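/- Let $\mathbb K$ be a field, $m\ge 1$ an integer and $A$ an infinite totally ordered alphabet. **Conventions.** The standardisation $\mathrm{std}(u)$ of a word $u$ over a totally ordered alphabet is obtained by numbering its letters $1,2,\dots$ from the smallest to the largest letter and, among equal letters, from left to right. A word is *$m$-stuttering* if each letter occurs in it a multiple of $m$ times. An *$m$-stuttering permutation of size $n$* is a rearrangement of $1^m2^m\cdots n^m$. Every $m$-stuttering word $u$ has a unique *$m$-standardisation* $\mathrm{std}^{(m)}(u)$, the $m$-stuttering permutation $\sigma$ with $\mathrm{std}(\sigma)=\mathrm{std}(u)$. For an $m$-stuttering permutation $\sigma$ let $$\mathbf G^{(m)}_\sigma=\mathbf G^{(m)}_\sigma(A)=\sum_{\mathrm{std}^{(m)}(u)=\sigma}u ,$$ the sum over the $m$-stuttering words $u$ over $A$, a noncommutative formal series in $A$ over $\mathbb K$, and let $\mathbf{FQSym}^{(m)}$ be the algebra generated by all the $\mathbf G^{(m)}_\sigma$ (for the concatenation product of series). For a second infinite totally ordered alphabet $B$, $A\hat+B$ is the ordered sum, in which all letters of $A$ are smaller than all letters of $B$; letting the letters of $A$ commute with those of $B$, a series over $A\hat+B$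 becomes an infinite sum of terms $u\otimes v$ with $u$ a word over $A$ and $v$ a word over $B$. **Statement.** 1. (Product) For all $m$-stuttering permutations $\sigma,\mu$, $$\mathbf G^{(m)}_\sigma\,\mathbf G^{(m)}_\mu=\sum_\nu\mathbf G^{(m)}_\nu ,$$ the (finite) sum over the $m$-stuttering permutations of the form $\nu=u\cdot v$ with $u,v$ $m$-stuttering words, $\mathrm{std}^{(m)}(u)=\sigma$, $\mathrm{std}^{(m)}(v)=\mu$. 2. (Coproduct) For every $m$-stuttering permutation $\sigma$ of size $n$, $$\mathbf G^{(m)}_\sigma(A\hat+B)=\sum_{(\mu,\nu)}\mathbf G^{(m)}_\mu(A)\otimes\mathbf G^{(m)}_\nu(B),$$ the (finite) sum over the pairs $(\mu,\nu)$ of $m$-stuttering permutations such that for some $k\le n$, $\mu$ is the subword of $\sigma$ formed by the letters $\le k$ and $\nu$ is the $m$-standardisation of the subword formed by the letters $>k$. 3. (Hopf algebra) The $\mathbf G^{(m)}_\sigma$ form a linear basis of $\mathbf{FQSym}^{(m)}$. With the product of series and with the coproduct $\Delta(\mathbf G^{(m)}_\sigma)=\mathbf G^{(m)}_\sigma(A\hat+A)=\sum\mathbf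 G^{(m)}_\mu\otimes\mathbf G^{(m)}_\nu$ (the same sum as in 2, with $B$ a copy of $A$), $\mathbf{FQSym}^{(m)}$ is a Hopf algebra. 4. (Dual) Let $\mathbf F^{(m)}_\sigma$ be the linear forms on $\mathbf{FQSym}^{(m)}$ dual to the basis $\mathbf G^{(m)}_\sigma$. Their linear span, with the product and the coproduct transposed from the coproduct and the product of $\mathbf{FQSym}^{(m)}$, is a Hopf algebra, the (graded) dual of $\mathbf{FQSym}^{(m)}$. 5. ($\mathbf{PBT}^{(m)}$) An *$m$-binary tree* is a binary tree that is either empty or composed of $m+1$ $m$-binary trees $T_L,T_{R_1},\dots,T_{R_m}$ grafted on $m$ root nodes: $T_L$ is the left subtree of the first root node, the right subtree of the $i$-th root node ($i<m$) is $T_{R_i}$ with the $(i+1)$-st root node grafted as left child of its leftmost node (if $T_{R_i}$ is empty, the $(i+1)$-st root node is itself the right child), and the right subtree of the $m$-th root node is $T_{R_m}$. For an $m$-stuttering permutation $\sigma$ let $\mathrm{ABR}(\sigma)$ be the shape of the binary search tree obtained by inserting the letters of $\sigma$ from right to left ($k$ goes to the left of a node $x$ if $k\le x$, otherwise to the right).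 For an $m$-binary tree $T$ with left-right mirror image $\tilde T$ let $$\mathbf P^{(m)}_T=\sum_{\mathrm{ABR}(\sigma)=\tilde T}\mathbf F^{(m)}_\sigma ,$$ the sum over a sylvester class of $m$-stuttering permutations. The $\mathbf P^{(m)}_T$, $T$ ranging over all $m$-binary trees, are linearly independent and span a Hopf subalgebra $\mathbf{PBT}^{(m)}$ of the Hopf algebra of 4. 6. (Products are $m$-Tamari intervals) Order the $m$-binary trees by the $m$-Tamari order, i.e. the restriction of the Tamari order on binary trees, whose relations are generated by the right rotations $y(x(A,B),C)\to x(A,y(B,C))$. For all $m$-binary trees $T_1,T_2$, $$\mathbf P^{(m)}_{T_1}\,\mathbf P^{(m)}_{T_2}=\sum_{T\in[T_-,T_+]}\mathbf P^{(m)}_T ,$$ where $T_-$ is $T_1$ with $T_2$ grafted to the left of its leftmost node, $T_+$ is $T_2$ with $T_1$ grafted to the right of its rightmost node, $T_-$ and $T_+$ are $m$-binary, and the interval is taken in the $m$-Tamari order on $m$-binary trees. -/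

import Mathlib

open scoped TensorProduct

noncomputable section

namespace MStut

/-! ### Words, standardisation, `m`-stuttering words and permutations -/

/-- The standardisation of a word `u`: its letters are numbered `1, 2, …` from the smallest to the
largest letter and, among equal letters, from left to right. -/
def std {A : Type*} [LinearOrder A] (u : List A) : List ℕ :=
  List.ofFn fun i : Fin u.length =>
    (Finset.univ.filter fun j : Fin u.length =>
      u.get j < u.get i ∨ (u.get j = u.get i ∧ j ≤ i)).card

/-- An `m`-stuttering word: every letter occurs a multiple of `m` times. -/
def IsStutWord {A : Type*} [LinearOrder A] (m : ℕ) (u : List A) : Prop :=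
  ∀ a : A, m ∣ u.count a

/-- The word `1^m 2^m ⋯ n^m`. -/
def blockWord (m n : ℕ) : List ℕ :=
  (List.range n).flatMap fun i => List.replicate m (i + 1)

/-- The `m`-stuttering permutations, of all sizes `n`: the rearrangements of `1^m 2^m ⋯ n^m`. -/
def StutPerm (m : ℕ) : Type :=
  {w : List ℕ // ∃ n : ℕ, w.Perm (blockWord m n)}

/-- The underlying word. -/
def StutPerm.word {m : ℕ} (σ : StutPerm m) : List ℕ := σ.1

/-- The size `n` of a rearrangement of `1^m 2^m ⋯ n^m`: its number of letters divided by `m`. -/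
def StutPerm.size {m : ℕ} (σ : StutPerm m) : ℕ := σ.word.length / m

/-- `σ` is an `m`-standardisation of the word `u`: the `m`-stuttering permutation `σ` has the same
standardisation as `u`. -/
def HasMStd {A : Type*} [LinearOrder A] {m : ℕ} (u : List A) (σ : StutPerm m) : Prop :=
  std u = std σ.word

/-! ### Noncommutative formal series and the elements `G` -/

/-- Formal series `∑ f(w) w` in the noncommuting letters of `A`, with coefficients in `K`. -/
def NCSeries (K A : Type*) : Type _ := List A → K

namespace NCSeries

variable {K A : Type*} [Field K]

instance : AddCommGroup (NCSeries K A) := inferInstanceAs (AddCommGroup (List A → K))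

instance : SMul K (NCSeries K A) where
  smul c f := fun w => c * f w

instance : Module K (NCSeries K A) where
  one_smul f := funext fun w => one_mul (f w)
  mul_smul c d f := funext fun w => mul_assoc c d (f w)
  smul_zero c := funext fun _ => mul_zero c
  smul_add c f g := funext fun w => mul_add c (f w) (g w)
  add_smul c d f := funext fun w => add_mul c d (f w)
  zero_smul f := funext fun w => zero_mul (f w)

instance : One (NCSeries K A) where
  one := fun w => match w with
    | [] => 1
    | _ :: _ => 0

/-- The concatenation product: the coefficient of `w` is the sum of `f(u) g(v)` over the
factorisations `w = u v`. -/
instance : Mul (NCSeries K A) where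
  mul f g := fun w => ∑ i ∈ Finset.range (w.length + 1), f (w.take i) * g (w.drop i)

theorem add_apply (f g : NCSeries K A) (w : List A) : (f + g) w = f w + g w := rfl

theorem zero_apply (w : List A) : (0 : NCSeries K A) w = 0 := rfl

theorem smul_apply (c : K) (f : NCSeries K A) (w : List A) : (c • f) w = c * f w := rfl

theorem one_apply_nil : (1 : NCSeries K A) [] = 1 := rfl

theorem one_apply_of_ne {w : List A} (h : w ≠ []) : (1 : NCSeries K A) w = 0 := by
  cases w with
  | nil => exact absurd rfl h
  | cons a w => rfl

theorem mul_apply (f g : NCSeries K A) (w : List A) :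
    (f * g) w = ∑ i ∈ Finset.range (w.length + 1), f (w.take i) * g (w.drop i) := rfl

theorem one_mul' (f : NCSeries K A) : 1 * f = f := by
  funext w
  rw [mul_apply, Finset.sum_eq_single 0]
  · rw [List.take_zero, List.drop_zero, one_apply_nil, one_mul]
  · intro i hi h0
    rw [one_apply_of_ne, zero_mul]
    intro h
    rcases List.take_eq_nil_iff.1 h with h | h
    · exact h0 h
    · subst h
      simp at hi
      exact h0 hi
  · intro h
    simp at h

theorem mul_one' (f : NCSeries K A) : f * 1 = f := by
  funext w
  rw [mul_apply, Finset.sum_eq_single w.length]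
  · rw [List.take_length, List.drop_length, one_apply_nil, mul_one]
  · intro i hi h0
    rw [one_apply_of_ne, mul_zero]
    intro h
    have h1 := List.drop_eq_nil_iff.1 h
    have h2 := Finset.mem_range.1 hi
    omega
  · intro h
    simp at h

theorem mul_assoc' (f g h : NCSeries K A) : f * g * h = f * (g * h) := by
  funext w
  simp only [mul_apply, Finset.sum_mul, Finset.mul_sum]
  rw [Finset.sum_sigma', Finset.sum_sigma']
  refine Finset.sum_bij' (fun p _ => ⟨p.2, p.1 - p.2⟩) (fun p _ => ⟨p.1 + p.2, p.1⟩)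
    ?_ ?_ ?_ ?_ ?_
  · rintro ⟨i, j⟩ hp
    simp only [Finset.mem_sigma, Finset.mem_range, List.length_take, List.length_drop] at hp ⊢
    omega
  · rintro ⟨i, j⟩ hp
    simp only [Finset.mem_sigma, Finset.mem_range, List.length_take, List.length_drop] at hp ⊢
    omega
  · rintro ⟨i, j⟩ hp
    simp only [Finset.mem_sigma, Finset.mem_range, List.length_take] at hp
    simp only [Sigma.mk.injEq, heq_eq_eq, and_true]
    omega
  · rintro ⟨i, j⟩ hp
    simp only [Sigma.mk.injEq, heq_eq_eq, true_and]
    omega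
  · rintro ⟨i, j⟩ hp
    simp only [Finset.mem_sigma, Finset.mem_range, List.length_take] at hp
    have hj : j ≤ i := by omega
    have e1 : (w.take i).take j = w.take j := by
      rw [List.take_take, min_eq_left hj]
    have e2 : (w.take i).drop j = (w.drop j).take (i - j) := List.drop_take
    have e3 : (w.drop j).drop (i - j) = w.drop i := by
      rw [List.drop_drop]
      congr 1
      omega
    simp only [e1, e2, e3, mul_assoc]

instance : Ring (NCSeries K A) where
  __ := (inferInstance : AddCommGroup (NCSeries K A))
  left_distrib f g h := by
    funext w
    simp only [mul_apply, add_apply, mul_add, Finset.sum_add_distrib]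
  right_distrib f g h := by
    funext w
    simp only [mul_apply, add_apply, add_mul, Finset.sum_add_distrib]
  zero_mul f := by
    funext w
    simp [mul_apply, zero_apply]
  mul_zero f := by
    funext w
    simp [mul_apply, zero_apply]
  mul_assoc := mul_assoc'
  one_mul := one_mul'
  mul_one := mul_one'

theorem smul_mul' (c : K) (f g : NCSeries K A) : c • f * g = c • (f * g) := by
  funext w
  simp only [mul_apply, smul_apply, Finset.mul_sum, mul_assoc]

theorem mul_smul' (c : K) (f g : NCSeries K A) : f * c • g = c • (f * g) := by
  funext w
  simp only [mul_apply, smul_apply, Finset.mul_sum]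
  exact Finset.sum_congr rfl fun i _ => by ring

instance : Algebra K (NCSeries K A) where
  algebraMap :=
    { toFun := fun c => c • (1 : NCSeries K A)
      map_one' := one_smul K _
      map_mul' := fun c d => by rw [smul_mul', one_mul, mul_smul]
      map_zero' := zero_smul K _
      map_add' := fun c d => add_smul c d _ }
  commutes' c f := by
    change c • (1 : NCSeries K A) * f = f * c • (1 : NCSeries K A)
    rw [smul_mul', mul_smul', one_mul, mul_one]
  smul_def' c f := by
    change c • f = c • (1 : NCSeries K A) * f
    rw [smul_mul', one_mul]

end NCSeries

open Classical in
/-- `G_σ^{(m)}(A)`: the sum of the `m`-stuttering words over `A` whose `m`-standardisation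
is `σ`. -/
def G (K A : Type*) [Field K] [LinearOrder A] {m : ℕ} (σ : StutPerm m) : NCSeries K A :=
  fun w => if IsStutWord m w ∧ HasMStd w σ then 1 else 0

/-- `FQSym^{(m)}`, the algebra generated by the series `G_σ^{(m)}(A)`. -/
def FQSym (K A : Type*) [Field K] [LinearOrder A] (m : ℕ) : Subalgebra K (NCSeries K A) :=
  Algebra.adjoin K (Set.range fun σ : StutPerm m => G K A σ)

/-- The index set of the product `G_σ G_μ`: the `m`-stuttering permutations `ν = u v` where `u`, `v`
are `m`-stuttering words with `m`-standardisations `σ` and `μ`. -/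
def prodSet {m : ℕ} (σ μ : StutPerm m) : Set (StutPerm m) :=
  {ν | ∃ u v : List ℕ, ν.word = u ++ v ∧ IsStutWord m u ∧ IsStutWord m v ∧
    HasMStd u σ ∧ HasMStd v μ}

/-- The index set of the coproduct of `G_σ`: the pairs `(μ, ν)` such that for some `k ≤ n`, `μ` is
the subword of `σ` of the letters `≤ k` and `ν` is the `m`-standardisation of the subword of the
letters `> k`. -/
def coprodSet {m : ℕ} (σ : StutPerm m) : Set (StutPerm m × StutPerm m) :=
  {p | ∃ k ≤ σ.size, p.1.word = σ.word.filter (fun a => a ≤ k) ∧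
    HasMStd (σ.word.filter (fun a => k < a)) p.2}

/-! ### Doubling the alphabet

`A ⊕ₗ B` is the ordered sum: the letters of `A` are smaller than those of `B`. When the
letters of `A` commute with those of `B`, a word over `A ⊕ₗ B` becomes a pair (word over `A`,
word over `B`), and a series becomes a function on such pairs. -/

/-- The subword of the letters from `A`. -/
def leftPart {A B : Type*} (w : List (A ⊕ₗ B)) : List A :=
  w.filterMap fun x => (ofLex x).getLeft?

/-- The subword of the letters from `B`. -/
def rightPart {A B : Type*} (w : List (A ⊕ₗ B)) : List B :=
  w.filterMap fun x => (ofLex x).getRight?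

/-- The series obtained from a series over `A ⊕ₗ B` by letting the letters of `A` commute with those
of `B`: the coefficient of `u ⊗ v` is the sum of the coefficients of the (finitely many) words `w`
whose subwords over `A` and `B` are `u` and `v`. -/
def separate {K A B : Type*} [Field K] (f : NCSeries K (A ⊕ₗ B)) : List A → List B → K :=
  fun u v => ∑ᶠ w ∈ {w : List (A ⊕ₗ B) | leftPart w = u ∧ rightPart w = v}, f w

/-- The external product `f ⊗ g` of a series over `A` and a series over `B`; the coefficient of
`u ⊗ v` is `f(u) g(v)`. -/
def seriesTensor (K A B : Type*) [Field K] :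
    NCSeries K A →ₗ[K] NCSeries K B →ₗ[K] (List A → List B → K) :=
  LinearMap.mk₂ K (fun f g u v => f u * g v)
    (fun f f' g => by funext u v; simp [NCSeries.add_apply, add_mul])
    (fun c f g => by funext u v; simp [NCSeries.smul_apply, mul_assoc])
    (fun f g g' => by funext u v; simp [NCSeries.add_apply, mul_add])
    (fun c f g => by funext u v; simp [NCSeries.smul_apply, mul_left_comm])

/-- The realisation of `FQSym^{(m)} ⊗ FQSym^{(m)}` as series in two mutually commuting copies
of `A`. -/
def realizeTensor (K A : Type*) [Field K] [LinearOrder A] (m : ℕ) :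
    (FQSym K A m) ⊗[K] (FQSym K A m) →ₗ[K] (List A → List A → K) :=
  TensorProduct.lift ((seriesTensor K A A).compl₁₂
    (FQSym K A m).val.toLinearMap (FQSym K A m).val.toLinearMap)

/-! ### Hopf algebras and duality

Mathlib's `HopfAlgebra K X` carries its own algebra structure. Here the algebra structure of `X` is
given beforehand, so the axioms are stated for a coalgebra structure on the given algebra. -/

section Hopf

variable (K : Type*) {X : Type*} [Field K] [Semiring X] [Algebra K X] [Coalgebra K X]

/-- `S` is an antipode: a two-sided convolution inverse of the identity. -/
def IsAntipode (S : X →ₗ[K] X) : Prop :=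
  LinearMap.mul' K X ∘ₗ S.rTensor X ∘ₗ CoalgebraStruct.comul =
    Algebra.linearMap K X ∘ₗ CoalgebraStruct.counit ∧
  LinearMap.mul' K X ∘ₗ S.lTensor X ∘ₗ CoalgebraStruct.comul =
    Algebra.linearMap K X ∘ₗ CoalgebraStruct.counit

variable (X) in
/-- The algebra `X` with its coalgebra structure is a Hopf algebra: the counit and the coproduct are
algebra morphisms, and there is an antipode. -/
structure IsHopf : Prop where
  counit_one : CoalgebraStruct.counit (R := K) (1 : X) = 1
  counit_mul : ∀ x y : X, CoalgebraStruct.counit (R := K) (x * y) =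
    CoalgebraStruct.counit (R := K) x * CoalgebraStruct.counit (R := K) y
  comul_one : CoalgebraStruct.comul (R := K) (1 : X) = 1
  comul_mul : ∀ x y : X, CoalgebraStruct.comul (R := K) (x * y) =
    CoalgebraStruct.comul (R := K) x * CoalgebraStruct.comul (R := K) y
  exists_antipode : ∃ S : X →ₗ[K] X, IsAntipode K S

/-- The Hopf algebra structure in Mathlib's sense. -/
abbrev IsHopf.toHopfAlgebra (h : IsHopf K X) : HopfAlgebra K X :=
  { Bialgebra.mk' K X h.counit_one (h.counit_mul _ _) h.comul_one (h.comul_mul _ _) with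
    antipode := h.exists_antipode.choose
    mul_antipode_rTensor_comul := h.exists_antipode.choose_spec.1
    mul_antipode_lTensor_comul := h.exists_antipode.choose_spec.2 }

/-- A subalgebra of a Hopf algebra that is a Hopf subalgebra: it is stable under the coproduct and
under the antipode. -/
def IsHopfSubalgebra (Q : Subalgebra K X) : Prop :=
  (∀ z ∈ Q, CoalgebraStruct.comul (R := K) z ∈
    LinearMap.range (TensorProduct.map Q.val.toLinearMap Q.val.toLinearMap)) ∧
  (∀ S : X →ₗ[K] X, IsAntipode K S → ∀ z ∈ Q, S z ∈ Q)

variable {K}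

/-- The linear forms on the coalgebra `X` form the convolution algebra `WithConv (X →ₗ[K] K)`, whose
product is the transpose of the coproduct: `⟨y * z, x⟩ = ⟨y ⊗ z, Δ x⟩`. This map sends an element of
a subalgebra `D` of it to the linear form that it is. -/
def toDual (D : Subalgebra K (WithConv (X →ₗ[K] K))) : D →ₗ[K] Module.Dual K X :=
  (WithConv.linearEquiv K (X →ₗ[K] K)).toLinearMap ∘ₗ D.val.toLinearMap

/-- The pairing `⟨y ⊗ z, a ⊗ b⟩ = ⟨y, a⟩ ⟨z, b⟩`. -/
def dualPairing (D : Subalgebra K (WithConv (X →ₗ[K] K))) :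
    D ⊗[K] D →ₗ[K] Module.Dual K (X ⊗[K] X) :=
  TensorProduct.dualDistrib K X X ∘ₗ TensorProduct.map (toDual D) (toDual D)

end Hopf

/-! ### Binary trees, the Tamari order and `m`-binary trees -/

/-- Binary trees: empty, or a root with a left and a right subtree. -/
abbrev BTree : Type := BinaryTree Unit

/-- The tree with left subtree `l` and right subtree `r`. -/
abbrev bnode (l r : BTree) : BTree := BinaryTree.node () l r

/-- Insertion of `k` in a binary search tree: to the left when `k ≤ root`, otherwise to the
right. -/
def bstInsert (k : ℕ) : BinaryTree ℕ → BinaryTree ℕ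
  | .nil => .node k .nil .nil
  | .node x l r => if k ≤ x then .node x (bstInsert k l) r else .node x l (bstInsert k r)

/-- The binary search tree of a word: its letters are inserted from right to left. -/
def bst (w : List ℕ) : BinaryTree ℕ := w.foldr bstInsert .nil

/-- The underlying unlabelled binary tree. -/
def shape (t : BinaryTree ℕ) : BTree := t.map fun _ => ()

/-- The left-right mirror image. -/
def mirror : BTree → BTree
  | .nil => .nil
  | .node _ l r => bnode (mirror r) (mirror l)

/-- `T` with `S` grafted as left child of its leftmost node. -/
def graftLeft (S : BTree) : BTree → BTree
  | .nil => S
  | .node _ l r => bnode (graftLeft S l) r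

/-- `T` with `S` grafted as right child of its rightmost node. -/
def graftRight (S : BTree) : BTree → BTree
  | .nil => S
  | .node _ l r => bnode l (graftRight S r)

/-- The binary tree built from `L` and `R₁, …, R_m` on `m` root nodes: `L` is the left subtree of
the first root node; its right subtree is `R₁` with the second root node grafted to the left of the
leftmost node of `R₁`; the right subtree of the second root node is `R₂` with the third root node
grafted in the same way, and so on; the right subtree of the last root node is `R_m`. -/
def rootChain (L : BTree) : List BTree → BTree
  | [] => L
  | R :: Rs => bnode L (graftLeft (rootChain .nil Rs) R)

/-- The `m`-binary trees: the empty tree, or `m + 1` `m`-binary trees grafted on `m` root nodes. -/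
inductive IsMBinary (m : ℕ) : BTree → Prop
  | nil : IsMBinary m .nil
  | chain (L : BTree) (Rs : List BTree) (hlen : Rs.length = m) (hL : IsMBinary m L)
      (hR : ∀ R ∈ Rs, IsMBinary m R) : IsMBinary m (rootChain L Rs)

/-- A right rotation at some node: `y(x(A, B), C)` becomes `x(A, y(B, C))`. -/
inductive Rotation : BTree → BTree → Prop
  | root (A B C : BTree) : Rotation (bnode (bnode A B) C) (bnode A (bnode B C))
  | left {S S' : BTree} (R : BTree) (h : Rotation S S') : Rotation (bnode S R) (bnode S' R)
  | right (L : BTree) {S S' : BTree} (h : Rotation S S') : Rotation (bnode L S) (bnode L S')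

/-- The Tamari order: `T'` is obtained from `T` by a sequence of right rotations. -/
def TamariLE (T T' : BTree) : Prop := Relation.ReflTransGen Rotation T T'

/-- The type of `m`-binary trees. -/
def MBinTree (m : ℕ) : Type := {T : BTree // IsMBinary m T}

/-- The underlying binary tree. -/
def MBinTree.tree {m : ℕ} (T : MBinTree m) : BTree := T.1

/-- The `m`-Tamari order on `m`-binary trees: the restriction of the Tamari order. -/
instance (m : ℕ) : Preorder (MBinTree m) where
  le T T' := TamariLE T.tree T'.tree
  le_refl _ := Relation.ReflTransGen.refl
  le_trans _ _ _ h h' := Relation.ReflTransGen.trans h h'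

/-- The sylvester class attached to the `m`-binary tree `T`: the `m`-stuttering permutations whose
binary search tree has the shape of the mirror image of `T`. -/
def sylvesterClass {m : ℕ} (T : MBinTree m) : Set (StutPerm m) :=
  {σ | shape (bst σ.word) = mirror T.tree}

end MStut

end

open scoped TensorProduct
open MStut

/-!
The coefficient of one word with standardisation `σ` detects `G_σ`, and cutting words in two gives
the product formula. Separating the small letters from the large ones in a word over `A ⊕ B` gives
the coproduct formula; so the coproduct is the restriction of `f ↦ f(A ⊕ A)`, which is
multiplicative. A graded bialgebra whose degree-zero part consists of the scalars has an antipode,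
the sum of the geometric series of `1 - id` for the convolution; the same series gives the antipode
of the dual and preserves every subalgebra that is stable under the coproduct.

A binary tree whose number of nodes is a multiple of `m` is `m`-binary if and only if its nodes
with a non-empty left subtree are preceded, in infix order, by a multiple of `m` nodes. The shapes
of the search trees of `m`-stuttering permutations are the mirror images of these trees. The trees
of the letters `> k` and of the letters `≤ k` of `ν` are the two parts into which the tree of `ν`
is split between two nodes consecutive in infix order. A tree splits into `U` and `V` if and only
if it lies in the Tamari interval from `U` grafted to the left of `V` to `V` grafted to the right
of `U`; this makes the products of the `P_T` intervals. The coproduct of `P_T` involves only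
sylvester classes since replacing `σ` and `μ` by congruent permutations does not change the number
of terms of `G_σ G_μ` in the class of `T`.
-/

noncomputable section

namespace MStut

/-! ### Standardisation -/

section Std

variable {A : Type*}

theorem card_filter_get (u : List A) (p : A → Prop) [DecidablePred p] :
    (Finset.univ.filter fun k : Fin u.length => p (u.get k)).card = u.countP fun a => p a := by
  conv_rhs => rw [← List.ofFn_get u]
  rw [← Multiset.coe_countP, ← Fin.univ_val_map, Multiset.countP_map]
  rfl

/-- The position `i` of `u` with its letter, in the order in which the letters are numbered by
`std`. -/
def stdKey (u : List A) (i : Fin u.length) : A ×ₗ Fin u.length :=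
  toLex (u.get i, i)

theorem stdKey_injective (u : List A) : Function.Injective (stdKey u) := fun i j h => by
  simpa [stdKey] using congrArg (fun x => (ofLex x).2) h

variable [LinearOrder A]

/-- The number of the position `i` in the standardisation. -/
def stdRank (u : List A) (i : Fin u.length) : ℕ :=
  (Finset.univ.filter fun j => stdKey u j ≤ stdKey u i).card

theorem stdKey_le_stdKey_of_lt {u : List A} {i j : Fin u.length} (hij : i < j) :
    stdKey u i ≤ stdKey u j ↔ u.get i ≤ u.get j := by
  simp only [stdKey, Prod.Lex.toLex_le_toLex, hij.le, and_true, ← le_iff_lt_or_eq]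

theorem stdKey_le_stdKey_of_gt {u : List A} {i j : Fin u.length} (hji : j < i) :
    stdKey u i ≤ stdKey u j ↔ ¬ u.get j ≤ u.get i := by
  rw [← stdKey_le_stdKey_of_lt hji, not_le, le_iff_lt_or_eq,
    or_iff_left ((stdKey_injective u).ne hji.ne')]

theorem stdRank_le_stdRank {u : List A} {i j : Fin u.length} :
    stdRank u i ≤ stdRank u j ↔ stdKey u i ≤ stdKey u j := by
  refine ⟨fun h => not_lt.1 fun hlt => h.not_gt (Finset.card_lt_card ?_), fun h => ?_⟩
  · refine (Finset.ssubset_iff_of_subset ?_).2 ⟨i, by simp, by simpa using hlt⟩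
    exact Finset.monotone_filter_right _ fun k _ hk => hk.trans hlt.le
  · exact Finset.card_le_card (Finset.monotone_filter_right _ fun k _ hk => hk.trans h)

theorem stdRank_injective (u : List A) : Function.Injective (stdRank u) := fun _ _ h =>
  stdKey_injective u (le_antisymm (stdRank_le_stdRank.1 h.le) (stdRank_le_stdRank.1 h.ge))

theorem countP_lt_stdRank (u : List A) (i : Fin u.length) :
    u.countP (fun a => a < u.get i) < stdRank u i := by
  rw [← card_filter_get]
  refine Finset.card_lt_card
    ((Finset.ssubset_iff_of_subset (Finset.monotone_filter_right _ fun k _ hk => ?_)).2 ⟨i, ?_⟩)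
  · exact Prod.Lex.toLex_le_toLex.2 (Or.inl hk)
  · simp

theorem stdRank_le_countP (u : List A) (i : Fin u.length) :
    stdRank u i ≤ u.countP (fun a => a ≤ u.get i) := by
  rw [← card_filter_get]
  refine Finset.card_le_card (Finset.monotone_filter_right _ fun k _ hk => ?_)
  exact (Prod.Lex.toLex_le_toLex.1 hk).elim le_of_lt fun h => h.1.le

theorem std_eq_ofFn (u : List A) : std u = List.ofFn (stdRank u) := by
  unfold std
  congr 1
  funext i
  simp [stdRank, stdKey, Prod.Lex.toLex_le_toLex]

@[simp] theorem length_std (u : List A) : (std u).length = u.length := by simp [std]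

theorem std_perm (u : List A) : (std u).Perm ((List.range u.length).map (· + 1)) := by
  refine List.Subperm.perm_of_length_le ?_ (by simp)
  rw [std_eq_ofFn]
  refine (List.nodup_ofFn.2 (stdRank_injective u)).subperm fun r hr => ?_
  obtain ⟨i, rfl⟩ := (List.mem_ofFn' _ _).1 hr
  have hpos : 0 < stdRank u i := (Nat.zero_le _).trans_lt (countP_lt_stdRank u i)
  have hle : stdRank u i ≤ u.length := (Finset.card_le_univ _).trans (by simp)
  exact List.mem_map.2 ⟨stdRank u i - 1, List.mem_range.2 (by omega), by omega⟩

end Std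

section SameStd

variable {A B C : Type*}

/-- Two words with the same length and the same inversions. This characterises having the same
standardisation, and is inherited by factors. -/
def SameStd [LE A] [LE B] (u : List A) (v : List B) : Prop :=
  u.length = v.length ∧ (u.zip v).Pairwise fun p q => p.1 ≤ q.1 ↔ p.2 ≤ q.2

section LE

variable [LE A] [LE B] [LE C] {u : List A} {v : List B} {w : List C}

theorem sameStd_iff_getElem :
    SameStd u v ↔ u.length = v.length ∧ ∀ i j (hiu : i < u.length) (hju : j < u.length)
      (hiv : i < v.length) (hjv : j < v.length), i < j → (u[i] ≤ u[j] ↔ v[i] ≤ v[j]) := by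
  refine and_congr_right fun _ => ?_
  simp only [List.pairwise_iff_getElem, List.length_zip, List.getElem_zip, lt_min_iff]
  exact ⟨fun H i j hiu hju hiv hjv => H i j ⟨hiu, hiv⟩ ⟨hju, hjv⟩,
    fun H i j hi hj => H i j hi.1 hj.1 hi.2 hj.2⟩

theorem SameStd.symm (h : SameStd u v) : SameStd v u := by
  rw [sameStd_iff_getElem] at h ⊢
  exact ⟨h.1.symm, fun i j hiv hjv hiu hju hij => (h.2 i j hiu hju hiv hjv hij).symm⟩

theorem SameStd.trans (h : SameStd u v) (h' : SameStd v w) : SameStd u w := by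
  rw [sameStd_iff_getElem] at h h' ⊢
  refine ⟨h.1.trans h'.1, fun i j hiu hju hiw hjw hij => ?_⟩
  exact (h.2 i j hiu hju (h.1 ▸ hiu) (h.1 ▸ hju) hij).trans
    (h'.2 i j (h.1 ▸ hiu) (h.1 ▸ hju) hiw hjw hij)

theorem SameStd.take (h : SameStd u v) (i : ℕ) : SameStd (u.take i) (v.take i) := by
  refine ⟨by simp [h.1], ?_⟩
  rw [List.zip, ← List.take_zipWith]
  exact h.2.sublist (List.take_sublist _ _)

theorem SameStd.drop (h : SameStd u v) (i : ℕ) : SameStd (u.drop i) (v.drop i) := by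
  refine ⟨by simp [h.1], ?_⟩
  rw [List.zip, ← List.drop_zipWith]
  exact h.2.sublist (List.drop_sublist _ _)

theorem sameStd_map (u : List A) (f : A → B) (h : ∀ a ∈ u, ∀ b ∈ u, (a ≤ b ↔ f a ≤ f b)) :
    SameStd u (u.map f) := by
  refine sameStd_iff_getElem.2 ⟨by simp, fun i j hiu hju hiv hjv _ => ?_⟩
  simp only [List.getElem_map]
  exact h _ (List.getElem_mem _) _ (List.getElem_mem _)

end LE

variable [LinearOrder A] [LinearOrder B] {u : List A} {v : List B}

theorem sameStd_std (u : List A) : SameStd u (std u) := by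
  refine sameStd_iff_getElem.2 ⟨by simp, fun i j hiu hju hiv hjv hij => ?_⟩
  simp only [std_eq_ofFn, List.getElem_ofFn]
  rw [stdRank_le_stdRank, stdKey_le_stdKey_of_lt (by simpa using hij)]
  rfl

theorem SameStd.stdKey_le_stdKey_iff (h : SameStd u v) (i j : Fin u.length) :
    stdKey u i ≤ stdKey u j ↔ stdKey v (i.cast h.1) ≤ stdKey v (j.cast h.1) := by
  obtain ⟨_, h⟩ := sameStd_iff_getElem.1 h
  rcases lt_trichotomy i j with hij | rfl | hji
  · rw [stdKey_le_stdKey_of_lt hij, stdKey_le_stdKey_of_lt (by simpa using hij)]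
    exact h i j _ _ _ _ hij
  · simp
  · rw [stdKey_le_stdKey_of_gt hji, stdKey_le_stdKey_of_gt (by simpa using hji)]
    exact not_congr (h j i _ _ _ _ hji)

theorem SameStd.std_eq (h : SameStd u v) : std u = std v := by
  refine List.ext_getElem (by simpa using h.1) fun i hi hi' => ?_
  simp only [std_eq_ofFn, List.getElem_ofFn]
  refine Finset.card_bijective (Fin.cast h.1) (finCongr h.1).bijective fun k => ?_
  simp only [Finset.mem_filter, Finset.mem_univ, true_and]
  exact h.stdKey_le_stdKey_iff k _

theorem std_eq_iff : std u = std v ↔ SameStd u v :=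
  ⟨fun h => (sameStd_std u).trans (h ▸ (sameStd_std v).symm), SameStd.std_eq⟩

end SameStd

/-! ### `m`-stuttering words and permutations -/

section IsStutWord

variable {A B : Type*} [LinearOrder A] [LinearOrder B] {m : ℕ} {u v : List A}

theorem IsStutWord.dvd_countP (h : IsStutWord m u) (p : A → Bool) : m ∣ u.countP p := by
  rw [← List.sum_map_count_dedup_filter_eq_countP]
  refine List.dvd_sum fun x hx => ?_
  obtain ⟨a, _, rfl⟩ := List.mem_map.1 hx
  exact h a

theorem IsStutWord.dvd_length (h : IsStutWord m u) : m ∣ u.length := by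
  simpa using h.dvd_countP fun _ => true

theorem IsStutWord.perm (h : IsStutWord m u) (huv : u.Perm v) : IsStutWord m v := fun a =>
  huv.count_eq a ▸ h a

theorem IsStutWord.filterMap (h : IsStutWord m u) (f : A → Option B) :
    IsStutWord m (u.filterMap f) := fun b => by
  rw [List.count_filterMap]
  exact h.dvd_countP _

theorem IsStutWord.map (h : IsStutWord m u) (f : A → B) : IsStutWord m (u.map f) := by
  simpa using h.filterMap (some ∘ f)

theorem IsStutWord.append (h : IsStutWord m u) (h' : IsStutWord m v) :
    IsStutWord m (u ++ v) := fun a => by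
  rw [List.count_append]
  exact dvd_add (h a) (h' a)

theorem IsStutWord.drop (h : IsStutWord m u) {i : ℕ} (hi : IsStutWord m (u.take i)) :
    IsStutWord m (u.drop i) := fun a => by
  have hu := h a
  rw [← List.take_append_drop i u, List.count_append] at hu
  exact (Nat.dvd_add_right (hi a)).1 hu

theorem IsStutWord.of_map_left {f : A → B} (huv : IsStutWord m (u ++ v))
    (hu : IsStutWord m (u.map f)) (h : ∀ a ∈ u, ∀ b ∈ v, f a = f b → a ≤ b) :
    IsStutWord m u := by
  intro c
  by_cases hcu : c ∈ u
  swap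
  · simp [List.count_eq_zero_of_not_mem hcu]
  by_cases hcv : c ∈ v
  swap
  · simpa [List.count_eq_zero_of_not_mem hcv] using huv c
  have hfiber : m ∣ u.countP fun d => f d = f c := by
    have := hu (f c)
    rwa [List.count, List.countP_map] at this
  have hlower : m ∣ u.countP fun d => f d = f c ∧ d < c := by
    have := huv.dvd_countP fun d => f d = f c ∧ d < c
    rwa [List.countP_append, List.countP_eq_zero (l := v) |>.2, add_zero] at this
    intro d hd
    simpa using fun hdc => h c hcu d hd (Eq.symm hdc)
  rw [List.countP_eq_countP_filter_add u _ fun d => d < c, List.countP_filter,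
    List.countP_filter] at hfiber
  simp only [← Bool.decide_and, ← decide_not, not_lt] at hfiber
  convert (Nat.dvd_add_right hlower).1 hfiber using 1
  refine List.countP_congr fun d hd => ?_
  simp only [beq_iff_eq, decide_eq_true_eq]
  exact ⟨fun hdc => ⟨hdc ▸ rfl, hdc.ge⟩, fun hdc => le_antisymm (h d hd c hcv hdc.1) hdc.2⟩

end IsStutWord

section blockWord

theorem blockWord_succ (m n : ℕ) :
    blockWord m (n + 1) = blockWord m n ++ List.replicate m (n + 1) := by
  simp [blockWord, List.range_succ]

theorem count_blockWord (m n a : ℕ) :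
    (blockWord m n).count a = if 1 ≤ a ∧ a ≤ n then m else 0 := by
  induction n with
  | zero => rw [if_neg (by omega), blockWord, List.range_zero, List.flatMap_nil, List.count_nil]
  | succ n ih =>
    rw [blockWord_succ, List.count_append, ih, List.count_replicate]
    by_cases h : a = n + 1
    · simp [h]
    · rw [if_neg (c := (n + 1 == a) = true) (by simpa using Ne.symm h), add_zero]
      exact if_congr (by omega) rfl rfl

theorem length_blockWord (m n : ℕ) : (blockWord m n).length = m * n := by
  simp [blockWord, mul_comm]

theorem perm_blockWord_iff {m n : ℕ} {w : List ℕ} :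
    w.Perm (blockWord m n) ↔ ∀ a, w.count a = if 1 ≤ a ∧ a ≤ n then m else 0 := by
  simp only [List.perm_iff_count, count_blockWord]

theorem map_div_range (m n : ℕ) [NeZero m] :
    (List.range (m * n)).map (fun r => r / m + 1) = blockWord m n := by
  have hm : 0 < m := Nat.pos_of_neZero m
  induction n with
  | zero => simp [blockWord]
  | succ n ih =>
    rw [blockWord_succ, ← ih, mul_add, mul_one, List.range_add, List.map_append, List.map_map]
    refine congrArg _ (List.eq_replicate_iff.2 ⟨by simp, fun b hb => ?_⟩)
    obtain ⟨x, hx, rfl⟩ := List.mem_map.1 hb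
    rw [Function.comp_apply, Nat.mul_add_div hm, Nat.div_eq_of_lt (List.mem_range.1 hx), add_zero]

end blockWord

namespace StutPerm

variable {m : ℕ}

theorem ext {σ τ : StutPerm m} (h : σ.word = τ.word) : σ = τ := Subtype.ext h

theorem isStutWord (σ : StutPerm m) : IsStutWord m σ.word := fun a => by
  obtain ⟨n, h⟩ := σ.2
  rw [word, perm_blockWord_iff.1 h]
  split_ifs <;> simp

/-- The empty permutation. -/
def empty (m : ℕ) : StutPerm m := ⟨[], 0, by simp [blockWord]⟩

@[simp] theorem word_empty : (empty m).word = [] := rfl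

@[simp] theorem size_empty : (empty m).size = 0 := Nat.zero_div m

variable [NeZero m]

theorem size_eq_of_perm (σ : StutPerm m) {n : ℕ} (h : σ.word.Perm (blockWord m n)) :
    σ.size = n := by
  rw [size, h.length_eq, length_blockWord, Nat.mul_div_cancel_left _ (Nat.pos_of_neZero m)]

theorem perm_size (σ : StutPerm m) : σ.word.Perm (blockWord m σ.size) := by
  obtain ⟨n, h⟩ := σ.2
  rwa [σ.size_eq_of_perm h]

theorem length_word (σ : StutPerm m) : σ.word.length = m * σ.size := by
  rw [σ.perm_size.length_eq, length_blockWord]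

theorem count_word (σ : StutPerm m) (a : ℕ) :
    σ.word.count a = if 1 ≤ a ∧ a ≤ σ.size then m else 0 :=
  perm_blockWord_iff.1 σ.perm_size a

theorem mem_word (σ : StutPerm m) (a : ℕ) : a ∈ σ.word ↔ 1 ≤ a ∧ a ≤ σ.size := by
  rw [← List.count_pos_iff, count_word]
  split_ifs with h
  · simp [h, Nat.pos_of_neZero m]
  · simp [h]

theorem eq_empty_of_size {σ : StutPerm m} (h : σ.size = 0) : σ = empty m := by
  refine ext (List.eq_nil_of_length_eq_zero ?_)
  rw [σ.length_word, h, mul_zero]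

theorem finite_size (n : ℕ) : {σ : StutPerm m | σ.size = n}.Finite := by
  refine Set.Finite.of_finite_image (f := word) ?_ fun σ _ τ _ h => ext h
  refine ((blockWord m n).permutations.toFinset.finite_toSet).subset ?_
  rintro _ ⟨σ, rfl, rfl⟩
  simpa using σ.perm_size

theorem perm_filter_le (σ : StutPerm m) (k : ℕ) :
    (σ.word.filter fun a => a ≤ k).Perm (blockWord m (min k σ.size)) := by
  refine perm_blockWord_iff.2 fun a => ?_
  by_cases h : a ≤ k
  · rw [List.count_filter (by simpa using h), σ.count_word]
    exact if_congr (by omega) rfl rfl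
  · rw [if_neg (by omega), List.count_eq_zero_of_not_mem (by simp [h])]

theorem perm_map_filter_lt (σ : StutPerm m) (k : ℕ) :
    ((σ.word.filter fun a => k < a).map (· - k)).Perm (blockWord m (σ.size - k)) := by
  refine perm_blockWord_iff.2 fun a => ?_
  rw [List.count, List.countP_map, List.countP_filter]
  by_cases ha : 1 ≤ a
  · trans σ.word.count (a + k)
    · refine List.countP_congr fun x _ => ?_
      simp only [Function.comp_apply, Bool.and_eq_true, beq_iff_eq, decide_eq_true_eq]
      omega
    · rw [σ.count_word]
      exact if_congr (by omega) rfl rfl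
  · rw [if_neg (by omega), List.countP_eq_zero]
    intro x _
    simp only [Function.comp_apply, Bool.and_eq_true, beq_iff_eq, decide_eq_true_eq]
    omega

/-- The subword of the letters `≤ k`: the left factors of the coproduct of `σ`. -/
def low (σ : StutPerm m) (k : ℕ) : StutPerm m :=
  ⟨σ.word.filter fun a => a ≤ k, min k σ.size, σ.perm_filter_le k⟩

/-- The `m`-standardisation of the subword of the letters `> k`: the right factors of the coproduct
of `σ`. -/
def high (σ : StutPerm m) (k : ℕ) : StutPerm m :=
  ⟨(σ.word.filter fun a => k < a).map (· - k), σ.size - k, σ.perm_map_filter_lt k⟩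

theorem word_low (σ : StutPerm m) (k : ℕ) : (σ.low k).word = σ.word.filter fun a => a ≤ k := rfl

theorem word_high (σ : StutPerm m) (k : ℕ) :
    (σ.high k).word = (σ.word.filter fun a => k < a).map (· - k) := rfl

theorem size_low (σ : StutPerm m) (k : ℕ) : (σ.low k).size = min k σ.size :=
  size_eq_of_perm _ (σ.perm_filter_le k)

theorem size_high (σ : StutPerm m) (k : ℕ) : (σ.high k).size = σ.size - k :=
  size_eq_of_perm _ (σ.perm_map_filter_lt k)

theorem sameStd_high (σ : StutPerm m) (k : ℕ) :
    SameStd (σ.word.filter fun a => k < a) (σ.high k).word := by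
  refine sameStd_map _ _ fun a ha b hb => ?_
  have hka : k < a := by simpa using (List.mem_filter.1 ha).2
  have hkb : k < b := by simpa using (List.mem_filter.1 hb).2
  omega

theorem countP_le (σ : StutPerm m) (k : ℕ) :
    σ.word.countP (fun a => a ≤ k) = m * min k σ.size := by
  rw [List.countP_eq_length_filter, (σ.perm_filter_le k).length_eq, length_blockWord]

end StutPerm

/-! ### Existence and uniqueness of the `m`-standardisation -/

section MStd

variable {A : Type*} [LinearOrder A] {m : ℕ} {u : List A} {σ : StutPerm m}

/-- The word `std^{(m)}(u)`: the `i`-th group of `m` consecutive numbers in `std u` is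
replaced by `i`. -/
def mStdWord (m : ℕ) (u : List A) : List ℕ :=
  (std u).map fun r => (r - 1) / m + 1

@[simp] theorem length_mStdWord (m : ℕ) (u : List A) : (mStdWord m u).length = u.length := by
  simp [mStdWord]

theorem getElem_mStdWord (m : ℕ) (u : List A) {i : ℕ} (hi : i < u.length) :
    (mStdWord m u)[i]'(by simpa) = (stdRank u ⟨i, hi⟩ - 1) / m + 1 := by
  simp [mStdWord, std_eq_ofFn]

theorem hasMStd_iff : HasMStd u σ ↔ SameStd u σ.word := std_eq_iff

theorem HasMStd.length_eq (h : HasMStd u σ) : u.length = σ.word.length := (hasMStd_iff.1 h).1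

variable [NeZero m]

/- The ranks of the positions with letter `u[i]` lie in `(c, c']`, where `c` and `c'` count the
letters `< u[i]` and `≤ u[i]`; both are multiples of `m` when `u` is stuttering. -/
theorem IsStutWord.mStdWord_lt (hu : IsStutWord m u) {i j : ℕ} (hi : i < u.length)
    (hj : j < u.length) (hij : u[i] < u[j]) :
    (mStdWord m u)[i]'(by simpa) < (mStdWord m u)[j]'(by simpa) := by
  have hm : 0 < m := Nat.pos_of_neZero m
  rw [getElem_mStdWord m u hi, getElem_mStdWord m u hj, add_lt_add_iff_right]
  obtain ⟨t, ht⟩ := hu.dvd_countP fun a => a ≤ u[i]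
  have hle : u.countP (fun a => a ≤ u[i]) ≤ u.countP fun a => a < u[j] :=
    List.countP_mono_left fun a _ => by simpa using fun ha : a ≤ u[i] => ha.trans_lt hij
  have hri : stdRank u ⟨i, hi⟩ ≤ m * t := ht ▸ stdRank_le_countP u ⟨i, hi⟩
  have hrj : m * t < stdRank u ⟨j, hj⟩ := (ht ▸ hle).trans_lt (countP_lt_stdRank u ⟨j, hj⟩)
  have hpos : 0 < stdRank u ⟨i, hi⟩ := (Nat.zero_le _).trans_lt (countP_lt_stdRank u ⟨i, hi⟩)
  calc (stdRank u ⟨i, hi⟩ - 1) / m < t := by rw [Nat.div_lt_iff_lt_mul hm, mul_comm]; omega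
    _ ≤ (stdRank u ⟨j, hj⟩ - 1) / m := by rw [Nat.le_div_iff_mul_le hm, mul_comm]; omega

theorem IsStutWord.sameStd_mStdWord (hu : IsStutWord m u) : SameStd u (mStdWord m u) := by
  refine sameStd_iff_getElem.2 ⟨by simp, fun i j hi hj _ _ hij => ⟨fun h => ?_, fun h => ?_⟩⟩
  · rw [getElem_mStdWord m u hi, getElem_mStdWord m u hj]
    gcongr
    exact stdRank_le_stdRank.2 ((stdKey_le_stdKey_of_lt (by simpa using hij)).2 h)
  · exact not_lt.1 fun hlt => h.not_gt (hu.mStdWord_lt hj hi hlt)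

theorem mStdWord_perm {n : ℕ} (h : u.length = m * n) : (mStdWord m u).Perm (blockWord m n) := by
  refine ((std_perm u).map _).trans (List.Perm.of_eq ?_)
  rw [List.map_map, h, ← map_div_range m n]
  rfl

theorem StutPerm.mStdWord_word (σ : StutPerm m) : mStdWord m σ.word = σ.word := by
  refine List.ext_getElem (by simp) fun i _ hi => ?_
  rw [getElem_mStdWord m _ hi]
  obtain ⟨hpos, hsize⟩ := (σ.mem_word _).1 (List.getElem_mem hi)
  have hlt := countP_lt_stdRank σ.word ⟨i, hi⟩
  have hle := stdRank_le_countP σ.word ⟨i, hi⟩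
  obtain ⟨c, hc⟩ : ∃ c, σ.word[i] = c + 1 := ⟨_, (Nat.sub_add_cancel hpos).symm⟩
  simp only [List.get_eq_getElem, hc, Nat.lt_succ_iff] at hlt hle hsize
  rw [σ.countP_le, min_eq_left (by omega)] at hlt
  rw [σ.countP_le, min_eq_left hsize] at hle
  rw [hc, Nat.div_eq_of_lt_le (k := c)] <;> rw [mul_comm] <;> omega

theorem HasMStd.word_eq (h : HasMStd u σ) : σ.word = mStdWord m u := by
  rw [← σ.mStdWord_word, mStdWord, mStdWord, show std u = std σ.word from h]

theorem HasMStd.unique {τ : StutPerm m} (hσ : HasMStd u σ) (hτ : HasMStd u τ) : σ = τ :=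
  StutPerm.ext (hσ.word_eq.trans hτ.word_eq.symm)

theorem IsStutWord.exists_hasMStd (hu : IsStutWord m u) : ∃ σ : StutPerm m, HasMStd u σ := by
  obtain ⟨n, hn⟩ := hu.dvd_length
  exact ⟨⟨mStdWord m u, n, mStdWord_perm hn⟩, hasMStd_iff.2 hu.sameStd_mStdWord⟩

theorem IsStutWord.existsUnique_hasMStd (hu : IsStutWord m u) :
    ∃! σ : StutPerm m, HasMStd u σ :=
  hu.exists_hasMStd.imp fun _ hσ => ⟨hσ, fun _ hτ => hτ.unique hσ⟩

theorem HasMStd.exists_map [Nonempty A] (hu : IsStutWord m u) (h : HasMStd u σ) :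
    ∃ f : ℕ → A, u = σ.word.map f ∧ ∀ a ∈ σ.word, ∀ b ∈ σ.word, f a < f b → a < b := by
  have hlt : ∀ i j : Fin σ.word.length, u.get (i.cast h.length_eq.symm) <
      u.get (j.cast h.length_eq.symm) → σ.word.get i < σ.word.get j := fun i j hij => by
    have := hu.mStdWord_lt _ _ hij
    simp only [← h.word_eq] at this
    exact this
  have hfac : Function.FactorsThrough (fun i => u.get (Fin.cast h.length_eq.symm i))
      σ.word.get := fun i j hij =>
    le_antisymm (not_lt.1 fun hji => (hlt j i hji).ne' hij) (not_lt.1 fun h => (hlt i j h).ne hij)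
  let f : ℕ → A := Function.extend σ.word.get (fun i => u.get (i.cast h.length_eq.symm))
    fun _ => Classical.arbitrary A
  have hf : ∀ i, f (σ.word.get i) = u.get (i.cast h.length_eq.symm) := hfac.extend_apply _
  refine ⟨f, List.ext_getElem (by simp [h.length_eq]) fun i hi hi' => ?_, fun a ha b hb hab => ?_⟩
  · simpa using (hf ⟨i, h.length_eq ▸ hi⟩).symm
  · obtain ⟨i, rfl⟩ := List.get_of_mem ha
    obtain ⟨j, rfl⟩ := List.get_of_mem hb
    exact hlt i j (by rwa [← hf i, ← hf j])

theorem StutPerm.exists_hasMStd (A : Type*) [LinearOrder A] [Infinite A] (σ : StutPerm m) :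
    ∃ w : List A, IsStutWord m w ∧ HasMStd w σ := by
  obtain ⟨s, hs⟩ := Infinite.exists_subset_card_eq A (σ.size + 1)
  let g : ℕ → A := fun a => s.orderEmbOfFin hs (Fin.ofNat _ a)
  refine ⟨σ.word.map g, σ.isStutWord.map g,
    hasMStd_iff.2 (sameStd_map _ _ fun a ha b hb => ?_).symm⟩
  have ha' := (σ.mem_word a).1 ha
  have hb' := (σ.mem_word b).1 hb
  simp only [g, OrderEmbedding.le_iff_le, Fin.le_def, Fin.ofNat]
  rw [Nat.mod_eq_of_lt (by omega), Nat.mod_eq_of_lt (by omega)]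

end MStd

/-! ### The product -/

section prodSet

variable {m : ℕ} {σ μ ν : StutPerm m}

theorem mem_prodSet : ν ∈ prodSet σ μ ↔
    IsStutWord m (ν.word.take σ.word.length) ∧ IsStutWord m (ν.word.drop σ.word.length) ∧
      HasMStd (ν.word.take σ.word.length) σ ∧ HasMStd (ν.word.drop σ.word.length) μ := by
  constructor
  · rintro ⟨u, v, h, hu, hv, hσ, hμ⟩
    rw [h, List.take_left' hσ.length_eq, List.drop_left' hσ.length_eq]
    exact ⟨hu, hv, hσ, hμ⟩
  · rintro ⟨hu, hv, hσ, hμ⟩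
    exact ⟨_, _, (List.take_append_drop _ _).symm, hu, hv, hσ, hμ⟩

theorem length_of_mem_prodSet (h : ν ∈ prodSet σ μ) :
    ν.word.length = σ.word.length + μ.word.length := by
  obtain ⟨u, v, h, -, -, hσ, hμ⟩ := h
  rw [h, List.length_append, hσ.length_eq, hμ.length_eq]

variable [NeZero m]

theorem size_of_mem_prodSet (h : ν ∈ prodSet σ μ) : ν.size = σ.size + μ.size := by
  have hl := length_of_mem_prodSet h
  rw [ν.length_word, σ.length_word, μ.length_word, ← mul_add] at hl
  exact Nat.eq_of_mul_eq_mul_left (Nat.pos_of_neZero m) hl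

theorem finite_prodSet (σ μ : StutPerm m) : (prodSet σ μ).Finite :=
  (StutPerm.finite_size (σ.size + μ.size)).subset fun _ => size_of_mem_prodSet

variable {A : Type*} [LinearOrder A] [Nonempty A] {w : List A}

theorem HasMStd.isStutWord_take_iff (hw : IsStutWord m w) (h : HasMStd w ν) (i : ℕ) :
    IsStutWord m (w.take i) ↔ IsStutWord m (ν.word.take i) := by
  obtain ⟨f, rfl, -⟩ := h.exists_map hw
  rw [← List.map_take]
  refine ⟨fun hst => IsStutWord.of_map_left (v := ν.word.drop i) (f := f) ?_ hst ?_, fun hst =>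
    hst.map f⟩
  · rw [List.take_append_drop]
    exact ν.isStutWord
  · intro a ha b hb hab
    obtain ⟨p, hp, rfl⟩ := List.getElem_of_mem ha
    obtain ⟨q, hq, rfl⟩ := List.getElem_of_mem hb
    simp only [List.length_take, List.length_drop, lt_min_iff] at hp hq
    simp only [List.getElem_take, List.getElem_drop] at hab ⊢
    have hiff := (sameStd_iff_getElem.1 (hasMStd_iff.1 h)).2 p (i + q)
    simp only [List.length_map, List.getElem_map] at hiff
    exact (hiff hp.2 (by omega) hp.2 (by omega) (by omega)).1 hab.le

theorem exists_mem_prodSet_iff (σ μ : StutPerm m) (w : List A) :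
    (∃ ν ∈ prodSet σ μ, IsStutWord m w ∧ HasMStd w ν) ↔
      (IsStutWord m (w.take σ.word.length) ∧ HasMStd (w.take σ.word.length) σ) ∧
      (IsStutWord m (w.drop σ.word.length) ∧ HasMStd (w.drop σ.word.length) μ) := by
  simp only [hasMStd_iff, mem_prodSet]
  constructor
  · rintro ⟨ν, ⟨htake, -, hσ, hμ⟩, hw, hν⟩
    have htake' := ((hasMStd_iff.2 hν).isStutWord_take_iff hw _).2 htake
    exact ⟨⟨htake', (hν.take _).trans hσ⟩, hw.drop htake', (hν.drop _).trans hμ⟩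
  · rintro ⟨⟨htake, hσ⟩, hdrop, hμ⟩
    have hw : IsStutWord m w := List.take_append_drop σ.word.length w ▸ htake.append hdrop
    obtain ⟨ν, hν⟩ := hw.exists_hasMStd
    have htake' := (hν.isStutWord_take_iff hw _).1 htake
    rw [hasMStd_iff] at hν
    exact ⟨ν, ⟨htake', ν.isStutWord.drop htake', (hν.take _).symm.trans hσ,
      (hν.drop _).symm.trans hμ⟩, hw, hν⟩

end prodSet

theorem sum_eq_indicator {ι M : Type*} [AddCommMonoidWithOne M] (s : Finset ι) (p : ι → Prop)
    [DecidablePred p] [Decidable (∃ i ∈ s, p i)]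
    (h : ∀ i ∈ s, ∀ j ∈ s, p i → p j → i = j) :
    ∑ i ∈ s, (if p i then (1 : M) else 0) = if ∃ i ∈ s, p i then 1 else 0 := by
  split_ifs with hex
  · obtain ⟨i, hi, hp⟩ := hex
    rw [Finset.sum_eq_single_of_mem i hi fun j hj hji =>
      if_neg fun hpj => hji (h j hj i hi hpj hp), if_pos hp]
  · push Not at hex
    exact Finset.sum_eq_zero fun i hi => if_neg (hex i hi)

section Product

theorem NCSeries.sum_apply {K A ι : Type*} [Field K] (s : Finset ι) (f : ι → NCSeries K A)
    (w : List A) : (∑ i ∈ s, f i) w = ∑ i ∈ s, f i w :=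
  Finset.sum_apply w s f

variable (K A B : Type*) [Field K] [LinearOrder A] [LinearOrder B] {m : ℕ}

open Classical in
theorem G_apply (σ : StutPerm m) (w : List A) :
    G K A σ w = if IsStutWord m w ∧ HasMStd w σ then 1 else 0 := rfl

variable {A} in
theorem G_apply_of_length_ne {σ : StutPerm m} {w : List A} (h : w.length ≠ σ.word.length) :
    G K A σ w = 0 := if_neg fun hw => h hw.2.length_eq

open Classical in
theorem G_apply_mul_G_apply (σ μ : StutPerm m) (u : List A) (v : List B) :
    G K A σ u * G K B μ v =
      if (IsStutWord m u ∧ HasMStd u σ) ∧ (IsStutWord m v ∧ HasMStd v μ) then 1 else 0 := by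
  rw [G_apply, G_apply, ite_zero_mul_ite_zero, mul_one]

theorem G_empty (m : ℕ) : G K A (StutPerm.empty m) = 1 := by
  funext w
  by_cases hw : w = []
  · subst hw
    exact if_pos ⟨fun _ => dvd_zero m, rfl⟩
  · rw [NCSeries.one_apply_of_ne hw, G_apply_of_length_ne]
    simpa using hw

theorem G_mul_G [Nonempty A] [NeZero m] (σ μ : StutPerm m) :
    G K A σ * G K A μ = ∑ ν ∈ (finite_prodSet σ μ).toFinset, G K A ν := by
  classical
  funext w
  have hlength : ∀ i, (w.take i).length ≠ σ.word.length →
      G K A σ (w.take i) * G K A μ (w.drop i) = 0 := fun i hi => by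
    rw [G_apply_of_length_ne K hi, zero_mul]
  calc (G K A σ * G K A μ) w
      = G K A σ (w.take σ.word.length) * G K A μ (w.drop σ.word.length) := by
        refine (NCSeries.mul_apply _ _ _).trans (Finset.sum_eq_single _ ?_ ?_) <;>
        · intros
          apply hlength
          simp_all only [Finset.mem_range, List.length_take]
          omega
    _ = if ∃ ν ∈ (finite_prodSet σ μ).toFinset, IsStutWord m w ∧ HasMStd w ν then 1 else 0 := by
        rw [G_apply_mul_G_apply]
        simp only [Set.Finite.mem_toFinset, exists_mem_prodSet_iff]
    _ = (∑ ν ∈ (finite_prodSet σ μ).toFinset, G K A ν) w := by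
        rw [NCSeries.sum_apply]
        exact (sum_eq_indicator _ _ fun ν _ ν' _ h h' => h.2.unique h'.2).symm

end Product

/-! ### Words over the doubled alphabet -/

section Double

variable {A B : Type*}

@[simp] theorem leftPart_nil : leftPart ([] : List (A ⊕ₗ B)) = [] := rfl

@[simp] theorem rightPart_nil : rightPart ([] : List (A ⊕ₗ B)) = [] := rfl

@[simp] theorem leftPart_inl (a : A) (w : List (A ⊕ₗ B)) :
    leftPart (Sum.inlₗ a :: w) = a :: leftPart w := rfl

@[simp] theorem leftPart_inr (b : B) (w : List (A ⊕ₗ B)) :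
    leftPart (Sum.inrₗ b :: w) = leftPart w := rfl

@[simp] theorem rightPart_inl (a : A) (w : List (A ⊕ₗ B)) :
    rightPart (Sum.inlₗ a :: w) = rightPart w := rfl

@[simp] theorem rightPart_inr (b : B) (w : List (A ⊕ₗ B)) :
    rightPart (Sum.inrₗ b :: w) = b :: rightPart w := rfl

theorem leftPart_append (w w' : List (A ⊕ₗ B)) :
    leftPart (w ++ w') = leftPart w ++ leftPart w' := List.filterMap_append

theorem rightPart_append (w w' : List (A ⊕ₗ B)) :
    rightPart (w ++ w') = rightPart w ++ rightPart w' := List.filterMap_append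

@[elab_as_elim]
theorem sumLex_cases {P : A ⊕ₗ B → Prop} (inl : ∀ a, P (Sum.inlₗ a)) (inr : ∀ b, P (Sum.inrₗ b))
    (x : A ⊕ₗ B) : P x :=
  match h : ofLex x with
  | .inl a => toLex_ofLex x ▸ h ▸ inl a
  | .inr b => toLex_ofLex x ▸ h ▸ inr b

theorem perm_leftPart_append_rightPart (w : List (A ⊕ₗ B)) :
    ((leftPart w).map Sum.inlₗ ++ (rightPart w).map Sum.inrₗ).Perm w := by
  induction w with
  | nil => rfl
  | cons x w ih =>
    induction x using sumLex_cases with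
    | inl a => exact ih.cons _
    | inr b => exact List.perm_middle.trans (ih.cons _)

theorem isStutWord_iff_parts [LinearOrder A] [LinearOrder B] {m : ℕ} {w : List (A ⊕ₗ B)} :
    IsStutWord m w ↔ IsStutWord m (leftPart w) ∧ IsStutWord m (rightPart w) :=
  ⟨fun h => ⟨h.filterMap _, h.filterMap _⟩, fun h =>
    ((h.1.map _).append (h.2.map _)).perm (perm_leftPart_append_rightPart w)⟩

/-- The pattern of the letters from `A`: together with the two parts of a word, it determines the
word. -/
def sides (w : List (A ⊕ₗ B)) : List Bool := w.map fun x => (ofLex x).isLeft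

@[simp] theorem sides_inl (a : A) (w : List (A ⊕ₗ B)) :
    sides (Sum.inlₗ a :: w) = true :: sides w := rfl

@[simp] theorem sides_inr (b : B) (w : List (A ⊕ₗ B)) :
    sides (Sum.inrₗ b :: w) = false :: sides w := rfl

theorem eq_of_sides_eq {w w' : List (A ⊕ₗ B)} (h : sides w = sides w')
    (hl : leftPart w = leftPart w') (hr : rightPart w = rightPart w') : w = w' := by
  induction w generalizing w' with
  | nil => exact (List.map_eq_nil_iff.1 h.symm).symm
  | cons x w ih =>
    cases w' with
    | nil => exact absurd h (List.cons_ne_nil _ _)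
    | cons x' w' =>
      induction x using sumLex_cases <;> induction x' using sumLex_cases <;>
      simp only [sides_inl, sides_inr, leftPart_inl, leftPart_inr, rightPart_inl, rightPart_inr,
        List.cons.injEq, true_and, Bool.true_eq_false, Bool.false_eq_true, false_and] at h hl hr
      · rw [hl.1, ih h hl.2 hr]
      · rw [hr.1, ih h hl hr.2]

theorem finite_parts (u : List A) (v : List B) :
    {w : List (A ⊕ₗ B) | leftPart w = u ∧ rightPart w = v}.Finite := by
  refine Set.Finite.of_finite_image (f := sides)
    ((List.finite_length_eq Bool (u.length + v.length)).subset ?_) ?_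
  · rintro _ ⟨w, ⟨rfl, rfl⟩, rfl⟩
    simpa [sides] using (perm_leftPart_append_rightPart w).length_eq.symm
  · rintro w ⟨hl, hr⟩ w' ⟨hl', hr'⟩ h
    exact eq_of_sides_eq h (hl.trans hl'.symm) (hr.trans hr'.symm)

/-- The letters from `A` of the word over `A ⊕ₗ B` are at the places of the letters `≤ k` of the
word over `ℕ`. -/
inductive SplitsAt (k : ℕ) : List (A ⊕ₗ B) → List ℕ → Prop
  | nil : SplitsAt k [] []
  | inl {w : List (A ⊕ₗ B)} {s : List ℕ} (x : A) {a : ℕ} (ha : a ≤ k) (h : SplitsAt k w s) :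
      SplitsAt k (Sum.inlₗ x :: w) (a :: s)
  | inr {w : List (A ⊕ₗ B)} {s : List ℕ} (x : B) {a : ℕ} (ha : k < a) (h : SplitsAt k w s) :
      SplitsAt k (Sum.inrₗ x :: w) (a :: s)

variable {k : ℕ} {w : List (A ⊕ₗ B)} {s : List ℕ}

theorem SplitsAt.sides_eq (h : SplitsAt k w s) : sides w = s.map fun a => decide (a ≤ k) := by
  induction h with
  | nil => rfl
  | inl x ha _ ih => simp [ih, ha]
  | inr x ha _ ih => simp [ih, ha]

theorem exists_splitsAt (k : ℕ) (s : List ℕ) (u : List A) (v : List B)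
    (hu : u.length = (s.filter fun a => a ≤ k).length)
    (hv : v.length = (s.filter fun a => k < a).length) :
    ∃ w : List (A ⊕ₗ B), SplitsAt k w s ∧ leftPart w = u ∧ rightPart w = v := by
  induction s generalizing u v with
  | nil =>
    obtain rfl := List.eq_nil_of_length_eq_zero hu
    obtain rfl := List.eq_nil_of_length_eq_zero hv
    exact ⟨[], SplitsAt.nil, rfl, rfl⟩
  | cons a s ih =>
    rcases le_or_gt a k with ha | ha
    · cases u with
      | nil => simp [ha] at hu
      | cons x u =>
        obtain ⟨w, hw, rfl, rfl⟩ := ih u v (by simpa [ha] using hu) (by simpa [ha.not_gt] using hv)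
        exact ⟨Sum.inlₗ x :: w, hw.inl x ha, rfl, rfl⟩
    · cases v with
      | nil => simp [ha] at hv
      | cons x v =>
        obtain ⟨w, hw, rfl, rfl⟩ := ih u v (by simpa [ha.not_ge] using hu) (by simpa [ha] using hv)
        exact ⟨Sum.inrₗ x :: w, hw.inr x ha, rfl, rfl⟩

theorem splitsAt_map {f : ℕ → A ⊕ₗ B} (h : ∀ a ∈ s, (ofLex (f a)).isLeft ↔ a ≤ k) :
    SplitsAt k (s.map f) s := by
  induction s with
  | nil => exact SplitsAt.nil
  | cons a s ih =>
    obtain ⟨ha, hs⟩ := List.forall_mem_cons.1 h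
    rw [List.map_cons]
    generalize f a = x at ha
    induction x using sumLex_cases with
    | inl x => exact (ih hs).inl x (ha.1 rfl)
    | inr x => exact (ih hs).inr x (not_le.1 fun hle => Bool.false_ne_true (ha.2 hle))

theorem sameStd_cons [LE A] [LE B] {a : A} {b : B} {u : List A} {v : List B} :
    SameStd (a :: u) (b :: v) ↔ (∀ p ∈ u.zip v, (a ≤ p.1 ↔ b ≤ p.2)) ∧ SameStd u v := by
  simp only [SameStd, List.length_cons, List.zip_cons_cons, List.pairwise_cons, add_left_inj]
  tauto

theorem SplitsAt.forall_mem_zip (h : SplitsAt k w s) (Q : (A ⊕ₗ B) × ℕ → Prop) :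
    (∀ p ∈ w.zip s, Q p) ↔
      (∀ p ∈ (leftPart w).zip (s.filter fun a => a ≤ k), Q (Sum.inlₗ p.1, p.2)) ∧
      (∀ p ∈ (rightPart w).zip (s.filter fun a => k < a), Q (Sum.inrₗ p.1, p.2)) := by
  induction h with
  | nil => simp
  | inl x ha _ ih =>
    rw [List.filter_cons_of_pos (by simpa), List.filter_cons_of_neg (by simpa)]
    simp only [List.zip_cons_cons, List.forall_mem_cons, ih, leftPart_inl, rightPart_inl, and_assoc]
  | inr x ha _ ih =>
    rw [List.filter_cons_of_neg (by simpa), List.filter_cons_of_pos (by simpa)]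
    simp only [List.zip_cons_cons, List.forall_mem_cons, ih, leftPart_inr, rightPart_inr]
    tauto

variable [LinearOrder A] [LinearOrder B]

theorem SplitsAt.sameStd_iff (h : SplitsAt k w s) : SameStd w s ↔
    SameStd (leftPart w) (s.filter fun a => a ≤ k) ∧
      SameStd (rightPart w) (s.filter fun a => k < a) := by
  induction h with
  | nil => simp [SameStd]
  | @inl w s x a ha hw ih =>
    have hcross : ∀ p ∈ (rightPart w).zip (s.filter fun a => k < a),
        (Sum.inlₗ x ≤ Sum.inrₗ p.1 ↔ a ≤ p.2) := fun p hp => by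
      have hp' : k < p.2 := by simpa using (List.mem_filter.1 (List.of_mem_zip hp).2).2
      exact iff_of_true (Sum.Lex.inl_le_inr _ _) (ha.trans hp'.le)
    rw [List.filter_cons_of_pos (by simpa), List.filter_cons_of_neg (by simpa), sameStd_cons,
      hw.forall_mem_zip, ih, leftPart_inl, rightPart_inl, sameStd_cons]
    simp only [Sum.Lex.inl_le_inl_iff]
    tauto
  | @inr w s x a ha hw ih =>
    have hcross : ∀ p ∈ (leftPart w).zip (s.filter fun a => a ≤ k),
        (Sum.inrₗ x ≤ Sum.inlₗ p.1 ↔ a ≤ p.2) := fun p hp => by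
      have hp' : p.2 ≤ k := by simpa using (List.mem_filter.1 (List.of_mem_zip hp).2).2
      exact iff_of_false Sum.Lex.not_inr_le_inl (hp'.trans_lt ha).not_ge
    rw [List.filter_cons_of_neg (by simpa), List.filter_cons_of_pos (by simpa), sameStd_cons,
      hw.forall_mem_zip, ih, leftPart_inr, rightPart_inr, sameStd_cons]
    simp only [Sum.Lex.inr_le_inr_iff]
    tauto

theorem HasMStd.exists_splitsAt {m : ℕ} [NeZero m] {σ : StutPerm m} (hw : IsStutWord m w)
    (h : HasMStd w σ) : ∃ k ≤ σ.size, SplitsAt k w σ.word := by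
  rcases isEmpty_or_nonempty (A ⊕ₗ B) with _ | _
  · obtain rfl : w = [] := List.eq_nil_iff_forall_not_mem.2 fun x => isEmptyElim x
    rw [List.eq_nil_of_length_eq_zero h.length_eq.symm]
    exact ⟨0, Nat.zero_le _, SplitsAt.nil⟩
  obtain ⟨f, rfl, hf⟩ := h.exists_map hw
  let k := Nat.findGreatest (fun a => a ∈ σ.word ∧ (ofLex (f a)).isLeft) σ.size
  refine ⟨k, Nat.findGreatest_le _, splitsAt_map fun a ha =>
    ⟨fun hleft => Nat.le_findGreatest ((σ.mem_word a).1 ha).2 ⟨ha, hleft⟩, fun hak => ?_⟩⟩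
  have hpos := (σ.mem_word a).1 ha
  obtain ⟨hk, hleft⟩ := Nat.findGreatest_of_ne_zero (m := k) rfl (by omega)
  by_contra hright
  refine hak.not_gt (hf k hk a ha ?_)
  generalize f k = x, f a = y at hleft hright
  induction x using sumLex_cases <;> induction y using sumLex_cases
  · exact absurd rfl hright
  · exact Sum.Lex.inl_lt_inr _ _
  · exact absurd rfl hright
  · exact absurd hleft Bool.false_ne_true

end Double

/-! ### The coproduct -/

section Coproduct

variable {m : ℕ} [NeZero m]

theorem coprodSet_eq_image (σ : StutPerm m) : coprodSet σ =
    (fun k => (σ.low k, σ.high k)) '' (Finset.range (σ.size + 1) : Set ℕ) := by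
  ext p
  simp only [coprodSet, Set.mem_ofPred_eq, Set.mem_image, Finset.coe_range, Set.mem_Iio,
    Nat.lt_succ_iff]
  refine exists_congr fun k => and_congr_right fun _ => ⟨fun h => ?_, ?_⟩
  · refine Prod.ext (StutPerm.ext h.1.symm) (HasMStd.unique ?_ h.2)
    exact hasMStd_iff.2 (σ.sameStd_high k)
  · rintro rfl
    exact ⟨rfl, hasMStd_iff.2 (σ.sameStd_high k)⟩

theorem finite_coprodSet (σ : StutPerm m) : (coprodSet σ).Finite := by
  rw [coprodSet_eq_image]
  exact (Finset.finite_toSet _).image _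

theorem finsum_coprodSet (σ : StutPerm m) {M : Type*} [AddCommMonoid M]
    (f : StutPerm m × StutPerm m → M) :
    ∑ᶠ p ∈ coprodSet σ, f p = ∑ k ∈ Finset.range (σ.size + 1), f (σ.low k, σ.high k) := by
  rw [coprodSet_eq_image, finsum_mem_image, finsum_mem_coe_finset]
  intro k hk l hl h
  have hsize := congrArg (fun p => p.1.size) h
  simp only [Finset.coe_range, Set.mem_Iio, StutPerm.size_low] at hk hl hsize
  omega

variable {A B : Type*} [LinearOrder A] [LinearOrder B]

theorem exists_parts_hasMStd_iff (σ : StutPerm m) (u : List A) (v : List B) :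
    (∃ w ∈ (finite_parts u v).toFinset, IsStutWord m w ∧ HasMStd w σ) ↔
      ∃ k ∈ Finset.range (σ.size + 1), (IsStutWord m u ∧ HasMStd u (σ.low k)) ∧
        (IsStutWord m v ∧ HasMStd v (σ.high k)) := by
  simp only [Set.Finite.mem_toFinset, Finset.mem_range, Nat.lt_succ_iff, hasMStd_iff]
  constructor
  · rintro ⟨w, ⟨rfl, rfl⟩, hw, h⟩
    obtain ⟨k, hk, hs⟩ := (hasMStd_iff.2 h).exists_splitsAt hw
    obtain ⟨hu, hv⟩ := isStutWord_iff_parts.1 hw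
    obtain ⟨hlow, hhigh⟩ := hs.sameStd_iff.1 h
    exact ⟨k, hk, ⟨hu, hlow⟩, hv, hhigh.trans (σ.sameStd_high k)⟩
  · rintro ⟨k, -, ⟨hu, hlow⟩, hv, hhigh⟩
    replace hhigh := hhigh.trans (σ.sameStd_high k).symm
    obtain ⟨w, hs, rfl, rfl⟩ := exists_splitsAt k σ.word u v hlow.1 hhigh.1
    exact ⟨w, ⟨rfl, rfl⟩, isStutWord_iff_parts.2 ⟨hu, hv⟩, hs.sameStd_iff.2 ⟨hlow, hhigh⟩⟩

theorem StutPerm.eq_of_length_low (σ : StutPerm m) {k l : ℕ} (hk : k ≤ σ.size) (hl : l ≤ σ.size)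
    (h : (σ.low k).word.length = (σ.low l).word.length) : k = l := by
  rw [StutPerm.length_word, StutPerm.length_word, σ.size_low, σ.size_low, min_eq_left hk,
    min_eq_left hl] at h
  exact Nat.eq_of_mul_eq_mul_left (Nat.pos_of_neZero m) h

theorem HasMStd.eq_of_parts_eq {σ : StutPerm m} {w w' : List (A ⊕ₗ B)} (hw : IsStutWord m w)
    (hw' : IsStutWord m w') (h : HasMStd w σ) (h' : HasMStd w' σ)
    (hl : leftPart w = leftPart w') (hr : rightPart w = rightPart w') : w = w' := by
  obtain ⟨k, hk, hs⟩ := h.exists_splitsAt hw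
  obtain ⟨l, hl', hs'⟩ := h'.exists_splitsAt hw'
  have hkl : k = l := σ.eq_of_length_low hk hl' <|
    calc (σ.low k).word.length = (leftPart w).length :=
          (hs.sameStd_iff.1 (hasMStd_iff.1 h)).1.1.symm
      _ = (σ.low l).word.length := hl ▸ (hs'.sameStd_iff.1 (hasMStd_iff.1 h')).1.1
  subst hkl
  exact eq_of_sides_eq (hs.sides_eq.trans hs'.sides_eq.symm) hl hr

theorem separate_eq_sum {K A B : Type*} [Field K] (f : NCSeries K (A ⊕ₗ B)) (u : List A)
    (v : List B) : separate f u v = ∑ w ∈ (finite_parts u v).toFinset, f w :=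
  finsum_mem_eq_finite_toFinset_sum _ _

variable (K A B : Type*) [Field K] [LinearOrder A] [LinearOrder B]

theorem separate_G (σ : StutPerm m) : separate (G K (A ⊕ₗ B) σ) =
    ∑ k ∈ Finset.range (σ.size + 1), seriesTensor K A B (G K A (σ.low k)) (G K B (σ.high k)) := by
  classical
  funext u v
  calc separate (G K (A ⊕ₗ B) σ) u v
      = if ∃ w ∈ (finite_parts u v).toFinset, IsStutWord m w ∧ HasMStd w σ then 1 else 0 := by
        rw [separate_eq_sum]
        refine sum_eq_indicator _ _ fun w hw w' hw' h h' => ?_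
        rw [Set.Finite.mem_toFinset] at hw hw'
        exact h.2.eq_of_parts_eq h.1 h'.1 h'.2 (hw.1.trans hw'.1.symm) (hw.2.trans hw'.2.symm)
    _ = ∑ k ∈ Finset.range (σ.size + 1), G K A (σ.low k) u * G K B (σ.high k) v := by
        simp only [exists_parts_hasMStd_iff, G_apply_mul_G_apply]
        refine (sum_eq_indicator _ _ fun k hk l hl h h' => ?_).symm
        rw [Finset.mem_range, Nat.lt_succ_iff] at hk hl
        exact σ.eq_of_length_low hk hl (h.1.2.length_eq.symm.trans h'.1.2.length_eq)
    _ = _ := by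
        simp only [Finset.sum_apply]
        rfl

end Coproduct

/-! ### Multiplicativity of the separation of the alphabets -/

section pairMul

variable {K A B : Type*} [Field K]

variable (K A B) in
/-- The product of series in two mutually commuting alphabets. -/
def pairMul : (List A → List B → K) →ₗ[K] (List A → List B → K) →ₗ[K] (List A → List B → K) :=
  LinearMap.mk₂ K
    (fun f g u v => ∑ i ∈ Finset.range (u.length + 1), ∑ j ∈ Finset.range (v.length + 1),
      f (u.take i) (v.take j) * g (u.drop i) (v.drop j))
    (fun f f' g => by funext u v; simp [add_mul, Finset.sum_add_distrib])
    (fun c f g => by funext u v; simp [mul_assoc, Finset.mul_sum])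
    (fun f g g' => by funext u v; simp [mul_add, Finset.sum_add_distrib])
    (fun c f g => by funext u v; simp [mul_left_comm, Finset.mul_sum])

theorem sum_factorisations (f g : List (A ⊕ₗ B) → K) (u : List A) (v : List B) :
    ∑ w ∈ (finite_parts u v).toFinset, ∑ l ∈ Finset.range (w.length + 1),
        f (w.take l) * g (w.drop l) =
      ∑ i ∈ Finset.range (u.length + 1), ∑ j ∈ Finset.range (v.length + 1),
        (∑ w ∈ (finite_parts (u.take i) (v.take j)).toFinset, f w) *
          ∑ w ∈ (finite_parts (u.drop i) (v.drop j)).toFinset, g w := by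
  simp only [Finset.sum_mul_sum]
  rw [← Finset.sum_product', Finset.sum_sigma']
  simp only [← Finset.sum_product']
  rw [Finset.sum_sigma']
  refine Finset.sum_bij'
    (fun p _ => ⟨((leftPart (p.1.take p.2)).length, (rightPart (p.1.take p.2)).length),
      (p.1.take p.2, p.1.drop p.2)⟩)
    (fun q _ => ⟨q.2.1 ++ q.2.2, q.2.1.length⟩) ?_ ?_ ?_ ?_ fun _ _ => rfl
  · rintro ⟨w, l⟩ h
    simp only [Finset.mem_sigma, Set.Finite.mem_toFinset, Set.mem_ofPred_eq, Finset.mem_range,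
      Finset.mem_product] at h ⊢
    obtain ⟨⟨rfl, rfl⟩, -⟩ := h
    have hl := leftPart_append (w.take l) (w.drop l)
    have hr := rightPart_append (w.take l) (w.drop l)
    rw [List.take_append_drop] at hl hr
    rw [hl, hr]
    simp
  · rintro ⟨⟨i, j⟩, w, w'⟩ h
    simp only [Finset.mem_sigma, Set.Finite.mem_toFinset, Set.mem_ofPred_eq, Finset.mem_range,
      Finset.mem_product] at h ⊢
    rw [leftPart_append, rightPart_append, h.2.1.1, h.2.1.2, h.2.2.1, h.2.2.2]
    simp
  · rintro ⟨w, l⟩ h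
    simp only [Finset.mem_sigma, Finset.mem_range] at h
    simp only [List.take_append_drop, Sigma.mk.injEq, heq_eq_eq, true_and, List.length_take]
    omega
  · rintro ⟨⟨i, j⟩, w, w'⟩ h
    simp only [Finset.mem_sigma, Set.Finite.mem_toFinset, Set.mem_ofPred_eq, Finset.mem_range,
      Finset.mem_product] at h
    simp only [List.take_left, List.drop_left, h.2.1.1, h.2.1.2, List.length_take]
    congr 2 <;> omega

theorem separate_mul (f g : NCSeries K (A ⊕ₗ B)) :
    separate (f * g) = pairMul K A B (separate f) (separate g) := by
  funext u v
  refine (separate_eq_sum _ u v).trans ((sum_factorisations f g u v).trans ?_)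
  simp only [← separate_eq_sum]
  rfl

theorem seriesTensor_mul (f f' : NCSeries K A) (g g' : NCSeries K B) :
    seriesTensor K A B (f * f') (g * g') =
      pairMul K A B (seriesTensor K A B f g) (seriesTensor K A B f' g') := by
  funext u v
  refine (Finset.sum_mul_sum _ _ _ _).trans ?_
  exact Finset.sum_congr rfl fun i _ => Finset.sum_congr rfl fun j _ => mul_mul_mul_comm _ _ _ _

end pairMul

/-! ### Grafting and splitting binary trees -/

section Trees

variable {S T T' T'' U V : BTree}

@[simp] theorem mirror_mirror (T : BTree) : mirror (mirror T) = T := by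
  induction T with
  | nil => rfl
  | node _ l r hl hr => rw [mirror, mirror, hl, hr]

@[simp] theorem numNodes_mirror (T : BTree) : (mirror T).numNodes = T.numNodes := by
  induction T with
  | nil => rfl
  | node _ l r hl hr => simp only [mirror, BinaryTree.numNodes, hl, hr, add_comm l.numNodes]

@[simp] theorem numNodes_graftLeft (S T : BTree) :
    (graftLeft S T).numNodes = S.numNodes + T.numNodes := by
  induction T with
  | nil => rfl
  | node _ l r hl _ => simp only [graftLeft, BinaryTree.numNodes, hl, add_assoc]

@[simp] theorem numNodes_graftRight (S T : BTree) :
    (graftRight S T).numNodes = T.numNodes + S.numNodes := by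
  induction T with
  | nil => exact (zero_add _).symm
  | node _ l r _ hr => simp only [graftRight, BinaryTree.numNodes, hr]; omega

@[simp] theorem graftLeft_nil_left (T : BTree) : graftLeft .nil T = T := by
  induction T with
  | nil => rfl
  | node _ l r hl _ => rw [graftLeft, hl]

@[simp] theorem graftLeft_eq_nil : graftLeft S T = .nil ↔ S = .nil ∧ T = .nil := by
  cases T <;> simp [graftLeft]

theorem exists_eq_graftLeft_bnode_nil (hT : T ≠ .nil) :
    ∃ s R, T = graftLeft (bnode .nil s) R := by
  induction T with
  | nil => exact absurd rfl hT
  | node _ l r hl _ =>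
    rcases eq_or_ne l .nil with rfl | hl'
    · exact ⟨r, .nil, rfl⟩
    · obtain ⟨s, R, rfl⟩ := hl hl'
      exact ⟨s, bnode R r, rfl⟩

/-- `U` consists of the first nodes of `T` in infix order and `V` of the other ones, with the
induced tree structures. -/
inductive Splits : BTree → BTree → BTree → Prop
  | nil : Splits .nil .nil .nil
  | left {l a b : BTree} (r : BTree) (h : Splits l a b) : Splits (bnode l r) a (bnode b r)
  | right (l : BTree) {r a b : BTree} (h : Splits r a b) : Splits (bnode l r) (bnode l a) b

theorem Splits.numNodes (h : Splits T U V) : T.numNodes = U.numNodes + V.numNodes := by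
  induction h with
  | nil => rfl
  | left r _ ih => simp only [BinaryTree.numNodes, ih, add_assoc]
  | right l _ ih => simp only [BinaryTree.numNodes, ih]; omega

theorem Splits.unique (h : Splits T U V) {U' V' : BTree} (h' : Splits T U' V')
    (hn : U.numNodes = U'.numNodes) : U = U' ∧ V = V' := by
  induction h generalizing U' V' with
  | nil => cases h'; exact ⟨rfl, rfl⟩
  | left r hs ih =>
    cases h' with
    | left _ h' =>
      obtain ⟨rfl, rfl⟩ := ih h' hn
      exact ⟨rfl, rfl⟩
    | right _ h' =>
      have := hs.numNodes
      simp only [BinaryTree.numNodes] at hn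
      omega
  | right l _ ih =>
    cases h' with
    | left _ h' =>
      have := h'.numNodes
      simp only [BinaryTree.numNodes] at hn
      omega
    | right _ h' =>
      obtain ⟨rfl, rfl⟩ := ih h' (by simpa using hn)
      exact ⟨rfl, rfl⟩

theorem splits_nil_right (T : BTree) : Splits T T .nil := by
  induction T with
  | nil => exact .nil
  | node _ l r _ hr => exact .right l hr

theorem splits_nil_left (T : BTree) : Splits T .nil T := by
  induction T with
  | nil => exact .nil
  | node _ l r hl _ => exact .left r hl

theorem splits_graftLeft (U V : BTree) : Splits (graftLeft U V) U V := by
  induction V with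
  | nil => exact splits_nil_right U
  | node _ l r hl _ => exact .left r hl

theorem splits_graftRight (U V : BTree) : Splits (graftRight V U) U V := by
  induction U with
  | nil => exact splits_nil_left V
  | node _ l r _ hr => exact .right l hr

/-! ### The Tamari order -/

theorem TamariLE.refl (T : BTree) : TamariLE T T := Relation.ReflTransGen.refl

theorem TamariLE.trans (h : TamariLE T T') (h' : TamariLE T' T'') : TamariLE T T'' :=
  Relation.ReflTransGen.trans h h'

theorem Rotation.tamariLE (h : Rotation T T') : TamariLE T T' := Relation.ReflTransGen.single h

theorem TamariLE.node {l l' r r' : BTree} (hl : TamariLE l l') (hr : TamariLE r r') :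
    TamariLE (bnode l r) (bnode l' r') :=
  (Relation.ReflTransGen.lift (fun x => bnode x r) (fun _ _ h => Rotation.left r h) _ _ hl).trans
    (Relation.ReflTransGen.lift (bnode l') (fun _ _ h => Rotation.right l' h) _ _ hr)

theorem TamariLE.node_left {l l' : BTree} (h : TamariLE l l') (r : BTree) :
    TamariLE (bnode l r) (bnode l' r) := h.node (.refl r)

theorem TamariLE.node_right (l : BTree) {r r' : BTree} (h : TamariLE r r') :
    TamariLE (bnode l r) (bnode l r') := (TamariLE.refl l).node h

theorem Rotation.numNodes (h : Rotation T T') : T.numNodes = T'.numNodes := by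
  induction h with
  | root A B C => simp only [BinaryTree.numNodes]; omega
  | left R _ ih => simp only [BinaryTree.numNodes, ih]
  | right L _ ih => simp only [BinaryTree.numNodes, ih]

theorem TamariLE.numNodes (h : TamariLE T T') : T.numNodes = T'.numNodes := by
  induction h with
  | refl => rfl
  | tail _ h ih => exact ih.trans h.numNodes

/-- The sum of the sizes of the right subtrees of the nodes, a strictly increasing function for the
Tamari order. -/
def rightWeight : BTree → ℕ
  | .nil => 0
  | .node _ l r => rightWeight l + rightWeight r + r.numNodes

theorem Rotation.rightWeight_lt (h : Rotation T T') : rightWeight T < rightWeight T' := by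
  induction h with
  | root A B C => simp only [rightWeight, BinaryTree.numNodes]; omega
  | left R _ ih => simp only [rightWeight]; omega
  | right L h ih => simp only [rightWeight, h.numNodes]; omega

theorem TamariLE.eq_or_rightWeight_lt (h : TamariLE T T') :
    T = T' ∨ rightWeight T < rightWeight T' := by
  induction h with
  | refl => exact Or.inl rfl
  | tail _ h ih => exact Or.inr (ih.elim (· ▸ h.rightWeight_lt) (·.trans h.rightWeight_lt))

theorem TamariLE.antisymm (h : TamariLE T T') (h' : TamariLE T' T) : T = T' := by
  rcases h.eq_or_rightWeight_lt with h | h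
  · exact h
  · exact (h'.eq_or_rightWeight_lt.resolve_right h.asymm).symm

theorem bnode_graftRight_le (b r a : BTree) :
    TamariLE (bnode (graftRight b a) r) (graftRight (bnode b r) a) := by
  induction a with
  | nil => exact .refl _
  | node _ a₁ a₂ _ ih => exact (Rotation.root _ _ _).tamariLE.trans (ih.node_right _)

theorem graftLeft_bnode_le (l a b : BTree) :
    TamariLE (graftLeft (bnode l a) b) (bnode l (graftLeft a b)) := by
  induction b with
  | nil => exact .refl _
  | node _ b₁ b₂ ih _ => exact (ih.node_left _).trans (Rotation.root _ _ _).tamariLE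

theorem Splits.graftLeft_le (h : Splits T U V) : TamariLE (graftLeft U V) T := by
  induction h with
  | nil => exact .refl _
  | left r _ ih => exact ih.node_left _
  | right l _ ih => exact (graftLeft_bnode_le _ _ _).trans (ih.node_right _)

theorem Splits.le_graftRight (h : Splits T U V) : TamariLE T (graftRight V U) := by
  induction h with
  | nil => exact .refl _
  | left r _ ih => exact (ih.node_left _).trans (bnode_graftRight_le _ _ _)
  | right l _ ih => exact ih.node_right _

theorem Rotation.splits (h : Rotation T T') (hs : Splits T U V) :
    ∃ U' V', Splits T' U' V' ∧ TamariLE U U' ∧ TamariLE V V' := by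
  induction h generalizing U V with
  | root A B C =>
    cases hs with
    | left _ hs =>
      cases hs with
      | left _ hs => exact ⟨_, _, .left _ hs, .refl _, (Rotation.root _ _ _).tamariLE⟩
      | right _ hs => exact ⟨_, _, .right _ (.left _ hs), .refl _, .refl _⟩
    | right _ hs => exact ⟨_, _, .right _ (.right _ hs), (Rotation.root _ _ _).tamariLE, .refl _⟩
  | left R h ih =>
    cases hs with
    | left _ hs =>
      obtain ⟨U', V', hs', hU, hV⟩ := ih hs
      exact ⟨_, _, .left _ hs', hU, hV.node_left _⟩
    | right _ hs => exact ⟨_, _, .right _ hs, h.tamariLE.node_left _, .refl _⟩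
  | right L h ih =>
    cases hs with
    | left _ hs => exact ⟨_, _, .left _ hs, .refl _, h.tamariLE.node_right _⟩
    | right _ hs =>
      obtain ⟨U', V', hs', hU, hV⟩ := ih hs
      exact ⟨_, _, .right _ hs', hU.node_right _, hV⟩

theorem TamariLE.splits (h : TamariLE T T') (hs : Splits T U V) :
    ∃ U' V', Splits T' U' V' ∧ TamariLE U U' ∧ TamariLE V V' := by
  induction h with
  | refl => exact ⟨U, V, hs, .refl _, .refl _⟩
  | tail _ h ih =>
    obtain ⟨U', V', hs', hU, hV⟩ := ih
    obtain ⟨U'', V'', hs'', hU', hV'⟩ := h.splits hs'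
    exact ⟨U'', V'', hs'', hU.trans hU', hV.trans hV'⟩

/-- The pairs obtained by splitting the trees of a Tamari chain from `graftLeft U V` to
`graftRight V U` increase from `(U, V)` to `(U, V)`, hence are constant. -/
theorem splits_iff_mem_interval :
    Splits T U V ↔ TamariLE (graftLeft U V) T ∧ TamariLE T (graftRight V U) := by
  refine ⟨fun h => ⟨h.graftLeft_le, h.le_graftRight⟩, fun ⟨h, h'⟩ => ?_⟩
  obtain ⟨U₁, V₁, hs₁, hU₁, hV₁⟩ := h.splits (splits_graftLeft U V)
  obtain ⟨U₂, V₂, hs₂, hU₂, hV₂⟩ := h'.splits hs₁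
  obtain ⟨rfl, rfl⟩ := hs₂.unique (splits_graftRight U V) (hU₁.trans hU₂).numNodes.symm
  rwa [hU₁.antisymm hU₂, hV₁.antisymm hV₂]

end Trees

/-! ### A numerical description of `m`-binary trees -/

section Aligned

variable {m i k : ℕ} {S T L : BTree}

/-- When the nodes of the tree are numbered `i, i + 1, …` in infix order, the nodes with a non-empty
left subtree have a number divisible by `m`. -/
def Aligned (m : ℕ) : ℕ → BTree → Prop
  | _, .nil => True
  | i, .node _ l r =>
    Aligned m i l ∧ Aligned m (i + l.numNodes + 1) r ∧ (l = .nil ∨ m ∣ i + l.numNodes)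

theorem aligned_add_left (hk : m ∣ k) : Aligned m (k + i) T ↔ Aligned m i T := by
  induction T generalizing i with
  | nil => rfl
  | node _ l r hl hr => simp only [Aligned, add_assoc k, hl, hr, Nat.dvd_add_right hk]

theorem aligned_iff_of_dvd (hi : m ∣ i) : Aligned m i T ↔ Aligned m 0 T :=
  aligned_add_left (i := 0) hi

theorem aligned_graftLeft : Aligned m i (graftLeft S T) ↔
    Aligned m i S ∧ Aligned m (i + S.numNodes) T ∧
      (S = .nil ∨ T = .nil ∨ m ∣ i + S.numNodes) := by
  induction T with
  | nil => simp [graftLeft, Aligned]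
  | node _ l r hl _ =>
    simp only [graftLeft, Aligned, hl, numNodes_graftLeft, graftLeft_eq_nil, reduceCtorEq, false_or,
      ← add_assoc]
    cases l <;> simp only [BinaryTree.numNodes, reduceCtorEq, add_zero] <;> tauto

theorem aligned_graftRight : Aligned m i (graftRight S T) ↔
    Aligned m i T ∧ Aligned m (i + T.numNodes) S := by
  induction T generalizing i with
  | nil => simp [graftRight, Aligned]
  | node _ l r _ hr =>
    simp only [graftRight, Aligned, hr, BinaryTree.numNodes, ← add_assoc, add_right_comm _ 1]
    tauto

theorem aligned_rootChain {Rs : List BTree} (hRs : ∀ R ∈ Rs, Aligned m 0 R ∧ m ∣ R.numNodes)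
    (hL : Aligned m i L) (hi : L = .nil ∨ m ∣ i + L.numNodes)
    (hlen : m ∣ i + L.numNodes + Rs.length) :
    Aligned m i (rootChain L Rs) ∧ m ∣ i + (rootChain L Rs).numNodes := by
  induction Rs generalizing i L with
  | nil => exact ⟨hL, hlen⟩
  | cons R Rs ih =>
    obtain ⟨⟨hR, hdvd⟩, hRs⟩ := List.forall_mem_cons.1 hRs
    obtain ⟨halign, hroots⟩ := ih (i := i + L.numNodes + 1) (L := .nil) hRs trivial (Or.inl rfl)
      (by simpa only [BinaryTree.numNodes, add_zero, List.length_cons, add_comm 1, add_assoc]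
        using hlen)
    refine ⟨⟨hL, aligned_graftLeft.2
      ⟨halign, (aligned_iff_of_dvd hroots).2 hR, Or.inr (Or.inr hroots)⟩, hi⟩, ?_⟩
    simp only [rootChain, BinaryTree.numNodes, numNodes_graftLeft]
    convert Nat.dvd_add hroots hdvd using 1
    omega

theorem Aligned.exists_rootChain {N : ℕ}
    (hN : ∀ S : BTree, S.numNodes ≤ N → Aligned m 0 S → m ∣ S.numNodes → IsMBinary m S)
    {j : ℕ} (hTN : T.numNodes ≤ N) (hT : Aligned m i T) (hdvd : m ∣ i + T.numNodes)
    (hij : m ∣ i + j) (hj : j < m) :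
    ∃ R Rs, T = graftLeft (rootChain .nil Rs) R ∧ Rs.length = j ∧ ∀ S ∈ R :: Rs, IsMBinary m S := by
  induction j generalizing i T with
  | zero =>
    refine ⟨T, [], (graftLeft_nil_left T).symm, rfl, List.forall_mem_singleton.2 ?_⟩
    exact hN T hTN ((aligned_iff_of_dvd hij).1 hT) ((Nat.dvd_add_right hij).1 hdvd)
  | succ j ih =>
    have hi : ¬ m ∣ i := fun h =>
      Nat.not_dvd_of_pos_of_lt j.succ_pos hj ((Nat.dvd_add_right h).1 hij)
    obtain ⟨s, R, rfl⟩ := exists_eq_graftLeft_bnode_nil (T := T) (by rintro rfl; exact hi hdvd)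
    obtain ⟨⟨-, hs, -⟩, hR, hroot⟩ := aligned_graftLeft.1 hT
    simp only [BinaryTree.numNodes, numNodes_graftLeft, reduceCtorEq, false_or, zero_add,
      add_zero] at hTN hdvd hs hR hroot
    have hnext : m ∣ i + (s.numNodes + 1) :=
      hroot.elim (fun h => by subst h; simpa [add_assoc] using hdvd) id
    obtain ⟨R', Rs, rfl, hlen, hRs⟩ := ih (T := s) (i := i + 1) (by omega) hs
      (by convert hnext using 1; omega) (by convert hij using 1; omega) (by omega)
    refine ⟨R, R' :: Rs, rfl, congrArg (· + 1) hlen, List.forall_mem_cons.2 ⟨?_, hRs⟩⟩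
    refine hN R (by omega) ((aligned_iff_of_dvd hnext).1 hR) ((Nat.dvd_add_right hnext).1 ?_)
    convert hdvd using 1
    omega

theorem Aligned.isMBinary [NeZero m] (hT : Aligned m 0 T) (hdvd : m ∣ T.numNodes) :
    IsMBinary m T := by
  induction hn : T.numNodes using Nat.strong_induction_on generalizing T with
  | _ n ih =>
    cases T with
    | nil => exact .nil
    | node _ l r =>
      simp only [BinaryTree.numNodes] at hn hdvd
      obtain ⟨hl, hr, hroot⟩ := hT
      simp only [zero_add] at hr hroot
      have hm := Nat.pos_of_neZero m
      have hldvd : m ∣ l.numNodes := hroot.elim (fun h => h ▸ dvd_zero m) id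
      have hlBin : IsMBinary m l := ih _ (by omega) hl hldvd rfl
      have hrBin (S : BTree) (hS : S.numNodes ≤ r.numNodes) (hSa : Aligned m 0 S)
          (hSd : m ∣ S.numNodes) : IsMBinary m S := ih _ (by omega) hSa hSd rfl
      obtain ⟨R, Rs, rfl, hlen, hRs⟩ := hr.exists_rootChain hrBin (j := m - 1) le_rfl
        (by convert hdvd using 1; omega)
        (by convert Nat.dvd_add hldvd (dvd_refl m) using 1; omega) (by omega)
      exact .chain l (R :: Rs) (by rw [List.length_cons]; omega) hlBin hRs

theorem isMBinary_iff_aligned [NeZero m] :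
    IsMBinary m T ↔ Aligned m 0 T ∧ m ∣ T.numNodes := by
  refine ⟨fun h => ?_, fun h => h.1.isMBinary h.2⟩
  induction h with
  | nil => exact ⟨trivial, dvd_zero m⟩
  | chain L Rs hlen _ _ hL hRs =>
    rw [← zero_add L.numNodes] at hL
    have := aligned_rootChain hRs hL.1 (Or.inr hL.2) (hlen ▸ hL.2.add (dvd_refl _))
    rwa [zero_add] at this

theorem IsMBinary.graftLeft [NeZero m] (hS : IsMBinary m S) (hT : IsMBinary m T) :
    IsMBinary m (graftLeft S T) := by
  rw [isMBinary_iff_aligned] at *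
  rw [aligned_graftLeft, numNodes_graftLeft, zero_add, aligned_iff_of_dvd hS.2]
  exact ⟨⟨hS.1, hT.1, Or.inr (Or.inr hS.2)⟩, hS.2.add hT.2⟩

theorem IsMBinary.graftRight [NeZero m] (hS : IsMBinary m S) (hT : IsMBinary m T) :
    IsMBinary m (graftRight S T) := by
  rw [isMBinary_iff_aligned] at *
  rw [aligned_graftRight, numNodes_graftRight, zero_add, aligned_iff_of_dvd hT.2]
  exact ⟨⟨hT.1, hS.1⟩, hT.2.add hS.2⟩

end Aligned

/-! ### Binary search trees and the sylvester congruence -/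

section BinarySearchTrees

variable {u u' v v' w : List ℕ} {x k : ℕ}

@[simp] theorem shape_node (x : ℕ) (l r : BinaryTree ℕ) :
    shape (.node x l r) = bnode (shape l) (shape r) := rfl

theorem foldr_bstInsert_node (w : List ℕ) (x : ℕ) (l r : BinaryTree ℕ) :
    w.foldr bstInsert (.node x l r) = .node x ((w.filter (· ≤ x)).foldr bstInsert l)
      ((w.filter (x < ·)).foldr bstInsert r) := by
  induction w with
  | nil => rfl
  | cons k w ih =>
    rcases le_or_gt k x with hk | hk
    · simp [ih, bstInsert, hk, hk.not_gt]
    · simp [ih, bstInsert, hk, hk.not_ge]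

theorem bst_concat (w : List ℕ) (x : ℕ) :
    bst (w ++ [x]) = .node x (bst (w.filter (· ≤ x))) (bst (w.filter (x < ·))) := by
  rw [bst, List.foldr_append]
  exact foldr_bstInsert_node w x .nil .nil

@[elab_as_elim]
theorem bst_induction {P : List ℕ → Prop} (nil : P [])
    (concat : ∀ w x, P (w.filter (· ≤ x)) → P (w.filter (x < ·)) → P (w ++ [x]))
    (w : List ℕ) : P w := by
  induction hn : w.length using Nat.strong_induction_on generalizing w with
  | _ n ih =>
    rcases w.eq_nil_or_concat' with rfl | ⟨w, x, rfl⟩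
    · exact nil
    · rw [List.length_append, List.length_singleton] at hn
      have hlt (p : ℕ → Bool) : (w.filter p).length < n := by
        have := w.length_filter_le p
        omega
      exact concat w x (ih _ (hlt _) _ rfl) (ih _ (hlt _) _ rfl)

theorem filter_filter_of_imp {p q : ℕ → Bool} (h : ∀ a, p a → q a) (w : List ℕ) :
    (w.filter q).filter p = w.filter p := by
  rw [List.filter_filter]
  exact List.filter_congr fun a _ => Bool.and_eq_left_iff_imp.2 (h a)

theorem perm_filter_le_append_filter_lt (w : List ℕ) (k : ℕ) :
    (w.filter (· ≤ k) ++ w.filter (k < ·)).Perm w := by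
  convert w.filter_append_perm (· ≤ k) using 4
  grind

@[simp] theorem numNodes_shape_bst (w : List ℕ) : (shape (bst w)).numNodes = w.length := by
  induction w using bst_induction with
  | nil => rfl
  | concat w x hl hr =>
    rw [bst_concat, shape_node, BinaryTree.numNodes, hl, hr, List.length_append,
      ← (perm_filter_le_append_filter_lt w x).length_eq, List.length_append, List.length_singleton]

theorem splits_shape_bst (k : ℕ) (w : List ℕ) :
    Splits (mirror (shape (bst w))) (mirror (shape (bst (w.filter (k < ·)))))
      (mirror (shape (bst (w.filter (· ≤ k))))) := by
  induction w using bst_induction with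
  | nil => exact .nil
  | concat w x hl hr =>
    rw [bst_concat]
    rcases le_or_gt x k with hx | hx
    · have hle : (w.filter (· ≤ k)).filter (· ≤ x) = w.filter (· ≤ x) :=
        filter_filter_of_imp (by grind) w
      have hlt : (w.filter (x < ·)).filter (k < ·) = w.filter (k < ·) :=
        filter_filter_of_imp (by grind) w
      rw [hlt, List.filter_comm] at hr
      simpa [bst_concat, mirror, hx, hle] using hr.left (mirror (shape (bst (w.filter (· ≤ x)))))
    · have hlt : (w.filter (k < ·)).filter (x < ·) = w.filter (x < ·) :=
        filter_filter_of_imp (by grind) w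
      have hle : (w.filter (· ≤ x)).filter (· ≤ k) = w.filter (· ≤ k) :=
        filter_filter_of_imp (by grind) w
      rw [hle, List.filter_comm] at hl
      simpa [bst_concat, mirror, hx, hlt] using hl.right (mirror (shape (bst (w.filter (x < ·)))))

/-- The sylvester congruence: the two words are rearrangements of each other and their binary search
trees have the same shape. -/
def Sylvester (u v : List ℕ) : Prop := u.Perm v ∧ shape (bst u) = shape (bst v)

theorem sylvester_concat : Sylvester (u ++ [x]) (v ++ [x]) ↔
    Sylvester (u.filter (· ≤ x)) (v.filter (· ≤ x)) ∧
      Sylvester (u.filter (x < ·)) (v.filter (x < ·)) := by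
  simp only [Sylvester, bst_concat, shape_node, BinaryTree.node.injEq, true_and,
    List.perm_append_right_iff]
  exact ⟨fun ⟨h, hl, hr⟩ => ⟨⟨h.filter _, hl⟩, h.filter _, hr⟩,
    fun ⟨⟨h, hl⟩, h', hr⟩ => ⟨(perm_filter_le_append_filter_lt u x).symm.trans
      ((h.append h').trans (perm_filter_le_append_filter_lt v x)), hl, hr⟩⟩

theorem countP_le_lt_countP_le {a b : ℕ} (hab : a < b) (hb : b ∈ w) :
    w.countP (· ≤ a) < w.countP (· ≤ b) := by
  rw [(List.perm_cons_erase hb).countP_eq, (List.perm_cons_erase hb).countP_eq]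
  simp only [List.countP_cons, hab.not_ge, le_refl, decide_true, decide_false, if_true, add_zero,
    Bool.false_eq_true, if_false, Nat.lt_succ_iff]
  exact List.countP_mono_left fun c _ => by simpa using fun h => h.trans hab.le

/-- The number of letters smaller than or equal to the last one is read off the size of the left
subtree of the root. -/
theorem Sylvester.last_eq {y : ℕ} (h : Sylvester (u ++ [x]) (v ++ [y])) : x = y := by
  have hroot : (u ++ [x]).countP (· ≤ x) = (v ++ [y]).countP (· ≤ y) := by
    have hshape := h.2
    rw [bst_concat, bst_concat, shape_node, shape_node, BinaryTree.node.injEq] at hshape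
    simpa [List.countP_eq_length_filter] using congrArg BinaryTree.numNodes hshape.2.1
  rcases lt_trichotomy x y with hxy | hxy | hxy
  · rw [← h.1.countP_eq] at hroot
    exact absurd hroot (countP_le_lt_countP_le hxy (h.1.mem_iff.2 (by simp))).ne
  · exact hxy
  · rw [h.1.countP_eq] at hroot
    exact absurd hroot (countP_le_lt_countP_le hxy (h.1.mem_iff.1 (by simp))).ne'

theorem Sylvester.filter (p : ℕ → Bool) (hp : {a | p a}.OrdConnected) (h : Sylvester u v) :
    Sylvester (u.filter p) (v.filter p) := by
  induction u using bst_induction generalizing v with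
  | nil =>
    obtain rfl := h.1.symm.eq_nil
    exact h
  | concat u x hl hr =>
    rcases v.eq_nil_or_concat' with rfl | ⟨v, y, rfl⟩
    · exact absurd h.1.eq_nil (by simp)
    obtain rfl := h.last_eq
    obtain ⟨hle, hlt⟩ := sylvester_concat.1 h
    by_cases hx : p x
    · simp only [List.filter_append, List.filter_singleton, hx, cond_true, sylvester_concat]
      rw [List.filter_comm _ p, List.filter_comm _ p, List.filter_comm _ p, List.filter_comm _ p]
      exact ⟨hl hle, hr hlt⟩
    · simp only [List.filter_append, List.filter_singleton, hx, cond_false, List.append_nil]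
      by_cases hlow : ∃ a, p a ∧ a ≤ x
      · obtain ⟨a, ha, hax⟩ := hlow
        have hpx (b : ℕ) (hb : p b) : decide (b ≤ x) := by
          by_contra hbx
          exact hx (hp.out ha hb ⟨hax, by simp at hbx; exact hbx.le⟩)
        simpa only [filter_filter_of_imp hpx] using hl hle
      · have hpx (b : ℕ) (hb : p b) : decide (x < b) := by grind
        simpa only [filter_filter_of_imp hpx] using hr hlt

theorem Sylvester.append (hu : Sylvester u u') (hv : Sylvester v v') :
    Sylvester (u ++ v) (u' ++ v') := by
  induction v using bst_induction generalizing u u' v' with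
  | nil =>
    obtain rfl := hv.1.symm.eq_nil
    simpa
  | concat v x hl hr =>
    rcases v'.eq_nil_or_concat' with rfl | ⟨v', y, rfl⟩
    · exact absurd hv.1.eq_nil (by simp)
    obtain rfl := hv.last_eq
    obtain ⟨hle, hlt⟩ := sylvester_concat.1 hv
    simp only [← List.append_assoc, sylvester_concat, List.filter_append]
    refine ⟨hl (hu.filter _ ?_) hle, hr (hu.filter _ ?_) hlt⟩
    · simpa only [decide_eq_true_eq] using! Set.ordConnected_Iic (a := x)
    · simpa only [decide_eq_true_eq] using! Set.ordConnected_Ioi (a := x)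

theorem shape_bst_map_fst_eq {P : List (ℕ × ℕ)}
    (hP : P.Pairwise fun p q => p.1 ≤ q.1 ↔ p.2 ≤ q.2) :
    shape (bst (P.map Prod.fst)) = shape (bst (P.map Prod.snd)) := by
  induction hn : P.length using Nat.strong_induction_on generalizing P with
  | _ n ih =>
    rcases P.eq_nil_or_concat' with rfl | ⟨P, p, rfl⟩
    · rfl
    · rw [List.length_append, List.length_singleton] at hn
      obtain ⟨hP, -, hp⟩ := List.pairwise_append.1 hP
      simp only [List.mem_singleton, forall_eq] at hp
      have hle : P.filter (fun q => q.2 ≤ p.2) = P.filter fun q => q.1 ≤ p.1 :=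
        List.filter_congr fun q hq => decide_eq_decide.2 (hp q hq).symm
      have hlt : P.filter (fun q => p.2 < q.2) = P.filter fun q => p.1 < q.1 :=
        List.filter_congr fun q hq =>
          decide_eq_decide.2 (lt_iff_lt_of_le_iff_le (hp q hq)).symm
      have hshape (c : ℕ × ℕ → Bool) := ih (P.filter c).length
        (by have := P.length_filter_le c; omega) (hP.filter c) rfl
      simp only [List.map_append, List.map_singleton, bst_concat, List.filter_map,
        Function.comp_def, shape_node, hle, hlt, hshape]

theorem SameStd.shape_bst_eq (h : SameStd u v) : shape (bst u) = shape (bst v) := by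
  simpa only [List.map_fst_zip h.1.le, List.map_snd_zip h.1.ge] using shape_bst_map_fst_eq h.2

theorem Sylvester.map {f : ℕ → ℕ} (hf : ∀ a ∈ u, ∀ b ∈ u, (a ≤ b ↔ f a ≤ f b))
    (h : Sylvester u v) : Sylvester (u.map f) (v.map f) := by
  refine ⟨h.1.map f, ?_⟩
  rw [← (sameStd_map u f hf).shape_bst_eq, h.2, SameStd.shape_bst_eq]
  exact sameStd_map v f fun a ha b hb => hf a (h.1.mem_iff.2 ha) b (h.1.mem_iff.2 hb)

/-- The nodes of the binary search tree of `w`, from the largest letter on, are numbered after the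
letters of `v`; the number of a node with a non-empty right subtree is the number of letters of
`w ++ v` larger than its label. -/
theorem aligned_bst {m : ℕ} (h : ∀ x ∈ w, m ∣ (w ++ v).countP (x < ·))
    (hwv : ∀ a ∈ w, ∀ b ∈ v, a ≤ b) : Aligned m v.length (mirror (shape (bst w))) := by
  induction w using bst_induction generalizing v with
  | nil => trivial
  | concat u x hl hr =>
    simp only [List.mem_append, List.mem_singleton, or_imp, forall_and, forall_eq] at h hwv
    rw [bst_concat, shape_node, mirror, Aligned, numNodes_mirror, numNodes_shape_bst]
    have hright : ∀ a ∈ u.filter (x < ·), a ∈ u ∧ x < a := by simp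
    refine ⟨hr (fun y hy => ?_) fun a ha => hwv.1 a (hright a ha).1, ?_, ?_⟩
    · obtain ⟨hyu, hxy⟩ := hright y hy
      have hcount : (u.filter (x < ·)).countP (y < ·) = u.countP (y < ·) := by
        rw [List.countP_filter]
        exact List.countP_congr fun b _ => by simpa using hxy.trans
      simpa [List.countP_append, hcount, hxy.not_gt] using h.1 y hyu
    · have hperm : (u.filter (· ≤ x) ++ (u.filter (x < ·) ++ [x] ++ v)).Perm (u ++ [x] ++ v) := by
        simp only [← List.append_assoc]
        exact ((perm_filter_le_append_filter_lt u x).append_right [x]).append_right v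
      convert hl (v := u.filter (x < ·) ++ [x] ++ v) (fun y hy => ?_) (fun a ha b hb => ?_) using 1
      · simp only [List.length_append, List.length_singleton]
        omega
      · rw [hperm.countP_eq]
        exact h.1 y (List.mem_of_mem_filter hy)
      · grind
    · rcases hfilter : u.filter (x < ·) with _ | ⟨a, t⟩
      · exact Or.inl rfl
      · obtain ⟨hau, hxa⟩ := hright a (hfilter ▸ List.mem_cons_self)
        have hv : v.countP (x < ·) = v.length :=
          List.countP_eq_length.2 fun b hb => by simpa using hxa.trans_le (hwv.1 a hau b hb)
        have hcount : (u ++ [x] ++ v).countP (x < ·) = v.length + (a :: t).length := by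
          rw [List.countP_append, List.countP_append, hv, List.countP_eq_length_filter, hfilter,
            List.countP_singleton]
          simp [add_comm]
        exact Or.inr (hcount ▸ h.2)

theorem IsStutWord.isMBinary {m : ℕ} [NeZero m] (hw : IsStutWord m w) :
    IsMBinary m (mirror (shape (bst w))) := by
  refine isMBinary_iff_aligned.2 ⟨aligned_bst (v := []) (fun x _ => ?_) (by simp), ?_⟩
  · exact (hw.append fun _ => by simp).dvd_countP _
  · rw [numNodes_mirror, numNodes_shape_bst]
    exact hw.dvd_length

/-- The nodes of `T`, numbered `i, i + 1, …` in infix order and listed in the order right subtree,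
left subtree, root. Inserted from right to left with decreasing labels, they rebuild the mirror
image of `T`. -/
def insertionOrder : ℕ → BTree → List ℕ
  | _, .nil => []
  | i, .node _ l r =>
    insertionOrder (i + l.numNodes + 1) r ++ insertionOrder i l ++ [i + l.numNodes]

theorem insertionOrder_perm (i : ℕ) (T : BTree) :
    (insertionOrder i T).Perm (List.range' i T.numNodes) := by
  induction T generalizing i with
  | nil => rfl
  | node _ l r hl hr =>
    have hrange : List.range' i (l.numNodes + r.numNodes + 1) =
        List.range' i l.numNodes ++
          ((i + l.numNodes) :: List.range' (i + l.numNodes + 1) r.numNodes) := by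
      rw [← List.range'_succ, add_assoc, List.range'_append_1]
    rw [insertionOrder, BinaryTree.numNodes, hrange]
    refine (((hr _).append (hl i)).append_right _).trans ?_
    grind

theorem mem_insertionOrder {i p : ℕ} {T : BTree} :
    p ∈ insertionOrder i T ↔ i ≤ p ∧ p < i + T.numNodes := by
  rw [(insertionOrder_perm i T).mem_iff, List.mem_range'_1]

theorem shape_bst_map_insertionOrder {m i : ℕ} {T : BTree} {f : ℕ → ℕ} (hf : Antitone f)
    (hlt : ∀ p q, p < q → q < i + T.numNodes → m ∣ q → f q < f p) (hT : Aligned m i T) :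
    shape (bst ((insertionOrder i T).map f)) = mirror T := by
  induction T generalizing i with
  | nil => rfl
  | node _ l r hl hr =>
    obtain ⟨hal, har, hroot⟩ := hT
    simp only [BinaryTree.numNodes] at hlt
    have hright : ∀ q ∈ insertionOrder (i + l.numNodes + 1) r, f q ≤ f (i + l.numNodes) := by
      intro q hq
      have := (mem_insertionOrder.1 hq).1
      exact hf (by omega)
    have hleft : ∀ p ∈ insertionOrder i l, f (i + l.numNodes) < f p := by
      intro p hp
      have hpl := mem_insertionOrder.1 hp
      refine hlt p _ hpl.2 (by omega) (hroot.resolve_left ?_)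
      rintro rfl
      simp only [BinaryTree.numNodes] at hpl
      omega
    rw [insertionOrder, List.map_append, List.map_append, List.map_singleton, bst_concat,
      shape_node, mirror, ← hl (fun p q h hq => hlt p q h (by omega)) hal,
      ← hr (fun p q h hq => hlt p q h (by omega)) har, List.filter_append, List.filter_append,
      List.filter_eq_self.2, List.filter_eq_nil_iff.2, List.filter_eq_nil_iff.2,
      List.filter_eq_self.2, List.append_nil, List.nil_append]
    all_goals simpa

theorem IsMBinary.exists_isStutWord {m : ℕ} [NeZero m] {T : BTree} (hT : IsMBinary m T) :
    ∃ w, IsStutWord m w ∧ shape (bst w) = mirror T := by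
  obtain ⟨halign, n, hn⟩ := isMBinary_iff_aligned.1 hT
  have hm := Nat.pos_of_neZero m
  refine ⟨(insertionOrder 0 T).map fun p => (n + 1) - (p / m + 1), ?_,
    shape_bst_map_insertionOrder (fun p q hpq => ?_) (fun p q hpq hq hmq => ?_) halign⟩
  · refine IsStutWord.perm (u := (blockWord m n).map ((n + 1) - ·))
      (IsStutWord.map (fun a => ?_) _) ?_
    · rw [count_blockWord]
      split_ifs <;> simp
    · rw [← map_div_range, List.map_map, List.range_eq_range', ← hn]
      exact ((insertionOrder_perm 0 T).map _).symm
  · have := Nat.div_le_div_right (c := m) hpq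
    omega
  · rw [zero_add, hn] at hq
    obtain ⟨c, rfl⟩ := hmq
    have hpc : p / m < c := Nat.div_lt_of_lt_mul hpq
    have hcn : c < n := Nat.lt_of_mul_lt_mul_left hq
    rw [Nat.mul_div_cancel_left _ hm]
    omega

end BinarySearchTrees

/-! ### The tree of an `m`-stuttering permutation -/

namespace StutPerm

variable {m : ℕ} [NeZero m] {σ τ : StutPerm m}

/-- The `m`-binary tree whose sylvester class contains `σ`. -/
def toTree (σ : StutPerm m) : MBinTree m := ⟨mirror (shape (bst σ.word)), σ.isStutWord.isMBinary⟩

theorem tree_toTree (σ : StutPerm m) : σ.toTree.tree = mirror (shape (bst σ.word)) := rfl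

theorem toTree_surjective : Function.Surjective (toTree (m := m)) := by
  intro T
  obtain ⟨w, hw, hwT⟩ := T.2.exists_isStutWord
  obtain ⟨σ, hσ⟩ := hw.exists_hasMStd
  have hshape : shape (bst σ.word) = mirror T.tree :=
    (hasMStd_iff.1 hσ).shape_bst_eq.symm.trans hwT
  exact ⟨σ, Subtype.ext ((congrArg mirror hshape).trans (mirror_mirror _))⟩

theorem numNodes_toTree (σ : StutPerm m) : σ.toTree.tree.numNodes = m * σ.size := by
  rw [tree_toTree, numNodes_mirror, numNodes_shape_bst, σ.length_word]

theorem mem_sylvesterClass {T : MBinTree m} : σ ∈ sylvesterClass T ↔ σ.toTree = T :=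
  ⟨fun h => Subtype.ext ((congrArg mirror h).trans (mirror_mirror _)),
    fun h => h ▸ (mirror_mirror (shape (bst σ.word))).symm⟩

theorem size_eq_of_toTree_eq (h : σ.toTree = τ.toTree) : σ.size = τ.size :=
  Nat.eq_of_mul_eq_mul_left (Nat.pos_of_neZero m) <| by
    rw [← numNodes_toTree, ← numNodes_toTree, h]

theorem toTree_eq_iff_sylvester : σ.toTree = τ.toTree ↔ Sylvester σ.word τ.word := by
  refine ⟨fun h => ⟨?_, ?_⟩, fun h => Subtype.ext (congrArg mirror h.2)⟩
  · exact σ.perm_size.trans (size_eq_of_toTree_eq h ▸ τ.perm_size.symm)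
  · simpa only [tree_toTree, mirror_mirror] using congrArg (fun T => mirror T.tree) h

theorem splits_toTree (σ : StutPerm m) (k : ℕ) :
    Splits σ.toTree.tree (σ.high k).toTree.tree (σ.low k).toTree.tree := by
  have h := splits_shape_bst k σ.word
  rwa [(σ.sameStd_high k).shape_bst_eq] at h

theorem exists_low_high_iff (ν : StutPerm m) (T₁ T₂ : MBinTree m) :
    (∃ k ∈ Finset.range (ν.size + 1), (ν.low k).toTree = T₁ ∧ (ν.high k).toTree = T₂) ↔
      TamariLE (graftLeft T₂.tree T₁.tree) ν.toTree.tree ∧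
        TamariLE ν.toTree.tree (graftRight T₁.tree T₂.tree) := by
  rw [← splits_iff_mem_interval]
  refine ⟨fun ⟨k, _, hlow, hhigh⟩ => hlow ▸ hhigh ▸ ν.splits_toTree k, fun h => ?_⟩
  obtain ⟨σ, rfl⟩ := toTree_surjective T₁
  obtain ⟨τ, rfl⟩ := toTree_surjective T₂
  have hsize : ν.size = τ.size + σ.size := by
    have hn := h.numNodes
    rw [numNodes_toTree, numNodes_toTree, numNodes_toTree, ← mul_add] at hn
    exact Nat.eq_of_mul_eq_mul_left (Nat.pos_of_neZero m) hn
  obtain ⟨hhigh, hlow⟩ := (ν.splits_toTree σ.size).unique h <| by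
    rw [numNodes_toTree, numNodes_toTree, size_high, hsize, Nat.add_sub_cancel]
  exact ⟨σ.size, Finset.mem_range.2 (by omega), Subtype.ext hlow, Subtype.ext hhigh⟩

end StutPerm

section Finiteness

variable {m : ℕ} [NeZero m]

theorem finite_mBinTree (N : ℕ) : {T : MBinTree m | T.tree.numNodes = N}.Finite := by
  refine ((StutPerm.finite_size (N / m)).image StutPerm.toTree).subset ?_
  rintro T rfl
  obtain ⟨σ, rfl⟩ := StutPerm.toTree_surjective T
  refine ⟨σ, ?_, rfl⟩
  rw [Set.mem_ofPred_eq, σ.numNodes_toTree, Nat.mul_div_cancel_left _ (Nat.pos_of_neZero m)]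

theorem finite_sylvesterClass (T : MBinTree m) : (sylvesterClass T).Finite := by
  obtain ⟨τ, rfl⟩ := StutPerm.toTree_surjective T
  exact (StutPerm.finite_size τ.size).subset fun σ hσ =>
    StutPerm.size_eq_of_toTree_eq (StutPerm.mem_sylvesterClass.1 hσ)

theorem finite_Icc (T T' : MBinTree m) : (Set.Icc T T').Finite :=
  (finite_mBinTree T'.tree.numNodes).subset fun _ hS => TamariLE.numNodes hS.2

end Finiteness

/-! ### Bases of generated subalgebras -/

theorem linearIndependent_of_dual {K M ι : Type*} [CommRing K] [AddCommMonoid M] [Module K M]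
    (v : ι → M) (f : ι → M →ₗ[K] K) (h0 : Pairwise fun i j => f i (v j) = 0)
    (h1 : ∀ i, f i (v i) = 1) : LinearIndependent K v :=
  letI : AddCommGroup M := Module.addCommMonoidToAddCommGroup K
  LinearIndependent.of_pairwise_dual_eq_zero_one v f h0 h1

theorem exists_basis_adjoin {K Y ι : Type*} [CommRing K] [Semiring Y] [Algebra K Y] (v : ι → Y)
    (hv : LinearIndependent K v) (h1 : 1 ∈ Submodule.span K (Set.range v))
    (hmul : ∀ i j, v i * v j ∈ Submodule.span K (Set.range v)) :
    ∃ b : Module.Basis ι K (Algebra.adjoin K (Set.range v)), ∀ i, (b i : Y) = v i := by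
  have hle : Submodule.span K (Set.range v) * Submodule.span K (Set.range v) ≤
      Submodule.span K (Set.range v) := by
    rw [Submodule.span_mul_span, Submodule.span_le]
    rintro _ ⟨_, ⟨i, rfl⟩, _, ⟨j, rfl⟩, rfl⟩
    exact hmul i j
  have hspan : ∀ y ∈ Algebra.adjoin K (Set.range v), y ∈ Submodule.span K (Set.range v) := by
    intro y hy
    induction hy using Algebra.adjoin_induction with
    | mem y hy => exact Submodule.subset_span hy
    | algebraMap r =>
      rw [Algebra.algebraMap_eq_smul_one]
      exact Submodule.smul_mem _ r h1
    | add y z _ _ hy hz => exact add_mem hy hz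
    | mul y z _ _ hy hz => exact hle (Submodule.mul_mem_mul hy hz)
  let v' : ι → Algebra.adjoin K (Set.range v) := fun i => ⟨v i, Algebra.subset_adjoin ⟨i, rfl⟩⟩
  have hv' : LinearIndependent K v' :=
    LinearIndependent.of_comp (Algebra.adjoin K (Set.range v)).val.toLinearMap hv
  refine ⟨Module.Basis.mk hv' ?_, fun i => by rw [Module.Basis.mk_apply]⟩
  rintro ⟨y, hy⟩ -
  have h := hspan y hy
  have hrange : Set.range v = (Algebra.adjoin K (Set.range v)).val.toLinearMap '' Set.range v' := by
    rw [← Set.range_comp]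
    rfl
  rw [hrange, Submodule.span_image] at h
  obtain ⟨z, hz, hzy⟩ := h
  obtain rfl : z = ⟨y, hy⟩ := Subtype.ext hzy
  exact hz

theorem mul_eq_sum_of_coe {K Y ι : Type*} [CommSemiring K] [Semiring Y] [Algebra K Y]
    {Q : Subalgebra K Y} {P : ι → Q} {v : ι → Y} (hP : ∀ i, (P i : Y) = v i) {i j : ι}
    {s : Finset ι} (h : v i * v j = ∑ k ∈ s, v k) : P i * P j = ∑ k ∈ s, P k := by
  refine Subtype.ext ?_
  rw [Subalgebra.coe_mul, AddSubmonoidClass.coe_finsetSum, hP, hP, h]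
  exact Finset.sum_congr rfl fun k _ => (hP k).symm

/-! ### Antipodes of connected bialgebras -/

section Antipode

open WithConv Filter

section Ring

variable {K X S : Type*} [Field K] [Ring X] [Algebra K X] [Coalgebra K X]

theorem isAntipode_iff (T : X →ₗ[K] X) : IsAntipode K T ↔
    toConv T * toConv LinearMap.id = 1 ∧ toConv LinearMap.id * toConv T = 1 := by
  rw [LinearMap.convMul_def, LinearMap.convMul_def, LinearMap.convOne_def,
    toConv_injective.eq_iff, toConv_injective.eq_iff]
  rfl

theorem IsAntipode.unique {T T' : X →ₗ[K] X} (hT : IsAntipode K T) (hT' : IsAntipode K T') :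
    T = T' :=
  toConv_injective
    (left_inv_eq_right_inv ((isAntipode_iff T).1 hT).1 ((isAntipode_iff T').1 hT').2)

variable (K X) in
/-- The element `1 - id` of the convolution algebra. It is locally nilpotent when `X` is graded and
connected, so that `id = 1 - (1 - id)` can be inverted by a geometric series. -/
def convDefect : WithConv (X →ₗ[K] X) := 1 - toConv LinearMap.id

variable (K X) in
/-- The geometric series of `convDefect`, truncated after `N` terms; it converges pointwise to the
antipode. -/
def convGeom (N : ℕ) : WithConv (X →ₗ[K] X) := ∑ k ∈ Finset.range N, convDefect K X ^ k

theorem convGeom_apply (N : ℕ) (x : X) :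
    (convGeom K X N).ofConv x = ∑ k ∈ Finset.range N, (convDefect K X ^ k).ofConv x := by
  rw [convGeom, ofConv_sum, LinearMap.sum_apply]

theorem toConv_id_eq : toConv (LinearMap.id : X →ₗ[K] X) = 1 - convDefect K X := by
  rw [convDefect, sub_sub_cancel]

section Connected

variable (b : Module.Basis S K X) {deg : S → ℕ} {C : S → Finset (S × S)}
  (hC : ∀ σ, CoalgebraStruct.comul (R := K) (b σ) = ∑ p ∈ C σ, b p.1 ⊗ₜ[K] b p.2)
  (hdeg : ∀ σ, ∀ p ∈ C σ, deg p.1 + deg p.2 = deg σ)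
  (h0 : ∀ σ, deg σ = 0 → b σ = algebraMap K X (CoalgebraStruct.counit (R := K) (b σ)))

include hC in
theorem convMul_basis (f g : WithConv (X →ₗ[K] X)) (σ : S) :
    (f * g).ofConv (b σ) = ∑ p ∈ C σ, f.ofConv (b p.1) * g.ofConv (b p.2) := by
  simp [hC]

include h0 in
theorem convDefect_basis_of_deg_eq_zero {σ : S} (hσ : deg σ = 0) :
    (convDefect K X).ofConv (b σ) = 0 := by
  rw [convDefect, ofConv_sub, LinearMap.sub_apply, LinearMap.convOne_apply, ← h0 σ hσ]
  exact sub_self _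

include hC hdeg h0 in
theorem convDefect_pow_basis (k : ℕ) (σ : S) (hk : deg σ < k) :
    (convDefect K X ^ k).ofConv (b σ) = 0 := by
  induction k generalizing σ with
  | zero => omega
  | succ k ih =>
    rw [pow_succ', convMul_basis b hC]
    refine Finset.sum_eq_zero fun p hp => ?_
    have hpσ := hdeg σ p hp
    by_cases hp0 : deg p.1 = 0
    · rw [convDefect_basis_of_deg_eq_zero b h0 hp0, zero_mul]
    · rw [ih p.2 (by omega), mul_zero]

include hC hdeg h0 in
theorem convGeom_basis {N : ℕ} (σ : S) (hN : deg σ < N) :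
    (convGeom K X N).ofConv (b σ) = (convGeom K X (deg σ + 1)).ofConv (b σ) := by
  rw [convGeom_apply, convGeom_apply]
  refine (Finset.sum_subset (Finset.range_mono hN) fun k _ hk => ?_).symm
  exact convDefect_pow_basis b hC hdeg h0 k σ (by simpa using hk)

include hC hdeg h0 in
theorem one_sub_convDefect_pow_basis (σ : S) :
    (1 - convDefect K X ^ (deg σ + 1)).ofConv (b σ) =
      (1 : WithConv (X →ₗ[K] X)).ofConv (b σ) := by
  rw [ofConv_sub, LinearMap.sub_apply,
    convDefect_pow_basis b hC hdeg h0 _ σ (Nat.lt_succ_self _), sub_zero]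

include hC hdeg h0 in
theorem isAntipode_of_eq_convGeom {T : X →ₗ[K] X}
    (hT : ∀ σ N, deg σ < N → T (b σ) = (convGeom K X N).ofConv (b σ)) : IsAntipode K T := by
  rw [isAntipode_iff]
  constructor <;> refine ofConv_injective (b.ext fun σ => ?_) <;>
    rw [← one_sub_convDefect_pow_basis b hC hdeg h0 σ]
  · rw [← geom_sum_mul_neg, ← toConv_id_eq, convMul_basis b hC, convMul_basis b hC]
    refine Finset.sum_congr rfl fun p hp => ?_
    have hpσ := hdeg σ p hp
    exact congrArg (· * _) (hT p.1 _ (by omega))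
  · rw [← mul_neg_geom_sum, ← toConv_id_eq, convMul_basis b hC, convMul_basis b hC]
    refine Finset.sum_congr rfl fun p hp => ?_
    have hpσ := hdeg σ p hp
    exact congrArg (_ * ·) (hT p.2 _ (by omega))

include hC hdeg h0 in
theorem exists_isAntipode_eventually_eq_convGeom : ∃ T : X →ₗ[K] X, IsAntipode K T ∧
    ∀ x, ∀ᶠ N in atTop, T x = (convGeom K X N).ofConv x := by
  let T : X →ₗ[K] X := b.constr K fun σ => (convGeom K X (deg σ + 1)).ofConv (b σ)
  have hT : ∀ σ N, deg σ < N → T (b σ) = (convGeom K X N).ofConv (b σ) := fun σ N hN =>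
    (b.constr_basis _ _ _).trans (convGeom_basis b hC hdeg h0 σ hN).symm
  refine ⟨T, isAntipode_of_eq_convGeom b hC hdeg h0 hT, fun x => ?_⟩
  induction b.mem_span x using Submodule.span_induction with
  | mem x hx =>
    obtain ⟨σ, rfl⟩ := hx
    filter_upwards [eventually_gt_atTop (deg σ)] with N hN using hT σ N hN
  | zero => exact .of_forall fun N => by rw [map_zero, map_zero]
  | add x y _ _ hx hy => filter_upwards [hx, hy] with N hx hy using by rw [map_add, map_add, hx, hy]
  | smul c x _ hx => filter_upwards [hx] with N hx using by rw [map_smul, map_smul, hx]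

end Connected

section Subcoalgebra

variable {Q : Subalgebra K X}
  (hQ : ∀ z ∈ Q, CoalgebraStruct.comul (R := K) z ∈
    LinearMap.range (TensorProduct.map Q.val.toLinearMap Q.val.toLinearMap))

include hQ in
theorem convMul_mem {f g : WithConv (X →ₗ[K] X)} (hf : ∀ z ∈ Q, f.ofConv z ∈ Q)
    (hg : ∀ z ∈ Q, g.ofConv z ∈ Q) : ∀ z ∈ Q, (f * g).ofConv z ∈ Q := by
  intro z hz
  obtain ⟨t, ht⟩ := hQ z hz
  rw [LinearMap.convMul_apply, ← ht]
  clear ht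
  induction t using TensorProduct.induction_on with
  | zero => simp
  | tmul x y =>
    simp only [TensorProduct.map_tmul, LinearMap.mul'_apply]
    exact Q.mul_mem (hf _ x.2) (hg _ y.2)
  | add s t hs ht => simpa only [map_add] using Q.add_mem hs ht

include hQ in
theorem convDefect_pow_mem (k : ℕ) : ∀ z ∈ Q, (convDefect K X ^ k).ofConv z ∈ Q := by
  induction k with
  | zero => exact fun z _ => Q.algebraMap_mem _
  | succ k ih =>
    rw [pow_succ']
    exact convMul_mem hQ (fun z hz => Q.sub_mem (Q.algebraMap_mem _) hz) ih

include hQ in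
theorem convGeom_mem (N : ℕ) : ∀ z ∈ Q, (convGeom K X N).ofConv z ∈ Q := fun z hz => by
  rw [convGeom_apply]
  exact Q.sum_mem fun k _ => convDefect_pow_mem hQ k z hz

end Subcoalgebra

end Ring

section Semiring

variable {K X S : Type*} [Field K] [Semiring X] [Algebra K X] [Coalgebra K X]
  (b : Module.Basis S K X) {deg : S → ℕ} {C : S → Finset (S × S)}
  (hC : ∀ σ, CoalgebraStruct.comul (R := K) (b σ) = ∑ p ∈ C σ, b p.1 ⊗ₜ[K] b p.2)
  (hdeg : ∀ σ, ∀ p ∈ C σ, deg p.1 + deg p.2 = deg σ)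
  (h0 : ∀ σ, deg σ = 0 → b σ = algebraMap K X (CoalgebraStruct.counit (R := K) (b σ)))

include hC hdeg h0 in
theorem exists_isAntipode_of_comul : ∃ T : X →ₗ[K] X, IsAntipode K T := by
  let : Ring X := Algebra.semiringToRing K
  exact (exists_isAntipode_eventually_eq_convGeom b hC hdeg h0).imp fun _ h => h.1

include hC hdeg h0 in
theorem isHopfSubalgebra_of_comul {Q : Subalgebra K X}
    (hQ : ∀ z ∈ Q, CoalgebraStruct.comul (R := K) z ∈
      LinearMap.range (TensorProduct.map Q.val.toLinearMap Q.val.toLinearMap)) :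
    IsHopfSubalgebra K Q := by
  let : Ring X := Algebra.semiringToRing K
  obtain ⟨T, hT, hlim⟩ := exists_isAntipode_eventually_eq_convGeom b hC hdeg h0
  refine ⟨hQ, fun T' hT' z hz => ?_⟩
  obtain ⟨N, hN⟩ := (hlim z).exists
  rw [hT'.unique hT, hN]
  exact convGeom_mem hQ N z hz

end Semiring

end Antipode

/-! ### Products of linear forms -/

section TensorEval

variable {K M N P : Type*} [CommSemiring K] [AddCommMonoid M] [Module K M] [AddCommMonoid N]
  [Module K N] [AddCommMonoid P] [Module K P]

theorem coord_apply_basis {ι : Type*} [DecidableEq ι] (b : Module.Basis ι K M) (i j : ι) :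
    b.coord i (b j) = if i = j then 1 else 0 := by
  rw [Module.Basis.coord_apply, b.repr_self_apply]
  exact if_congr eq_comm rfl rfl

/-- The linear form `x ⊗ y ↦ f(x) g(y)`. -/
def tensorEval (f : M →ₗ[K] K) (g : N →ₗ[K] K) : M ⊗[K] N →ₗ[K] K :=
  LinearMap.mul' K K ∘ₗ TensorProduct.map f g

@[simp] theorem tensorEval_tmul (f : M →ₗ[K] K) (g : N →ₗ[K] K) (x : M) (y : N) :
    tensorEval f g (x ⊗ₜ y) = f x * g y := rfl

theorem coord_tensorProduct {S S' : Type*} (F : Module.Basis S K M) (F' : Module.Basis S' K N)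
    (i : S) (j : S') :
    (F.tensorProduct F').coord (i, j) = tensorEval (F.coord i) (F'.coord j) := by
  refine TensorProduct.ext' fun x y => ?_
  rw [Module.Basis.coord_apply, Module.Basis.tensorProduct_repr_tmul_apply, tensorEval_tmul]
  simp [mul_comm]

theorem tensorEval_assoc (f : M →ₗ[K] K) (g : N →ₗ[K] K) (h : P →ₗ[K] K)
    (t : (M ⊗[K] N) ⊗[K] P) : tensorEval f (tensorEval g h) (TensorProduct.assoc K M N P t) =
      tensorEval (tensorEval f g) h t := by
  have : tensorEval f (tensorEval g h) ∘ₗ (TensorProduct.assoc K M N P).toLinearMap =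
      tensorEval (tensorEval f g) h :=
    TensorProduct.ext_threefold fun x y z => by simp [mul_assoc]
  exact LinearMap.congr_fun this t

theorem tensorEval_rTensor (δ : M →ₗ[K] P) (f : P →ₗ[K] K) (g : N →ₗ[K] K) (t : M ⊗[K] N) :
    tensorEval f g (δ.rTensor N t) = tensorEval (f ∘ₗ δ) g t := by
  have : tensorEval f g ∘ₗ δ.rTensor N = tensorEval (f ∘ₗ δ) g :=
    TensorProduct.ext' fun x y => rfl
  exact LinearMap.congr_fun this t

theorem tensorEval_lTensor (δ : N →ₗ[K] P) (f : M →ₗ[K] K) (g : P →ₗ[K] K) (t : M ⊗[K] N) :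
    tensorEval f g (δ.lTensor M t) = tensorEval f (g ∘ₗ δ) t := by
  have : tensorEval f g ∘ₗ δ.lTensor M = tensorEval f (g ∘ₗ δ) :=
    TensorProduct.ext' fun x y => rfl
  exact LinearMap.congr_fun this t

theorem apply_lid_rTensor (e : M →ₗ[K] K) (f : N →ₗ[K] K) (t : M ⊗[K] N) :
    f (TensorProduct.lid K N (e.rTensor N t)) = tensorEval e f t := by
  have : f ∘ₗ (TensorProduct.lid K N).toLinearMap ∘ₗ e.rTensor N = tensorEval e f :=
    TensorProduct.ext' fun x y => by simp
  exact LinearMap.congr_fun this t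

theorem apply_rid_lTensor (e : N →ₗ[K] K) (f : M →ₗ[K] K) (t : M ⊗[K] N) :
    f (TensorProduct.rid K M (e.lTensor M t)) = tensorEval f e t := by
  have : f ∘ₗ (TensorProduct.rid K M).toLinearMap ∘ₗ e.lTensor M = tensorEval f e :=
    TensorProduct.ext' fun x y => by simp [mul_comm]
  exact LinearMap.congr_fun this t

end TensorEval

/-! ### Coalgebra structures on duals -/

section Dual

variable {K X S : Type*} [Field K] [Ring X] [Algebra K X] [Coalgebra K X]
  (D : Subalgebra K (WithConv (X →ₗ[K] K)))

/-- Evaluation at `x`, as a linear form on a subalgebra `D` of the convolution algebra of linear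
forms. -/
def evalAt (x : X) : D →ₗ[K] K := (toDual D).flip x

/-- Evaluation at `x ⊗ y`, as a linear form on `D ⊗ D`. -/
def evalAt₂ (x y : X) : D ⊗[K] D →ₗ[K] K := tensorEval (evalAt D x) (evalAt D y)

variable {D}

theorem evalAt_apply (x : X) (z : D) : evalAt D x z = toDual D z x := rfl

theorem evalAt_eq (x : X) (z : D) : evalAt D x z = z.1.ofConv x := rfl

@[simp] theorem evalAt₂_tmul (x y : X) (z z' : D) :
    evalAt₂ D x y (z ⊗ₜ z') = evalAt D x z * evalAt D y z' := rfl

theorem dualPairing_tmul (t : D ⊗[K] D) (x y : X) :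
    dualPairing D t (x ⊗ₜ[K] y) = evalAt₂ D x y t := by
  induction t using TensorProduct.induction_on with
  | zero => simp
  | tmul z z' => simp [dualPairing, evalAt_apply]
  | add s t hs ht => rw [map_add, map_add, LinearMap.add_apply, hs, ht]

theorem evalAt_one (x : X) : evalAt D x 1 = CoalgebraStruct.counit (R := K) x := by
  rw [evalAt_eq]
  rfl

theorem evalAt_mul {ι : Type*} {x : X} (r : Coalgebra.Repr K x ι) (z z' : D) :
    evalAt D x (z * z') = ∑ i ∈ r.index, evalAt D (r.left i) z * evalAt D (r.right i) z' :=
  r.convMul_apply z.1 z'.1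

theorem evalAt₂_mul {ι κ : Type*} {x y : X} (r : Coalgebra.Repr K x ι) (r' : Coalgebra.Repr K y κ)
    (s t : D ⊗[K] D) : evalAt₂ D x y (s * t) = ∑ i ∈ r.index, ∑ j ∈ r'.index,
      evalAt₂ D (r.left i) (r'.left j) s * evalAt₂ D (r.right i) (r'.right j) t := by
  induction s using TensorProduct.induction_on with
  | zero => simp
  | add s s' hs hs' => simp only [add_mul, map_add, hs, hs', Finset.sum_add_distrib]
  | tmul a c =>
    induction t using TensorProduct.induction_on with
    | zero => simp
    | add s s' hs hs' => simp only [mul_add, map_add, hs, hs', Finset.sum_add_distrib]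
    | tmul a' c' =>
      simp only [Algebra.TensorProduct.tmul_mul_tmul, evalAt₂_tmul, evalAt_mul r, evalAt_mul r',
        Finset.sum_mul_sum]
      exact Finset.sum_congr rfl fun i _ => Finset.sum_congr rfl fun j _ => by ring

variable (b : Module.Basis S K X) (F : Module.Basis S K D)
  (hF : ∀ σ, toDual D (F σ) = b.coord σ)

include hF in
theorem evalAt_basis (σ : S) : evalAt D (b σ) = F.coord σ := by
  classical
  refine F.ext fun τ => ?_
  rw [evalAt_apply, hF, coord_apply_basis, coord_apply_basis]
  exact if_congr eq_comm rfl rfl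

include hF in
theorem evalAt_basis_basis [DecidableEq S] (σ τ : S) :
    evalAt D (b σ) (F τ) = if σ = τ then 1 else 0 := by
  rw [evalAt_basis b F hF, coord_apply_basis]

include b F hF in
theorem eq_of_evalAt {z z' : D} (h : ∀ σ, evalAt D (b σ) z = evalAt D (b σ) z') : z = z' := by
  refine F.ext_elem fun σ => ?_
  simpa [evalAt_basis b F hF] using h σ

include b F hF in
theorem eq_of_evalAt₂ {t t' : D ⊗[K] D}
    (h : ∀ σ τ, evalAt₂ D (b σ) (b τ) t = evalAt₂ D (b σ) (b τ) t') : t = t' := by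
  refine (F.tensorProduct F).ext_elem fun ⟨σ, τ⟩ => ?_
  rw [← Module.Basis.coord_apply, ← Module.Basis.coord_apply, coord_tensorProduct,
    ← evalAt_basis b F hF, ← evalAt_basis b F hF]
  exact h σ τ

include b F hF in
theorem eq_of_evalAt₃ {t t' : D ⊗[K] (D ⊗[K] D)}
    (h : ∀ x y w, tensorEval (evalAt D x) (evalAt₂ D y w) t =
      tensorEval (evalAt D x) (evalAt₂ D y w) t') : t = t' := by
  refine (F.tensorProduct (F.tensorProduct F)).ext_elem fun ⟨σ, τ, υ⟩ => ?_
  rw [← Module.Basis.coord_apply, ← Module.Basis.coord_apply, coord_tensorProduct,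
    coord_tensorProduct, ← evalAt_basis b F hF, ← evalAt_basis b F hF, ← evalAt_basis b F hF]
  exact h _ _ _

section Comul

variable (δ : D →ₗ[K] D ⊗[K] D) (hδ : ∀ x y, evalAt₂ D x y ∘ₗ δ = evalAt D (x * y))

/-- The coalgebra structure on `D` transposed from the product of `X`. -/
abbrev dualCoalgebra : Coalgebra K D where
  comul := δ
  counit := evalAt D 1
  coassoc := by
    refine LinearMap.ext fun z => eq_of_evalAt₃ b F hF fun x y w => ?_
    rw [evalAt₂]
    simp only [LinearMap.comp_apply, LinearEquiv.coe_coe]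
    rw [tensorEval_assoc, tensorEval_rTensor, tensorEval_lTensor, ← evalAt₂, ← evalAt₂, hδ, hδ,
      ← evalAt₂, ← evalAt₂, ← LinearMap.comp_apply, ← LinearMap.comp_apply, hδ, hδ, mul_assoc]
  rTensor_counit_comp_comul := by
    refine LinearMap.ext fun z => (TensorProduct.lid K D).injective ?_
    refine eq_of_evalAt b F hF fun σ => ?_
    rw [LinearMap.comp_apply, apply_lid_rTensor, ← evalAt₂, ← LinearMap.comp_apply, hδ, one_mul,
      TensorProduct.mk_apply, TensorProduct.lid_tmul, one_smul]
  lTensor_counit_comp_comul := by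
    refine LinearMap.ext fun z => (TensorProduct.rid K D).injective ?_
    refine eq_of_evalAt b F hF fun σ => ?_
    rw [LinearMap.comp_apply, apply_rid_lTensor, ← evalAt₂, ← LinearMap.comp_apply, hδ, mul_one,
      LinearMap.flip_apply, TensorProduct.mk_apply, TensorProduct.rid_tmul, one_smul]

include b F hF hδ in
theorem dual_comul_mul (hX : ∀ x y : X, CoalgebraStruct.comul (R := K) (x * y) =
    CoalgebraStruct.comul (R := K) x * CoalgebraStruct.comul (R := K) y) (z z' : D) :
    δ (z * z') = δ z * δ z' := by
  refine eq_of_evalAt₂ b F hF fun σ τ => ?_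
  let r := Coalgebra.Repr.arbitrary K (b σ)
  let r' := Coalgebra.Repr.arbitrary K (b τ)
  have hδ' : ∀ x y z, evalAt₂ D x y (δ z) = evalAt D (x * y) z := fun x y z =>
    LinearMap.congr_fun (hδ x y) z
  rw [hδ', evalAt₂_mul r r']
  simp only [hδ']
  rw [evalAt_eq, Subalgebra.coe_mul, LinearMap.convMul_apply, hX, ← r.eq, ← r'.eq,
    Finset.sum_mul_sum]
  simp only [map_sum, Algebra.TensorProduct.tmul_mul_tmul, TensorProduct.map_tmul,
    LinearMap.mul'_apply]
  rfl

include b F hF hδ in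
theorem dual_comul_one (hX : ∀ x y : X, CoalgebraStruct.counit (R := K) (x * y) =
      CoalgebraStruct.counit (R := K) x * CoalgebraStruct.counit (R := K) y) :
    δ 1 = 1 := by
  refine eq_of_evalAt₂ b F hF fun σ τ => ?_
  rw [← LinearMap.comp_apply, hδ, evalAt_one, hX, Algebra.TensorProduct.one_def, evalAt₂_tmul,
    evalAt_one, evalAt_one]

theorem dual_counit_mul (hX : CoalgebraStruct.comul (R := K) (1 : X) = 1) (z z' : D) :
    evalAt D 1 (z * z') = evalAt D 1 z * evalAt D 1 z' := by
  rw [evalAt_eq, Subalgebra.coe_mul, LinearMap.convMul_apply, hX, Algebra.TensorProduct.one_def,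
    TensorProduct.map_tmul, LinearMap.mul'_apply]
  rfl

end Comul

end Dual

/-! ### Sylvester classes and products -/

section ProdSet

variable {m : ℕ} [NeZero m] {α α' β β' ν : StutPerm m}

theorem count_add_count_le_countP {w : List ℕ} {p : ℕ → Bool} {a b : ℕ} (hab : a ≠ b)
    (ha : p a) (hb : p b) : w.count a + w.count b ≤ w.countP p := by
  induction w with
  | nil => rfl
  | cons c w ih =>
    simp only [List.count_cons, List.countP_cons, beq_iff_eq]
    grind

theorem HasMStd.exists_map_le_iff {u : List ℕ} (h : HasMStd u α) (hu : IsStutWord m u)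
    (hle : ∀ a, u.count a ≤ m) :
    ∃ f : ℕ → ℕ, u = α.word.map f ∧ ∀ a ∈ α.word, ∀ b ∈ α.word, (a ≤ b ↔ f a ≤ f b) := by
  obtain ⟨f, rfl, hf⟩ := h.exists_map hu
  have hinj : ∀ a ∈ α.word, ∀ b ∈ α.word, f a = f b → a = b := by
    intro a ha b hb hab
    by_contra hne
    have hfb := hle (f b)
    rw [List.count, List.countP_map] at hfb
    have hcount := (count_add_count_le_countP hne (by simpa using hab) (by simp)).trans hfb
    rw [α.count_word, α.count_word, if_pos ((α.mem_word a).1 ha),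
      if_pos ((α.mem_word b).1 hb)] at hcount
    have := Nat.pos_of_neZero m
    omega
  refine ⟨f, rfl, fun a ha b hb => ?_⟩
  grind

theorem exists_maps_of_mem_prodSet (h : ν ∈ prodSet α β) :
    ∃ f g : ℕ → ℕ, ν.word = α.word.map f ++ β.word.map g ∧
      (∀ a ∈ α.word, ∀ b ∈ α.word, (a ≤ b ↔ f a ≤ f b)) ∧
      (∀ a ∈ β.word, ∀ b ∈ β.word, (a ≤ b ↔ g a ≤ g b)) := by
  obtain ⟨u, v, huv, hu, hv, hα, hβ⟩ := h
  have hcount : ∀ a, u.count a + v.count a ≤ m := fun a => by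
    rw [← List.count_append, ← huv, ν.count_word]
    split_ifs <;> omega
  obtain ⟨f, rfl, hf⟩ := hα.exists_map_le_iff hu fun a => (Nat.le_add_right _ _).trans (hcount a)
  obtain ⟨g, rfl, hg⟩ := hβ.exists_map_le_iff hv fun a => (Nat.le_add_left _ _).trans (hcount a)
  exact ⟨f, g, huv, hf, hg⟩

theorem exists_mem_prodSet_of_toTree_eq (hα : α.toTree = α'.toTree) (hβ : β.toTree = β'.toTree)
    (h : ν ∈ prodSet α β) : ∃ ν' ∈ prodSet α' β', ν'.toTree = ν.toTree ∧ ∃ f g : ℕ → ℕ,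
      ν.word = α.word.map f ++ β.word.map g ∧ ν'.word = α'.word.map f ++ β'.word.map g := by
  obtain ⟨f, g, hν, hf, hg⟩ := exists_maps_of_mem_prodSet h
  rw [StutPerm.toTree_eq_iff_sylvester] at hα hβ
  have hf' : ∀ a ∈ α'.word, ∀ b ∈ α'.word, (a ≤ b ↔ f a ≤ f b) := fun a ha b hb =>
    hf a (hα.1.mem_iff.2 ha) b (hα.1.mem_iff.2 hb)
  have hg' : ∀ a ∈ β'.word, ∀ b ∈ β'.word, (a ≤ b ↔ g a ≤ g b) := fun a ha b hb =>
    hg a (hβ.1.mem_iff.2 ha) b (hβ.1.mem_iff.2 hb)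
  have hsylv : Sylvester ν.word (α'.word.map f ++ β'.word.map g) :=
    hν ▸ (hα.map hf).append (hβ.map hg)
  let ν' : StutPerm m := ⟨α'.word.map f ++ β'.word.map g, ν.size, hsylv.1.symm.trans ν.perm_size⟩
  exact ⟨ν', ⟨_, _, rfl, α'.isStutWord.map f, β'.isStutWord.map g,
    hasMStd_iff.2 (sameStd_map _ _ hf').symm, hasMStd_iff.2 (sameStd_map _ _ hg').symm⟩,
    (StutPerm.toTree_eq_iff_sylvester.2 hsylv).symm, f, g, hν, rfl⟩

open Classical in
theorem card_prodSet_le (hα : α.toTree = α'.toTree) (hβ : β.toTree = β'.toTree)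
    (T : MBinTree m) :
    ((finite_prodSet α β).toFinset.filter fun ν => ν.toTree = T).card ≤
      ((finite_prodSet α' β').toFinset.filter fun ν => ν.toTree = T).card := by
  refine Finset.card_le_card_of_forall_subsingleton
    (fun ν ν' => ∃ f g : ℕ → ℕ, ν.word = α.word.map f ++ β.word.map g ∧
      ν'.word = α'.word.map f ++ β'.word.map g) ?_ ?_
  · intro ν hν
    simp only [Finset.mem_filter, Set.Finite.mem_toFinset] at hν ⊢
    obtain ⟨ν', hmem, htree, hmaps⟩ := exists_mem_prodSet_of_toTree_eq hα hβ hν.1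
    exact ⟨ν', ⟨hmem, htree.trans hν.2⟩, hmaps⟩
  · rintro ν' - ν₁ ⟨-, f₁, g₁, h₁, h₁'⟩ ν₂ ⟨-, f₂, g₂, h₂, h₂'⟩
    obtain ⟨hf, hg⟩ := List.append_inj (h₁'.symm.trans h₂') (by simp)
    rw [StutPerm.toTree_eq_iff_sylvester] at hα hβ
    refine StutPerm.ext ?_
    rw [h₁, h₂, List.map_congr_left fun a ha => List.map_inj_left.1 hf a (hα.1.mem_iff.1 ha),
      List.map_congr_left fun a ha => List.map_inj_left.1 hg a (hβ.1.mem_iff.1 ha)]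

open Classical in
/-- The number of `ν` in the sylvester class of `T` that occur in the product `G_σ G_μ`, for
arbitrary representatives `σ` and `μ` of the sylvester classes of `T₁` and `T₂`. -/
def prodMultiplicity (T₁ T₂ T : MBinTree m) : ℕ :=
  ((finite_prodSet (Function.surjInv StutPerm.toTree_surjective T₁)
    (Function.surjInv StutPerm.toTree_surjective T₂)).toFinset.filter fun ν => ν.toTree = T).card

open Classical in
theorem card_prodSet_eq_prodMultiplicity (σ μ : StutPerm m) (T : MBinTree m) :
    ((finite_prodSet σ μ).toFinset.filter fun ν => ν.toTree = T).card =
      prodMultiplicity σ.toTree μ.toTree T :=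
  have hrep : ∀ T, (Function.surjInv (StutPerm.toTree_surjective (m := m)) T).toTree = T :=
    Function.surjInv_eq _
  le_antisymm (card_prodSet_le (hrep _).symm (hrep _).symm T)
    (card_prodSet_le (hrep _) (hrep _) T)

end ProdSet

namespace StutPerm

variable {m : ℕ} [NeZero m] (σ : StutPerm m)

theorem low_low {j k : ℕ} (h : j ≤ k) : (σ.low k).low j = σ.low j := by
  refine ext ?_
  simp only [word_low]
  exact filter_filter_of_imp (fun a ha => by simpa using (of_decide_eq_true ha).trans h) _

theorem high_low (j k : ℕ) : (σ.low k).high j = (σ.high j).low (k - j) := by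
  refine ext ?_
  simp only [word_low, word_high, List.filter_map, List.filter_filter]
  congr 1
  refine List.filter_congr fun a _ => ?_
  simp only [Function.comp_apply, ← Bool.decide_and, decide_eq_decide]
  omega

theorem high_high (j i : ℕ) : (σ.high j).high i = σ.high (j + i) := by
  refine ext ?_
  simp only [word_high, List.filter_map, List.filter_filter, List.map_map]
  refine Eq.trans (List.map_congr_left fun a _ => ?_) (congrArg _ (List.filter_congr fun a _ => ?_))
  · simp only [Function.comp_apply]
    omega
  · simp only [Function.comp_apply, ← Bool.decide_and, decide_eq_decide]
    omega

theorem low_size : σ.low σ.size = σ :=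
  ext (List.filter_eq_self.2 fun a ha => by simpa using ((σ.mem_word a).1 ha).2)

theorem high_zero : σ.high 0 = σ := by
  refine ext ?_
  rw [word_high, (List.filter_eq_self (p := fun a => decide (0 < a))).2 fun a ha =>
    decide_eq_true ((σ.mem_word a).1 ha).1]
  simp

variable {σ} in
theorem eq_empty_iff : σ = empty m ↔ σ.size = 0 :=
  ⟨fun h => by rw [h, size_empty], eq_empty_of_size⟩

variable (m) in
theorem finite_size_le (n : ℕ) : {σ : StutPerm m | σ.size ≤ n}.Finite := by
  refine ((Set.finite_Iic n).biUnion fun k _ => finite_size k).subset fun σ hσ => ?_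
  exact Set.mem_biUnion (Set.mem_Iic.2 hσ) rfl

end StutPerm

section IndexSets

variable {m : ℕ} [NeZero m]

theorem finite_factorisations (ν : StutPerm m) :
    {p : StutPerm m × StutPerm m | ν ∈ prodSet p.1 p.2}.Finite := by
  refine ((StutPerm.finite_size_le m ν.size).prod (StutPerm.finite_size_le m ν.size)).subset ?_
  intro p hp
  have hsize := size_of_mem_prodSet hp
  exact Set.mem_prod.2 ⟨Set.mem_ofPred.2 (by omega), Set.mem_ofPred.2 (by omega)⟩

theorem size_add_of_mem_factorisations {ν : StutPerm m} {p : StutPerm m × StutPerm m}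
    (hp : p ∈ (finite_factorisations ν).toFinset) : p.1.size + p.2.size = ν.size :=
  (size_of_mem_prodSet ((finite_factorisations ν).mem_toFinset.1 hp)).symm

open Classical in
/-- The pairs of trees of the factorisations of the elements of the sylvester class of `T`; they
index the coproduct of `P_T`. -/
def coprodTrees (T : MBinTree m) : Finset (MBinTree m × MBinTree m) :=
  (finite_sylvesterClass T).toFinset.biUnion fun ν =>
    (finite_factorisations ν).toFinset.image (Prod.map StutPerm.toTree StutPerm.toTree)

theorem prodMultiplicity_eq_zero {T : MBinTree m} {σ μ : StutPerm m}
    (hT : (σ.toTree, μ.toTree) ∉ coprodTrees T) :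
    prodMultiplicity σ.toTree μ.toTree T = 0 := by
  classical
  rw [← card_prodSet_eq_prodMultiplicity, Finset.card_eq_zero, Finset.filter_eq_empty_iff]
  refine fun ν hν hνT => hT (Finset.mem_biUnion.2 ⟨ν, ?_, Finset.mem_image.2 ⟨(σ, μ), ?_, rfl⟩⟩)
  · rwa [Set.Finite.mem_toFinset, StutPerm.mem_sylvesterClass]
  · rwa [Set.Finite.mem_toFinset] at hν ⊢

theorem mem_coprodSet {σ : StutPerm m} {p : StutPerm m × StutPerm m} :
    p ∈ coprodSet σ ↔ ∃ k ∈ Finset.range (σ.size + 1), (σ.low k, σ.high k) = p := by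
  rw [coprodSet_eq_image]
  exact Iff.rfl

theorem size_add_of_mem_coprodSet {σ : StutPerm m} {p : StutPerm m × StutPerm m}
    (hp : p ∈ coprodSet σ) : p.1.size + p.2.size = σ.size := by
  obtain ⟨k, -, rfl⟩ := mem_coprodSet.1 hp
  rw [σ.size_low, σ.size_high]
  omega

theorem finite_coprodSet_fibre (p : StutPerm m × StutPerm m) :
    {ν : StutPerm m | p ∈ coprodSet ν}.Finite :=
  (StutPerm.finite_size (p.1.size + p.2.size)).subset fun _ hν =>
    (size_add_of_mem_coprodSet hν).symm

theorem eq_of_mem_coprodSet {σ : StutPerm m} {p q : StutPerm m × StutPerm m}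
    (hp : p ∈ coprodSet σ) (hq : q ∈ coprodSet σ) (h : p.1.size = q.1.size) : p = q := by
  obtain ⟨k, hk, rfl⟩ := mem_coprodSet.1 hp
  obtain ⟨l, hl, rfl⟩ := mem_coprodSet.1 hq
  rw [Finset.mem_range, Nat.lt_succ_iff] at hk hl
  rw [σ.size_low, σ.size_low, min_eq_left hk, min_eq_left hl] at h
  rw [h]

end IndexSets

/-! ### The basis of `FQSym^{(m)}` -/

section FQSym

/-- The coefficient of the word `w`, as a linear form on series. -/
def coeffAt {K A : Type*} [Field K] (w : List A) : NCSeries K A →ₗ[K] K where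
  toFun f := f w
  map_add' _ _ := rfl
  map_smul' _ _ := rfl

theorem coeffAt_apply {K A : Type*} [Field K] (w : List A) (f : NCSeries K A) :
    coeffAt w f = f w := rfl

variable {K A : Type*} [Field K] [LinearOrder A] {m : ℕ}

theorem basis_empty {b : Module.Basis (StutPerm m) K (FQSym K A m)}
    (hb : ∀ σ, (b σ : NCSeries K A) = G K A σ) : b (StutPerm.empty m) = 1 :=
  Subtype.ext ((hb _).trans (G_empty K A m))

theorem basis_mul_basis [NeZero m] [Nonempty A] {b : Module.Basis (StutPerm m) K (FQSym K A m)}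
    (hb : ∀ σ, (b σ : NCSeries K A) = G K A σ) (σ μ : StutPerm m) :
    b σ * b μ = ∑ ν ∈ (finite_prodSet σ μ).toFinset, b ν :=
  mul_eq_sum_of_coe hb (G_mul_G K A σ μ)

variable [NeZero m] [Infinite A]

variable (A) in
/-- A word over `A` whose `m`-standardisation is `σ`; its coefficient detects `G_σ`. -/
def wordOf (σ : StutPerm m) : List A := (σ.exists_hasMStd A).choose

open Classical in
theorem coeffAt_wordOf_G (σ τ : StutPerm m) :
    coeffAt (wordOf A σ) (G K A τ) = if σ = τ then 1 else 0 := by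
  rw [coeffAt_apply, G_apply]
  have hword := (σ.exists_hasMStd A).choose_spec
  refine if_congr ⟨fun h => hword.2.unique h.2, ?_⟩ rfl rfl
  rintro rfl
  exact hword

variable (K A m) in
theorem exists_basis_FQSym : ∃ b : Module.Basis (StutPerm m) K (FQSym K A m),
    ∀ σ, (b σ : NCSeries K A) = G K A σ := by
  classical
  refine exists_basis_adjoin (fun σ : StutPerm m => G K A σ) ?_ ?_ fun σ μ => ?_
  · exact linearIndependent_of_dual _ (fun σ => coeffAt (wordOf A σ))
      (fun σ τ h => (coeffAt_wordOf_G σ τ).trans (if_neg h))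
      fun σ => (coeffAt_wordOf_G σ σ).trans (if_pos rfl)
  · rw [← G_empty K A m]
    exact Submodule.subset_span ⟨_, rfl⟩
  · rw [G_mul_G K A]
    exact sum_mem fun ν _ => Submodule.subset_span ⟨ν, rfl⟩

end FQSym

/-! ### The coproduct splitting the set of letters -/

section Coalgebra

variable {K X : Type*} [CommSemiring K] [AddCommMonoid X] [Module K X] {m : ℕ} [NeZero m]
  (b : Module.Basis (StutPerm m) K X)

theorem coord_empty_basis (σ : StutPerm m) :
    b.coord (.empty m) (b σ) = if σ.size = 0 then 1 else 0 := by
  classical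
  rw [coord_apply_basis]
  exact if_congr (eq_comm.trans StutPerm.eq_empty_iff) rfl rfl

/-- The coproduct that splits `σ` into its letters `≤ k` and its letters `> k`, for all `k`. -/
def splitComul : X →ₗ[K] X ⊗[K] X :=
  b.constr K fun σ => ∑ k ∈ Finset.range (σ.size + 1), b (σ.low k) ⊗ₜ[K] b (σ.high k)

theorem splitComul_basis (σ : StutPerm m) : splitComul b (b σ) =
    ∑ k ∈ Finset.range (σ.size + 1), b (σ.low k) ⊗ₜ[K] b (σ.high k) :=
  b.constr_basis _ _ _

theorem splitComul_basis_eq_sum_coprodSet (σ : StutPerm m) :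
    splitComul b (b σ) = ∑ p ∈ (finite_coprodSet σ).toFinset, b p.1 ⊗ₜ[K] b p.2 := by
  rw [splitComul_basis, ← finsum_mem_eq_finite_toFinset_sum, finsum_coprodSet]

theorem splitComul_coassoc :
    (TensorProduct.assoc K X X X).toLinearMap ∘ₗ (splitComul b).rTensor X ∘ₗ splitComul b =
      (splitComul b).lTensor X ∘ₗ splitComul b := by
  refine b.ext fun σ => ?_
  simp only [LinearMap.comp_apply, LinearEquiv.coe_coe, splitComul_basis, map_sum,
    LinearMap.rTensor_tmul, LinearMap.lTensor_tmul, TensorProduct.sum_tmul,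
    TensorProduct.tmul_sum, TensorProduct.assoc_tmul]
  let f (j i : ℕ) : X ⊗[K] (X ⊗[K] X) :=
    b (σ.low j) ⊗ₜ (b ((σ.high j).low i) ⊗ₜ b (σ.high (j + i)))
  calc _ = ∑ k ∈ Finset.range (σ.size + 1), ∑ j ∈ Finset.range (k + 1), f j (k - j) := by
        refine Finset.sum_congr rfl fun k hk => ?_
        rw [Finset.mem_range, Nat.lt_succ_iff] at hk
        rw [σ.size_low, min_eq_left hk]
        refine Finset.sum_congr rfl fun j hj => ?_
        rw [Finset.mem_range, Nat.lt_succ_iff] at hj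
        rw [σ.low_low hj, σ.high_low, ← Nat.add_sub_cancel' hj, Nat.add_sub_cancel_left]
    _ = ∑ j ∈ Finset.range (σ.size + 1), ∑ i ∈ Finset.range (σ.size + 1 - j), f j i :=
        Finset.sum_range_diag_flip _ f
    _ = _ := by
        refine Finset.sum_congr rfl fun j hj => ?_
        rw [Finset.mem_range, Nat.lt_succ_iff] at hj
        rw [σ.size_high, Nat.sub_add_comm hj]
        exact Finset.sum_congr rfl fun i _ => by rw [σ.high_high]

theorem rTensor_coord_empty_comp_splitComul :
    (b.coord (.empty m)).rTensor X ∘ₗ splitComul b = TensorProduct.mk K K X 1 := by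
  refine b.ext fun σ => ?_
  rw [LinearMap.comp_apply, splitComul_basis, map_sum, Finset.sum_eq_single 0]
  · rw [LinearMap.rTensor_tmul, coord_empty_basis, σ.size_low, Nat.zero_min, if_pos rfl,
      σ.high_zero, TensorProduct.mk_apply]
  · intro k hk hk0
    rw [Finset.mem_range] at hk
    rw [LinearMap.rTensor_tmul, coord_empty_basis, σ.size_low, if_neg (by omega),
      TensorProduct.zero_tmul]
  · exact fun h => absurd (Finset.mem_range.2 (Nat.succ_pos _)) h

theorem lTensor_coord_empty_comp_splitComul :
    (b.coord (.empty m)).lTensor X ∘ₗ splitComul b = (TensorProduct.mk K X K).flip 1 := by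
  refine b.ext fun σ => ?_
  rw [LinearMap.comp_apply, splitComul_basis, map_sum, Finset.sum_eq_single σ.size]
  · rw [LinearMap.lTensor_tmul, coord_empty_basis, σ.size_high, Nat.sub_self, if_pos rfl,
      σ.low_size, LinearMap.flip_apply, TensorProduct.mk_apply]
  · intro k hk hkσ
    rw [Finset.mem_range] at hk
    rw [LinearMap.lTensor_tmul, coord_empty_basis, σ.size_high, if_neg (by omega),
      TensorProduct.tmul_zero]
  · exact fun h => absurd (Finset.mem_range.2 (Nat.lt_succ_self _)) h

/-- The coalgebra structure with coproduct `splitComul` and with the coefficient of the empty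
permutation as counit. -/
abbrev splitCoalgebra : Coalgebra K X where
  comul := splitComul b
  counit := b.coord (.empty m)
  coassoc := splitComul_coassoc b
  rTensor_counit_comp_comul := rTensor_coord_empty_comp_splitComul b
  lTensor_counit_comp_comul := lTensor_coord_empty_comp_splitComul b

end Coalgebra

/-! ### Bases of `G`-type -/

section IsGBasis

variable {K X : Type*} [Field K] [Ring X] [Algebra K X] [Coalgebra K X] {m : ℕ} [NeZero m]

/-- The basis `b` of `X` multiplies and comultiplies as the basis `G_σ` of `FQSym^{(m)}` does. -/
structure IsGBasis (b : Module.Basis (StutPerm m) K X) : Prop where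
  empty : b (.empty m) = 1
  mul : ∀ σ μ, b σ * b μ = ∑ ν ∈ (finite_prodSet σ μ).toFinset, b ν
  comul : ∀ σ, CoalgebraStruct.comul (R := K) (b σ) =
    ∑ p ∈ (finite_coprodSet σ).toFinset, b p.1 ⊗ₜ[K] b p.2
  counit : CoalgebraStruct.counit (R := K) = b.coord (.empty m)

namespace IsGBasis

variable {b : Module.Basis (StutPerm m) K X} (h : IsGBasis b)
include h

theorem counit_basis (σ : StutPerm m) :
    CoalgebraStruct.counit (R := K) (b σ) = if σ.size = 0 then 1 else 0 := by
  rw [h.counit, coord_empty_basis]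

theorem basis_eq_algebraMap (σ : StutPerm m) (hσ : σ.size = 0) :
    b σ = algebraMap K X (CoalgebraStruct.counit (R := K) (b σ)) := by
  rw [h.counit_basis, if_pos hσ, map_one, StutPerm.eq_empty_iff.2 hσ, h.empty]

theorem counit_one : CoalgebraStruct.counit (R := K) (1 : X) = 1 := by
  rw [← h.empty, h.counit_basis, StutPerm.size_empty, if_pos rfl]

theorem counit_mul (x y : X) : CoalgebraStruct.counit (R := K) (x * y) =
    CoalgebraStruct.counit (R := K) x * CoalgebraStruct.counit (R := K) y := by
  refine LinearMap.map_mul_iff _ |>.2 (b.ext fun σ => b.ext fun μ => ?_) x y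
  change CoalgebraStruct.counit (R := K) (b σ * b μ) =
    CoalgebraStruct.counit (R := K) (b σ) * CoalgebraStruct.counit (R := K) (b μ)
  by_cases hσ : σ.size = 0
  · rw [StutPerm.eq_empty_iff.2 hσ, h.empty, one_mul, h.counit_one, one_mul]
  · rw [h.counit_basis σ, if_neg hσ, zero_mul, h.mul, map_sum]
    refine Finset.sum_eq_zero fun ν hν => ?_
    have := size_of_mem_prodSet ((finite_prodSet σ μ).mem_toFinset.1 hν)
    rw [h.counit_basis, if_neg (by omega)]

theorem comul_one : CoalgebraStruct.comul (R := K) (1 : X) = 1 := by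
  have hlow : (StutPerm.empty m).low 0 = .empty m :=
    StutPerm.eq_empty_of_size (by rw [StutPerm.size_low, Nat.zero_min])
  rw [← h.empty, h.comul, ← finsum_mem_eq_finite_toFinset_sum, finsum_coprodSet,
    StutPerm.size_empty, zero_add, Finset.sum_range_one, StutPerm.high_zero, hlow, h.empty,
    Algebra.TensorProduct.one_def]

theorem isHopf (hmul : ∀ x y : X, CoalgebraStruct.comul (R := K) (x * y) =
    CoalgebraStruct.comul (R := K) x * CoalgebraStruct.comul (R := K) y) : IsHopf K X where
  counit_one := h.counit_one
  counit_mul := h.counit_mul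
  comul_one := h.comul_one
  comul_mul := hmul
  exists_antipode := exists_isAntipode_of_comul b h.comul (deg := StutPerm.size)
    (fun σ _ hp => size_add_of_mem_coprodSet ((finite_coprodSet σ).mem_toFinset.1 hp))
    h.basis_eq_algebraMap

end IsGBasis

end IsGBasis

/-! ### The Hopf algebra `FQSym^{(m)}` -/

section Realization

variable {K A : Type*} [Field K] {m : ℕ}

theorem separate_sum {B ι : Type*} (s : Finset ι) (f : ι → NCSeries K (A ⊕ₗ B)) :
    separate (∑ i ∈ s, f i) = ∑ i ∈ s, separate (f i) := by
  funext u v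
  refine (separate_eq_sum _ u v).trans
    ((Finset.sum_congr rfl fun w _ => NCSeries.sum_apply s f w).trans (Finset.sum_comm.trans ?_))
  rw [Finset.sum_apply, Finset.sum_apply]
  exact Finset.sum_congr rfl fun i _ => (separate_eq_sum (f i) u v).symm

variable [LinearOrder A]

theorem realizeTensor_tmul (x y : FQSym K A m) :
    realizeTensor K A m (x ⊗ₜ y) = seriesTensor K A A x y := rfl

theorem realizeTensor_mul (s t : (FQSym K A m) ⊗[K] (FQSym K A m)) :
    realizeTensor K A m (s * t) =
      pairMul K A A (realizeTensor K A m s) (realizeTensor K A m t) := by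
  induction s using TensorProduct.induction_on with
  | zero => rw [zero_mul, map_zero, map_zero, LinearMap.zero_apply]
  | add s s' hs hs' => rw [add_mul, map_add, map_add, map_add, hs, hs', LinearMap.add_apply]
  | tmul x y =>
    induction t using TensorProduct.induction_on with
    | zero => rw [mul_zero, map_zero, map_zero]
    | add s s' hs hs' => rw [mul_add, map_add, map_add, map_add, hs, hs']
    | tmul x' y' =>
      rw [Algebra.TensorProduct.tmul_mul_tmul, realizeTensor_tmul, realizeTensor_tmul,
        realizeTensor_tmul, ← seriesTensor_mul]
      rfl

variable [NeZero m] {b : Module.Basis (StutPerm m) K (FQSym K A m)}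
  (hb : ∀ σ, (b σ : NCSeries K A) = G K A σ)

include hb in
theorem realizeTensor_splitComul (σ : StutPerm m) :
    realizeTensor K A m (splitComul b (b σ)) = separate (G K (A ⊕ₗ A) σ) := by
  rw [splitComul_basis, map_sum, separate_G K A A]
  exact Finset.sum_congr rfl fun k _ => by rw [realizeTensor_tmul, hb, hb]

variable [Infinite A]
include hb

theorem coord_eq_coeffAt (σ : StutPerm m) :
    b.coord σ = coeffAt (wordOf A σ) ∘ₗ (FQSym K A m).val.toLinearMap := by
  classical
  refine b.ext fun τ => ?_
  rw [LinearMap.comp_apply, AlgHom.toLinearMap_apply, Subalgebra.coe_val, hb, coeffAt_wordOf_G,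
    coord_apply_basis]

theorem coord_tensorProduct_eq_realizeTensor (t : (FQSym K A m) ⊗[K] (FQSym K A m))
    (σ τ : StutPerm m) : (b.tensorProduct b).coord (σ, τ) t =
      realizeTensor K A m t (wordOf A σ) (wordOf A τ) := by
  rw [coord_tensorProduct, coord_eq_coeffAt hb, coord_eq_coeffAt hb]
  induction t using TensorProduct.induction_on with
  | zero => rw [map_zero, map_zero]; rfl
  | tmul x y => rfl
  | add s t hs ht => rw [map_add, map_add, hs, ht]; rfl

theorem realizeTensor_injective : Function.Injective (realizeTensor K A m) := fun s t hst =>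
  (b.tensorProduct b).ext_elem fun ⟨σ, τ⟩ => by
    rw [← Module.Basis.coord_apply, ← Module.Basis.coord_apply,
      coord_tensorProduct_eq_realizeTensor hb, coord_tensorProduct_eq_realizeTensor hb, hst]

theorem splitComul_mul (x y : FQSym K A m) :
    splitComul b (x * y) = splitComul b x * splitComul b y := by
  refine LinearMap.map_mul_iff _ |>.2 (b.ext fun σ => b.ext fun μ => ?_) x y
  refine realizeTensor_injective hb ?_
  change realizeTensor K A m (splitComul b (b σ * b μ)) =
    realizeTensor K A m (splitComul b (b σ) * splitComul b (b μ))
  have : Nonempty (A ⊕ₗ A) := inferInstanceAs (Nonempty (A ⊕ A))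
  rw [realizeTensor_mul, realizeTensor_splitComul hb, realizeTensor_splitComul hb,
    ← separate_mul, G_mul_G K (A ⊕ₗ A), basis_mul_basis hb, map_sum, map_sum, separate_sum]
  exact Finset.sum_congr rfl fun ν _ => realizeTensor_splitComul hb ν

theorem isGBasis_splitCoalgebra : @IsGBasis K _ _ _ _ (splitCoalgebra b) m _ b :=
  letI := splitCoalgebra b
  { empty := basis_empty hb
    mul := basis_mul_basis hb
    comul := splitComul_basis_eq_sum_coprodSet b
    counit := rfl }

theorem isHopf_FQSym : @IsHopf K _ _ _ _ (splitCoalgebra b) :=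
  letI := splitCoalgebra b
  (isGBasis_splitCoalgebra hb).isHopf (splitComul_mul hb)

end Realization

/-! ### The dual Hopf algebra -/

section Dual

variable {K X : Type*} [Field K] [Ring X] [Algebra K X] [Coalgebra K X] {m : ℕ} [NeZero m]
  {b : Module.Basis (StutPerm m) K X}

/-- The coproduct formula for the basis, as a Sweedler representation. -/
abbrev IsGBasis.repr (h : IsGBasis b) (σ : StutPerm m) :
    Coalgebra.Repr K (b σ) (StutPerm m × StutPerm m) where
  index := (finite_coprodSet σ).toFinset
  left p := b p.1
  right p := b p.2
  eq := (h.comul σ).symm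

theorem IsGBasis.toConv_coord_mul (h : IsGBasis b) (σ μ : StutPerm m) :
    WithConv.toConv (b.coord σ) * WithConv.toConv (b.coord μ) =
      ∑ ν ∈ (finite_coprodSet_fibre (σ, μ)).toFinset, WithConv.toConv (b.coord ν) := by
  classical
  refine WithConv.ofConv_injective (b.ext fun ν => ?_)
  have hsum : ∑ p ∈ (finite_coprodSet ν).toFinset, b.coord σ (b p.1) * b.coord μ (b p.2) =
      if (σ, μ) ∈ coprodSet ν then 1 else 0 := by
    simp only [coord_apply_basis, ite_zero_mul_ite_zero, mul_one, ← Prod.mk_inj, Prod.mk.eta,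
      Finset.sum_ite_eq, Set.Finite.mem_toFinset]
  rw [WithConv.ofConv_sum, LinearMap.sum_apply]
  refine ((h.repr ν).convMul_apply _ _).trans (hsum.trans ?_)
  simp only [coord_apply_basis, Finset.sum_ite_eq', Set.Finite.mem_toFinset, Set.mem_ofPred_eq]

theorem IsGBasis.toConv_coord_empty (h : IsGBasis b) :
    WithConv.toConv (b.coord (.empty m)) = 1 := by
  rw [← h.counit]
  rfl

theorem IsGBasis.exists_dual_basis (h : IsGBasis b) :
    ∃ (D : Subalgebra K (WithConv (X →ₗ[K] K))) (F : Module.Basis (StutPerm m) K D),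
      ∀ σ, toDual D (F σ) = b.coord σ := by
  classical
  have hli : LinearIndependent K fun σ => WithConv.toConv (b.coord σ) :=
    linearIndependent_of_dual _
      (fun σ => LinearMap.applyₗ (b σ) ∘ₗ (WithConv.linearEquiv K (X →ₗ[K] K)).toLinearMap)
      (fun σ τ hne => (coord_apply_basis b τ σ).trans (if_neg hne.symm))
      fun σ => (coord_apply_basis b σ σ).trans (if_pos rfl)
  obtain ⟨F, hF⟩ := exists_basis_adjoin (fun σ => WithConv.toConv (b.coord σ)) hli
    (h.toConv_coord_empty ▸ Submodule.subset_span ⟨_, rfl⟩) fun σ μ => by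
      rw [h.toConv_coord_mul]
      exact sum_mem fun ν _ => Submodule.subset_span ⟨ν, rfl⟩
  exact ⟨_, F, fun σ => congrArg WithConv.ofConv (hF σ)⟩

variable {D : Subalgebra K (WithConv (X →ₗ[K] K))} (F : Module.Basis (StutPerm m) K D)

/-- The coproduct transposed from the product: `F_ν` is sent to the sum of all `F_σ ⊗ F_μ` such
that `ν` occurs in `G_σ G_μ`. -/
def factorComul : D →ₗ[K] D ⊗[K] D :=
  F.constr K fun ν => ∑ p ∈ (finite_factorisations ν).toFinset, F p.1 ⊗ₜ[K] F p.2

theorem factorComul_basis (ν : StutPerm m) : factorComul F (F ν) =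
    ∑ p ∈ (finite_factorisations ν).toFinset, F p.1 ⊗ₜ[K] F p.2 :=
  F.constr_basis _ _ _

variable {F} (h : IsGBasis b) (hF : ∀ σ, toDual D (F σ) = b.coord σ)

include h hF in
theorem evalAt₂_basis_comp_factorComul (σ μ : StutPerm m) :
    evalAt₂ D (b σ) (b μ) ∘ₗ factorComul F = evalAt D (b σ * b μ) := by
  classical
  refine F.ext fun ν => ?_
  calc evalAt₂ D (b σ) (b μ) (factorComul F (F ν))
      = if (σ, μ) ∈ (finite_factorisations ν).toFinset then 1 else 0 := by
        simp only [factorComul_basis, map_sum, evalAt₂_tmul, evalAt_basis_basis b F hF,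
          ite_zero_mul_ite_zero, mul_one, ← Prod.mk_inj, Prod.mk.eta, Finset.sum_ite_eq]
    _ = if ν ∈ (finite_prodSet σ μ).toFinset then 1 else 0 := by
        simp only [Set.Finite.mem_toFinset, Set.mem_ofPred_eq]
    _ = evalAt D (b σ * b μ) (F ν) := by
        simp only [evalAt_apply, h.mul, hF, map_sum, coord_apply_basis, Finset.sum_ite_eq]

include h hF in
theorem dualPairing_factorComul (z : D) :
    dualPairing D (factorComul F z) = toDual D z ∘ₗ LinearMap.mul' K X :=
  (b.tensorProduct b).ext fun ⟨σ, μ⟩ => by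
    rw [Module.Basis.tensorProduct_apply, dualPairing_tmul, LinearMap.comp_apply,
      LinearMap.mul'_apply]
    exact LinearMap.congr_fun (evalAt₂_basis_comp_factorComul h hF σ μ) z

include h hF in
theorem evalAt₂_comp_factorComul (x y : X) :
    evalAt₂ D x y ∘ₗ factorComul F = evalAt D (x * y) := by
  refine LinearMap.ext fun z => ?_
  rw [LinearMap.comp_apply, ← dualPairing_tmul, dualPairing_factorComul h hF]
  rfl

include h hF in
theorem dual_basis_empty : F (.empty m) = 1 := by
  refine eq_of_evalAt b F hF fun σ => ?_
  rw [evalAt_apply, hF, evalAt_one, h.counit]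

/-- The coalgebra structure on the dual, transposed from the product. -/
abbrev factorCoalgebra : Coalgebra K D :=
  dualCoalgebra b F hF (factorComul F) (evalAt₂_comp_factorComul h hF)

theorem dual_basis_eq_algebraMap (σ : StutPerm m) (hσ : σ.size = 0) :
    F σ = algebraMap K D ((factorCoalgebra h hF).counit (F σ)) := by
  obtain rfl := StutPerm.eq_empty_of_size hσ
  change _ = algebraMap K D (evalAt D 1 (F _))
  rw [dual_basis_empty h hF, evalAt_one, h.counit_one, map_one]

theorem isHopf_dual (hX : IsHopf K X) : @IsHopf K D _ _ _ (factorCoalgebra h hF) :=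
  letI := factorCoalgebra h hF
  have hδ := evalAt₂_comp_factorComul h hF
  { counit_one := (evalAt_one (1 : X)).trans hX.counit_one
    counit_mul := dual_counit_mul hX.comul_one
    comul_one := dual_comul_one b F hF _ hδ hX.counit_mul
    comul_mul := dual_comul_mul b F hF _ hδ hX.comul_mul
    exists_antipode := exists_isAntipode_of_comul F (factorComul_basis F) (deg := StutPerm.size)
      (fun _ _ hp => size_add_of_mem_factorisations hp) (dual_basis_eq_algebraMap h hF) }

end Dual

/-! ### The Hopf subalgebra `PBT^{(m)}` -/

/-- `T₁` with `T₂` grafted to the left of its leftmost node, the lower bound of `P_{T₁} P_{T₂}`. -/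
def MBinTree.under {m : ℕ} [NeZero m] (T₁ T₂ : MBinTree m) : MBinTree m :=
  ⟨graftLeft T₂.tree T₁.tree, T₂.2.graftLeft T₁.2⟩

/-- `T₂` with `T₁` grafted to the right of its rightmost node, the upper bound of
`P_{T₁} P_{T₂}`. -/
def MBinTree.over {m : ℕ} [NeZero m] (T₁ T₂ : MBinTree m) : MBinTree m :=
  ⟨graftRight T₁.tree T₂.tree, T₁.2.graftRight T₂.2⟩

section Sylvester

variable {K X : Type*} [Field K] [Ring X] [Algebra K X] [Coalgebra K X] {m : ℕ} [NeZero m]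
  {D : Subalgebra K (WithConv (X →ₗ[K] K))} (F : Module.Basis (StutPerm m) K D)

/-- The sum `P_T` of the basis elements indexed by the sylvester class of `T`. -/
def sylvesterSum (T : MBinTree m) : D := ∑ σ ∈ (finite_sylvesterClass T).toFinset, F σ

variable {F} {b : Module.Basis (StutPerm m) K X} (h : IsGBasis b)
  (hF : ∀ σ, toDual D (F σ) = b.coord σ)

include hF in
open Classical in
theorem evalAt_sylvesterSum (ν : StutPerm m) (T : MBinTree m) :
    evalAt D (b ν) (sylvesterSum F T) = if ν.toTree = T then 1 else 0 := by
  simp only [sylvesterSum, map_sum, evalAt_basis_basis b F hF, Finset.sum_ite_eq,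
    Set.Finite.mem_toFinset, StutPerm.mem_sylvesterClass]

include h hF

theorem sylvesterSum_empty : sylvesterSum F (StutPerm.empty m).toTree = 1 := by
  classical
  refine eq_of_evalAt b F hF fun ν => ?_
  rw [evalAt_sylvesterSum hF, evalAt_one, h.counit_basis]
  refine if_congr ⟨fun hν => ?_, fun hν => by rw [StutPerm.eq_empty_iff.2 hν]⟩ rfl rfl
  rw [StutPerm.size_eq_of_toTree_eq hν, StutPerm.size_empty]

theorem sylvesterSum_mul (T₁ T₂ : MBinTree m) : sylvesterSum F T₁ * sylvesterSum F T₂ =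
    ∑ T ∈ (finite_Icc (T₁.under T₂) (T₁.over T₂)).toFinset, sylvesterSum F T := by
  classical
  refine eq_of_evalAt b F hF fun ν => ?_
  have hsplit : (∃ p ∈ (finite_coprodSet ν).toFinset, p.1.toTree = T₁ ∧ p.2.toTree = T₂) ↔
      ν.toTree ∈ (finite_Icc (T₁.under T₂) (T₁.over T₂)).toFinset := by
    rw [Set.Finite.mem_toFinset]
    refine Iff.trans ?_ (ν.exists_low_high_iff T₁ T₂)
    simp only [Set.Finite.mem_toFinset, mem_coprodSet]
    grind
  rw [evalAt_mul (h.repr ν), map_sum]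
  simp only [evalAt_sylvesterSum hF, ite_zero_mul_ite_zero, mul_one]
  rw [Finset.sum_ite_eq, sum_eq_indicator]
  · exact if_congr hsplit rfl rfl
  · intro p hp q hq hpT hqT
    rw [Set.Finite.mem_toFinset] at hp hq
    exact eq_of_mem_coprodSet hp hq (StutPerm.size_eq_of_toTree_eq (hpT.1.trans hqT.1.symm))

theorem exists_basis_sylvesterSum :
    ∃ (Q : Subalgebra K D) (P : Module.Basis (MBinTree m) K Q),
      ∀ T, (P T : D) = sylvesterSum F T := by
  classical
  have hrep := Function.surjInv_eq (StutPerm.toTree_surjective (m := m))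
  have hli : LinearIndependent K (sylvesterSum F) :=
    linearIndependent_of_dual _
      (fun T => evalAt D (b (Function.surjInv StutPerm.toTree_surjective T)))
      (fun T T' hne => (evalAt_sylvesterSum hF _ T').trans (if_neg (by rwa [hrep])))
      fun T => (evalAt_sylvesterSum hF _ T).trans (if_pos (hrep T))
  refine ⟨_, exists_basis_adjoin (sylvesterSum F) hli ?_ fun T T' => ?_⟩
  · rw [← sylvesterSum_empty h hF]
    exact Submodule.subset_span ⟨_, rfl⟩
  · rw [sylvesterSum_mul h hF]
    exact sum_mem fun T _ => Submodule.subset_span ⟨T, rfl⟩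

theorem evalAt_mul_sylvesterSum (σ μ : StutPerm m) (T : MBinTree m) :
    evalAt D (b σ * b μ) (sylvesterSum F T) = prodMultiplicity σ.toTree μ.toTree T := by
  classical
  rw [← card_prodSet_eq_prodMultiplicity, Finset.natCast_card_filter, evalAt_apply, h.mul, map_sum]
  exact Finset.sum_congr rfl fun ν _ => evalAt_sylvesterSum hF ν T

theorem factorComul_sylvesterSum (T : MBinTree m) : factorComul F (sylvesterSum F T) =
    ∑ p ∈ coprodTrees T,
      (prodMultiplicity p.1 p.2 T : K) • sylvesterSum F p.1 ⊗ₜ[K] sylvesterSum F p.2 := by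
  classical
  refine eq_of_evalAt₂ b F hF fun σ μ => ?_
  rw [← LinearMap.comp_apply, evalAt₂_comp_factorComul h hF, evalAt_mul_sylvesterSum h hF]
  simp only [map_sum, map_smul, evalAt₂_tmul, evalAt_sylvesterSum hF, ite_zero_mul_ite_zero,
    smul_eq_mul]
  simp only [← Prod.mk_inj, Prod.mk.eta, mul_ite, mul_one, mul_zero, Finset.sum_ite_eq]
  split_ifs with hmem
  · rfl
  · rw [prodMultiplicity_eq_zero hmem, Nat.cast_zero]

variable {Q : Subalgebra K D} {P : Module.Basis (MBinTree m) K Q}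
  (hP : ∀ T, (P T : D) = sylvesterSum F T)
include P hP

theorem factorComul_mem_range (z : Q) : factorComul F z ∈
    LinearMap.range (TensorProduct.map Q.val.toLinearMap Q.val.toLinearMap) := by
  induction P.mem_span z using Submodule.span_induction with
  | mem x hx =>
    obtain ⟨T, rfl⟩ := hx
    rw [hP, factorComul_sylvesterSum h hF]
    refine sum_mem fun p _ => Submodule.smul_mem _ _ ⟨P p.1 ⊗ₜ P p.2, ?_⟩
    rw [TensorProduct.map_tmul, ← hP, ← hP]
    rfl
  | zero => exact (factorComul F).map_zero ▸ zero_mem _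
  | add x y _ _ hx hy => rw [Subalgebra.coe_add, map_add]; exact add_mem hx hy
  | smul c x _ hx => rw [Subalgebra.coe_smul, map_smul]; exact Submodule.smul_mem _ c hx

theorem isHopfSubalgebra_sylvester : @IsHopfSubalgebra K D _ _ _ (factorCoalgebra h hF) Q :=
  letI := factorCoalgebra h hF
  isHopfSubalgebra_of_comul F (factorComul_basis F) (deg := StutPerm.size)
    (fun _ _ hp => size_add_of_mem_factorisations hp) (dual_basis_eq_algebraMap h hF)
    fun z hz => factorComul_mem_range h hF hP ⟨z, hz⟩

end Sylvester

end MStut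

end

theorem mainTheorem10 (K : Type*) [Field K] (m : ℕ) (hm : 1 ≤ m)
    (A : Type*) [LinearOrder A] [Infinite A] :
    -- every `m`-stuttering word has exactly one `m`-standardisation
    (∀ u : List A, IsStutWord m u → ∃! σ : StutPerm m, HasMStd u σ) ∧
    -- the product formula
    (∀ σ μ : StutPerm m, (prodSet σ μ).Finite ∧
      G K A σ * G K A μ = ∑ᶠ ν ∈ prodSet σ μ, G K A ν) ∧
    -- the coproduct formula: expansion over the doubled alphabet
    (∀ (B : Type*) [LinearOrder B] [Infinite B] (σ : StutPerm m), (coprodSet σ).Finite ∧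
      separate (G K (A ⊕ₗ B) σ) =
        ∑ᶠ p ∈ coprodSet σ, seriesTensor K A B (G K A p.1) (G K B p.2)) ∧
    -- the `G_σ` form a basis of `FQSym^{(m)}`, which is a Hopf algebra
    ∃ b : Module.Basis (StutPerm m) K (FQSym K A m),
      (∀ σ : StutPerm m, (b σ : NCSeries K A) = G K A σ) ∧
    ∃ _ : Coalgebra K (FQSym K A m), IsHopf K (FQSym K A m) ∧
      (∀ σ : StutPerm m,
        realizeTensor K A m (CoalgebraStruct.comul (R := K) (b σ)) =
          separate (G K (A ⊕ₗ A) σ) ∧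
        CoalgebraStruct.comul (R := K) (b σ) =
          ∑ᶠ p ∈ coprodSet σ, b p.1 ⊗ₜ[K] b p.2) ∧
    -- the dual Hopf algebra, with the dual basis `F_σ`
    ∃ (D : Subalgebra K (WithConv (FQSym K A m →ₗ[K] K)))
      (F : Module.Basis (StutPerm m) K D),
      (∀ σ : StutPerm m, toDual D (F σ) = b.coord σ) ∧
    ∃ _ : Coalgebra K D, IsHopf K D ∧
      (∀ (z : D) (x y : FQSym K A m),
        dualPairing D (CoalgebraStruct.comul (R := K) z) (x ⊗ₜ[K] y) = toDual D z (x * y)) ∧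
    -- `PBT^{(m)}` is a Hopf subalgebra of it
    ∃ (Q : Subalgebra K D) (P : Module.Basis (MBinTree m) K Q),
      (∀ T : MBinTree m, (sylvesterClass T).Finite ∧
        (P T : D) = ∑ᶠ σ ∈ sylvesterClass T, F σ) ∧
      IsHopfSubalgebra K Q ∧
      -- products are intervals of the `m`-Tamari order
      (∀ T₁ T₂ : MBinTree m, ∃ lo hi : MBinTree m,
        lo.tree = graftLeft T₂.tree T₁.tree ∧ hi.tree = graftRight T₁.tree T₂.tree ∧
        (Set.Icc lo hi).Finite ∧
        P T₁ * P T₂ = ∑ᶠ T ∈ Set.Icc lo hi, P T) := by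
  have : NeZero m := ⟨Nat.one_le_iff_ne_zero.mp hm⟩
  refine ⟨fun u hu => hu.existsUnique_hasMStd, fun σ μ => ⟨finite_prodSet σ μ, ?_⟩,
    fun B _ _ σ => ⟨finite_coprodSet σ, ?_⟩, ?_⟩
  · rw [G_mul_G K A, finsum_mem_eq_finite_toFinset_sum]
  · rw [separate_G K A B, finsum_coprodSet]
  obtain ⟨b, hb⟩ := exists_basis_FQSym K A m
  let := splitCoalgebra b
  have h : IsGBasis b := isGBasis_splitCoalgebra hb
  have hX : IsHopf K (FQSym K A m) := isHopf_FQSym hb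
  refine ⟨b, hb, splitCoalgebra b, hX, fun σ => ⟨realizeTensor_splitComul hb σ,
    (h.comul σ).trans (finsum_mem_eq_finite_toFinset_sum _ (finite_coprodSet σ)).symm⟩, ?_⟩
  obtain ⟨D, F, hF⟩ := h.exists_dual_basis
  refine ⟨D, F, hF, factorCoalgebra h hF, isHopf_dual h hF hX,
    fun z x y => LinearMap.congr_fun (dualPairing_factorComul h hF z) (x ⊗ₜ y), ?_⟩
  obtain ⟨Q, P, hP⟩ := exists_basis_sylvesterSum h hF
  refine ⟨Q, P, fun T => ⟨finite_sylvesterClass T, ?_⟩, isHopfSubalgebra_sylvester h hF hP,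
    fun T₁ T₂ => ⟨T₁.under T₂, T₁.over T₂, rfl, rfl, finite_Icc _ _, ?_⟩⟩
  · rw [hP, finsum_mem_eq_finite_toFinset_sum _ (finite_sylvesterClass T)]; rfl
  · exact (mul_eq_sum_of_coe hP (sylvesterSum_mul h hF T₁ T₂)).trans
      (finsum_mem_eq_finite_toFinset_sum _ (finite_Icc _ _)).symm
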